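/- Let $k$ be a field. A coquasi-bialgebra over $k$ is a coalgebra $(H,\Delta,\varepsilon)$ with a unital (not necessarily associative) multiplication such that multiplication and unit are coalgebra maps, together with a convolution invertible $\omega\in(H\otimes H\otimes H)^*$ satisfying, in Sweedler notation, $h_1(g_1l_1)\,\omega(h_2,g_2,l_2)=\omega(h_1,g_1,l_1)\,(h_2g_2)l_2$, $\ \omega(h_1,g_1,l_1m_1)\omega(h_2g_2,l_2,m_2)=\omega(g_1,l_1,m_1)\omega(h_1,g_2l_2,m_2)\omega(h_2,g_3,l_3)$ and $\omega(h,1,g)=\varepsilon(h)\varepsilon(g)$. It is a coquasi-Hopf algebra if it is endowed with a coalgebra antihomomorphism $S:H\to H$ (the antipode) and $\alpha,\beta\in H^*$ such that $S(h_1)\alpha(h_2)h_3=\alpha(h)1$, $h_1\beta(h_2)S(h_3)=\beta(h)1$ and $\omega(h_1\beta(h_2),S(h_3),\alpha(h_4)h_5)=\omega^{-1}(S(h_1),\alpha(h_2)h_3\beta(h_4),S(h_5))=\varepsilon(h)$. The category $\mathcal M^H$ of right $H$-comodules is monoidal with tensor product $\otimes_k$, codiagonal coaction and associativity $(u\otimes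 v)\otimes w\mapsto u_0\otimes(v_0\otimes w_0)\,\omega(u_1,v_1,w_1)$. A right $H$-comodule algebra $A$ is an algebra in $\mathcal M^H$; $\mathcal M_A^H$ and ${}_A\mathcal M_A^H$ denote the categories of right $A$-modules and of $A$-bimodules in $\mathcal M^H$, the latter being monoidal with respect to the tensor product $\bigcirc_A$ over $A$ formed in $\mathcal M^H$ (the coequalizer of the two maps $(M\otimes A)\otimes N\rightrightarrows M\otimes N$) and with unit $A$. For a comodule $M$ put $M^{coH}=\{m\in M: m_0\otimes m_1=m\otimes 1\}$; then $B=A^{coH}$ is an associative $k$-algebra. Let $H$ be a coquasi-Hopf algebra over $k$ with bijective antipode and let $A$ be a right $H$-comodule algebra such that, with $B=A^{coH}$, the algebra $A$ is faithfully flat as a left $B$-module and is a Galois extension of $B$, i.e. the map $$A\otimes_BA\to A\otimes H,\qquad a\otimes_B b\mapsto a_0b_0\otimes\omega^{-1}(a_1,b_1\beta(b_2),S(b_3))\,b_4$$ is bijective. Then the coinvariant functor $(-)^{coH}:\mathcal M_A^H\to\mathcal M_B$ is an equivalence, and it induces (restricting also the left $A$-action on $M$ to a left $B$-action on $M^{coH}$)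 a functor $(-)^{coH}:{}_A\mathcal M_A^H\to{}_B\mathcal M_B$, where ${}_B\mathcal M_B$ is monoidal with respect to $\otimes_B$, and this functor is (strong) monoidal. Its structure isomorphisms are the maps $M^{coH}\otimes_BN^{coH}\to(M\bigcirc_AN)^{coH}$, $m\otimes_Bn\mapsto[m\otimes n]$, and the identity $B\to A^{coH}$. -/

import Mathlib

universe u

open CategoryTheory MonoidalCategory Limits TensorProduct

namespace CoquasiGalois

noncomputable section Linear

variable {k : Type*} [CommRing k]
variable {C D : Type*} [AddCommGroup C] [Module k C] [AddCommGroup D] [Module k D]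
variable {V W : Type*} [AddCommGroup V] [Module k V] [AddCommGroup W] [Module k W]

/-- `v ↦ f(v₁) v₀` for a coaction `ρ v = v₀ ⊗ v₁` and a functional `f` on the coalgebra. -/
def act (ρ : V →ₗ[k] V ⊗[k] C) (f : C →ₗ[k] k) : V →ₗ[k] V :=
  (TensorProduct.rid k V).toLinearMap ∘ₗ f.lTensor V ∘ₗ ρ

/-- The coaction `v ⊗ w ↦ (v₀ ⊗ w₀) ⊗ (v₁ ⊗ w₁)` of `C ⊗ D` on `V ⊗ W`. -/
def ext (ρ : V →ₗ[k] V ⊗[k] C) (σ : W →ₗ[k] W ⊗[k] D) :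
    V ⊗[k] W →ₗ[k] (V ⊗[k] W) ⊗[k] (C ⊗[k] D) :=
  (TensorProduct.tensorTensorTensorComm k V C W D).toLinearMap ∘ₗ TensorProduct.map ρ σ

theorem ext_tmul (ρ : V →ₗ[k] V ⊗[k] C) (σ : W →ₗ[k] W ⊗[k] D) (v : V) (w : W) :
    ext ρ σ (v ⊗ₜ w) = TensorProduct.tensorTensorTensorComm k V C W D (ρ v ⊗ₜ σ w) := rfl

theorem act_natural {ρ : V →ₗ[k] V ⊗[k] C} {σ : W →ₗ[k] W ⊗[k] D} {T : V →ₗ[k] W}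
    {t : C →ₗ[k] D} (h : σ ∘ₗ T = TensorProduct.map T t ∘ₗ ρ) (g : D →ₗ[k] k) :
    act σ g ∘ₗ T = T ∘ₗ act ρ (g ∘ₗ t) := by
  have h1 : (TensorProduct.rid k W).toLinearMap ∘ₗ g.lTensor W ∘ₗ TensorProduct.map T t =
      T ∘ₗ (TensorProduct.rid k V).toLinearMap ∘ₗ (g ∘ₗ t).lTensor V := by
    ext v c
    simp
  calc _ = (TensorProduct.rid k W).toLinearMap ∘ₗ g.lTensor W ∘ₗ (σ ∘ₗ T) := rfl
    _ = ((TensorProduct.rid k W).toLinearMap ∘ₗ g.lTensor W ∘ₗ TensorProduct.map T t) ∘ₗ ρ := by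
      rw [h]; rfl
    _ = _ := by rw [h1]; rfl

variable [Coalgebra k C]

/-- `ρ : V → V ⊗ C` is a right coaction of the coalgebra `C` on `V`: it is coassociative and
counital. In Sweedler notation, `ρ v = v₀ ⊗ v₁`. -/
structure IsCoaction (ρ : V →ₗ[k] V ⊗[k] C) : Prop where
  coassoc : (TensorProduct.assoc k V C C).toLinearMap ∘ₗ ρ.rTensor C ∘ₗ ρ =
    (Coalgebra.comul (R := k) (A := C)).lTensor V ∘ₗ ρ
  counit : (TensorProduct.rid k V).toLinearMap ∘ₗ
    (Coalgebra.counit (R := k) (A := C)).lTensor V ∘ₗ ρ = LinearMap.id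

/-- `c ↦ f(c₂) c₁`. -/
def hitRight (f : C →ₗ[k] k) : C →ₗ[k] C :=
  (TensorProduct.rid k C).toLinearMap ∘ₗ f.lTensor C ∘ₗ Coalgebra.comul

/-- `c ↦ f(c₁) c₂`. -/
def hitLeft (f : C →ₗ[k] k) : C →ₗ[k] C :=
  (TensorProduct.lid k C).toLinearMap ∘ₗ f.rTensor C ∘ₗ Coalgebra.comul

/-- The convolution product of functionals, `c ↦ f(c₁) g(c₂)`. -/
def conv (f g : C →ₗ[k] k) : C →ₗ[k] k :=
  (TensorProduct.lid k k).toLinearMap ∘ₗ TensorProduct.map f g ∘ₗ Coalgebra.comul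

theorem IsCoaction.ext [Coalgebra k D] {ρ : V →ₗ[k] V ⊗[k] C} {σ : W →ₗ[k] W ⊗[k] D}
    (hρ : IsCoaction ρ) (hσ : IsCoaction σ) : IsCoaction (ext ρ σ) where
  coassoc := by
    let S : (V ⊗[k] (C ⊗[k] C)) ⊗[k] (W ⊗[k] (D ⊗[k] D)) →ₗ[k]
        (V ⊗[k] W) ⊗[k] ((C ⊗[k] D) ⊗[k] (C ⊗[k] D)) :=
      ((TensorProduct.tensorTensorTensorComm k C C D D).toLinearMap).lTensor _ ∘ₗ
        (TensorProduct.tensorTensorTensorComm k V (C ⊗[k] C) W (D ⊗[k] D)).toLinearMap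
    have h1 : (TensorProduct.assoc k (V ⊗[k] W) (C ⊗[k] D) (C ⊗[k] D)).toLinearMap ∘ₗ
        (CoquasiGalois.ext ρ σ).rTensor (C ⊗[k] D) ∘ₗ
          (TensorProduct.tensorTensorTensorComm k V C W D).toLinearMap =
        S ∘ₗ TensorProduct.map ((TensorProduct.assoc k V C C).toLinearMap ∘ₗ ρ.rTensor C)
          ((TensorProduct.assoc k W D D).toLinearMap ∘ₗ σ.rTensor D) := by
      ext v c w d
      simp only [CoquasiGalois.ext, S, TensorProduct.AlgebraTensorModule.curry_apply,
        TensorProduct.curry_apply, LinearMap.coe_restrictScalars, LinearMap.comp_apply,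
        LinearEquiv.coe_coe, TensorProduct.tensorTensorTensorComm_tmul, LinearMap.rTensor_tmul,
        TensorProduct.map_tmul]
      generalize ρ v = x
      generalize σ w = y
      induction x with
      | zero => simp
      | add a b ha hb => simp only [add_tmul, map_add, ha, hb]
      | tmul a b =>
        induction y with
        | zero => simp
        | add a b ha hb => simp only [tmul_add, add_tmul, map_add, ha, hb]
        | tmul a b => simp
    have h2 : (Coalgebra.comul (R := k) (A := C ⊗[k] D)).lTensor (V ⊗[k] W) ∘ₗ
          (TensorProduct.tensorTensorTensorComm k V C W D).toLinearMap =
        S ∘ₗ TensorProduct.map ((Coalgebra.comul (R := k) (A := C)).lTensor V)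
          ((Coalgebra.comul (R := k) (A := D)).lTensor W) := by
      ext v c w d
      simp only [S, TensorProduct.AlgebraTensorModule.curry_apply,
        TensorProduct.curry_apply, LinearMap.coe_restrictScalars, LinearMap.comp_apply,
        LinearEquiv.coe_coe, TensorProduct.tensorTensorTensorComm_tmul, LinearMap.lTensor_tmul,
        TensorProduct.map_tmul]
      rfl
    calc _ = ((TensorProduct.assoc k (V ⊗[k] W) (C ⊗[k] D) (C ⊗[k] D)).toLinearMap ∘ₗ
        (CoquasiGalois.ext ρ σ).rTensor (C ⊗[k] D) ∘ₗ
          (TensorProduct.tensorTensorTensorComm k V C W D).toLinearMap) ∘ₗ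
            TensorProduct.map ρ σ := rfl
      _ = S ∘ₗ TensorProduct.map ((Coalgebra.comul (R := k) (A := C)).lTensor V)
          ((Coalgebra.comul (R := k) (A := D)).lTensor W) ∘ₗ TensorProduct.map ρ σ := by
        rw [h1, LinearMap.comp_assoc, ← TensorProduct.map_comp,
          ← TensorProduct.map_comp, ← hρ.coassoc, ← hσ.coassoc]
        rfl
      _ = _ := by rw [← LinearMap.comp_assoc, ← h2]; rfl
  counit := by
    have h : (TensorProduct.rid k (V ⊗[k] W)).toLinearMap ∘ₗ
        (Coalgebra.counit (R := k) (A := C ⊗[k] D)).lTensor (V ⊗[k] W) ∘ₗ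
          (TensorProduct.tensorTensorTensorComm k V C W D).toLinearMap =
        TensorProduct.map ((TensorProduct.rid k V).toLinearMap ∘ₗ
          (Coalgebra.counit (R := k) (A := C)).lTensor V)
          ((TensorProduct.rid k W).toLinearMap ∘ₗ
          (Coalgebra.counit (R := k) (A := D)).lTensor W) := by
      ext v c w d
      simp [smul_tmul', tmul_smul, smul_smul, mul_comm]
    calc _ = ((TensorProduct.rid k (V ⊗[k] W)).toLinearMap ∘ₗ
        (Coalgebra.counit (R := k) (A := C ⊗[k] D)).lTensor (V ⊗[k] W) ∘ₗ
          (TensorProduct.tensorTensorTensorComm k V C W D).toLinearMap) ∘ₗ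
            TensorProduct.map ρ σ := rfl
      _ = _ := by
        rw [h, ← TensorProduct.map_comp, LinearMap.comp_assoc, LinearMap.comp_assoc, hρ.counit,
          hσ.counit, TensorProduct.map_id]

theorem IsCoaction.map [Coalgebra k D] {ρ : V →ₗ[k] V ⊗[k] C} (hρ : IsCoaction ρ) (f : C →ₗ[k] D)
    (hc : Coalgebra.comul ∘ₗ f = TensorProduct.map f f ∘ₗ Coalgebra.comul (R := k))
    (he : Coalgebra.counit ∘ₗ f = Coalgebra.counit (R := k)) :
    IsCoaction (f.lTensor V ∘ₗ ρ) where
  coassoc := by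
    have h1 : (TensorProduct.assoc k V D D).toLinearMap ∘ₗ
        (f.lTensor V ∘ₗ ρ).rTensor D ∘ₗ f.lTensor V = (TensorProduct.map f f).lTensor V ∘ₗ
        (TensorProduct.assoc k V C C).toLinearMap ∘ₗ ρ.rTensor C := by
      ext v c
      simp only [TensorProduct.AlgebraTensorModule.curry_apply,
        TensorProduct.curry_apply, LinearMap.coe_restrictScalars, LinearMap.comp_apply,
        LinearEquiv.coe_coe, LinearMap.lTensor_tmul, LinearMap.rTensor_tmul]
      generalize ρ v = x
      induction x with
      | zero => simp
      | add a b ha hb => simp only [add_tmul, map_add, ha, hb]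
      | tmul a b => simp
    calc _ = ((TensorProduct.assoc k V D D).toLinearMap ∘ₗ
        (f.lTensor V ∘ₗ ρ).rTensor D ∘ₗ f.lTensor V) ∘ₗ ρ := rfl
      _ = (TensorProduct.map f f).lTensor V ∘ₗ
        ((TensorProduct.assoc k V C C).toLinearMap ∘ₗ ρ.rTensor C ∘ₗ ρ) := by rw [h1]; rfl
      _ = _ := by
        rw [hρ.coassoc, ← LinearMap.comp_assoc, ← LinearMap.lTensor_comp, ← hc,
          LinearMap.lTensor_comp, LinearMap.comp_assoc]
  counit := by
    rw [← LinearMap.comp_assoc _ _ (LinearMap.lTensor _ _), ← LinearMap.lTensor_comp, he,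
      hρ.counit]

theorem act_counit {ρ : V →ₗ[k] V ⊗[k] C} (hρ : IsCoaction ρ) :
    act ρ Coalgebra.counit = LinearMap.id := hρ.counit

/-- `v₀ ⊗ v₁ g(v₂)`, computed in two ways. -/
theorem lTensor_hitRight {ρ : V →ₗ[k] V ⊗[k] C} (hρ : IsCoaction ρ) (g : C →ₗ[k] k) :
    (hitRight g).lTensor V ∘ₗ ρ = ρ ∘ₗ act ρ g := by
  have h1 : ρ ∘ₗ (TensorProduct.rid k V).toLinearMap ∘ₗ g.lTensor V =
      ((TensorProduct.rid k C).toLinearMap ∘ₗ g.lTensor C).lTensor V ∘ₗ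
        (TensorProduct.assoc k V C C).toLinearMap ∘ₗ ρ.rTensor C := by
    ext v c
    simp only [TensorProduct.AlgebraTensorModule.curry_apply,
        TensorProduct.curry_apply, LinearMap.coe_restrictScalars, LinearMap.comp_apply,
        LinearEquiv.coe_coe, LinearMap.lTensor_tmul, LinearMap.rTensor_tmul,
        TensorProduct.rid_tmul, map_smul]
    generalize ρ v = x
    induction x with
    | zero => simp
    | add a b ha hb => simp only [add_tmul, smul_add, map_add, ha, hb]
    | tmul a b => simp
  calc _ = ((TensorProduct.rid k C).toLinearMap ∘ₗ g.lTensor C).lTensor V ∘ₗ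
        ((Coalgebra.comul (R := k) (A := C)).lTensor V ∘ₗ ρ) := by
        rw [← LinearMap.comp_assoc, ← LinearMap.lTensor_comp]; rfl
    _ = (((TensorProduct.rid k C).toLinearMap ∘ₗ g.lTensor C).lTensor V ∘ₗ
        (TensorProduct.assoc k V C C).toLinearMap ∘ₗ ρ.rTensor C) ∘ₗ ρ := by
        rw [← hρ.coassoc]; rfl
    _ = _ := by rw [← h1]; rfl

/-- `v₀ ⊗ g(v₁) v₂`, computed in two ways. -/
theorem lTensor_hitLeft {ρ : V →ₗ[k] V ⊗[k] C} (hρ : IsCoaction ρ) (g : C →ₗ[k] k) :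
    (hitLeft g).lTensor V ∘ₗ ρ = (act ρ g).rTensor C ∘ₗ ρ := by
  have h1 : (act ρ g).rTensor C =
      ((TensorProduct.lid k C).toLinearMap ∘ₗ g.rTensor C).lTensor V ∘ₗ
        (TensorProduct.assoc k V C C).toLinearMap ∘ₗ ρ.rTensor C := by
    ext v c
    simp only [act, TensorProduct.AlgebraTensorModule.curry_apply,
        TensorProduct.curry_apply, LinearMap.coe_restrictScalars, LinearMap.comp_apply,
        LinearEquiv.coe_coe, LinearMap.rTensor_tmul]
    generalize ρ v = x
    induction x with
    | zero => simp
    | add a b ha hb => simp only [add_tmul, map_add, ha, hb]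
    | tmul a b => simp [smul_tmul]
  calc _ = ((TensorProduct.lid k C).toLinearMap ∘ₗ g.rTensor C).lTensor V ∘ₗ
        ((Coalgebra.comul (R := k) (A := C)).lTensor V ∘ₗ ρ) := by
        rw [← LinearMap.comp_assoc, ← LinearMap.lTensor_comp]; rfl
    _ = (((TensorProduct.lid k C).toLinearMap ∘ₗ g.rTensor C).lTensor V ∘ₗ
        (TensorProduct.assoc k V C C).toLinearMap ∘ₗ ρ.rTensor C) ∘ₗ ρ := by
        rw [← hρ.coassoc]; rfl
    _ = _ := by rw [← h1]

theorem conv_eq (f g : C →ₗ[k] k) : conv f g = f ∘ₗ hitRight g := by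
  have : (TensorProduct.lid k k).toLinearMap ∘ₗ TensorProduct.map f g =
      f ∘ₗ (TensorProduct.rid k C).toLinearMap ∘ₗ g.lTensor C := by
    ext v c
    simp [mul_comm]
  rw [conv, ← LinearMap.comp_assoc, this]
  rfl

theorem act_conv {ρ : V →ₗ[k] V ⊗[k] C} (hρ : IsCoaction ρ) (f g : C →ₗ[k] k) :
    act ρ (conv f g) = act ρ f ∘ₗ act ρ g := by
  rw [conv_eq, act, LinearMap.lTensor_comp, LinearMap.comp_assoc, lTensor_hitRight hρ]
  rfl

/-- If `f(c₁) ω(c₂) = ω(c₁) g(c₂)`, then the map `v ↦ v₀ ω(v₁)` is colinear from the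
coaction pushed forward along `g` to the one pushed forward along `f`. -/
theorem act_colinear {ρ : V →ₗ[k] V ⊗[k] C} (hρ : IsCoaction ρ) {f g : C →ₗ[k] D}
    {ω : C →ₗ[k] k} (h : f ∘ₗ hitRight ω = g ∘ₗ hitLeft ω) :
    (f.lTensor V ∘ₗ ρ) ∘ₗ act ρ ω = (act ρ ω).rTensor D ∘ₗ (g.lTensor V ∘ₗ ρ) := by
  rw [LinearMap.comp_assoc, ← lTensor_hitRight hρ, ← LinearMap.comp_assoc,
    ← LinearMap.lTensor_comp, h, LinearMap.lTensor_comp, LinearMap.comp_assoc,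
    lTensor_hitLeft hρ, ← LinearMap.comp_assoc, ← LinearMap.comp_assoc]
  congr 1
  ext v c
  simp

end Linear

noncomputable section Coquasi

section ExtLemmas

variable {k : Type*} [CommRing k]
variable {C D C' D' : Type*} [AddCommGroup C] [Module k C] [AddCommGroup D] [Module k D]
  [AddCommGroup C'] [Module k C'] [AddCommGroup D'] [Module k D']
variable {V W V' W' : Type*} [AddCommGroup V] [Module k V] [AddCommGroup W] [Module k W]
  [AddCommGroup V'] [Module k V'] [AddCommGroup W'] [Module k W']

theorem ext_natural {ρ : V →ₗ[k] V ⊗[k] C} {σ : W →ₗ[k] W ⊗[k] D}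
    {ρ' : V' →ₗ[k] V' ⊗[k] C'} {σ' : W' →ₗ[k] W' ⊗[k] D'}
    {S : V →ₗ[k] V'} {s : C →ₗ[k] C'} {T : W →ₗ[k] W'} {t : D →ₗ[k] D'}
    (hS : ρ' ∘ₗ S = TensorProduct.map S s ∘ₗ ρ) (hT : σ' ∘ₗ T = TensorProduct.map T t ∘ₗ σ) :
    ext ρ' σ' ∘ₗ TensorProduct.map S T =
      TensorProduct.map (TensorProduct.map S T) (TensorProduct.map s t) ∘ₗ ext ρ σ := by
  have h : (TensorProduct.tensorTensorTensorComm k V' C' W' D').toLinearMap ∘ₗ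
      TensorProduct.map (TensorProduct.map S s) (TensorProduct.map T t) =
      TensorProduct.map (TensorProduct.map S T) (TensorProduct.map s t) ∘ₗ
      (TensorProduct.tensorTensorTensorComm k V C W D).toLinearMap := by
    ext v c w d
    simp
  rw [ext, LinearMap.comp_assoc, ← TensorProduct.map_comp, hS, hT, TensorProduct.map_comp,
    ← LinearMap.comp_assoc, h, LinearMap.comp_assoc]
  rfl

theorem ext_lTensor (ρ : V →ₗ[k] V ⊗[k] C) (σ : W →ₗ[k] W ⊗[k] D) (s : C →ₗ[k] C')
    (t : D →ₗ[k] D') : ext (s.lTensor V ∘ₗ ρ) (t.lTensor W ∘ₗ σ) =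
      (TensorProduct.map s t).lTensor (V ⊗[k] W) ∘ₗ ext ρ σ := by
  have h := ext_natural (ρ := ρ) (σ := σ) (ρ' := s.lTensor V ∘ₗ ρ) (σ' := t.lTensor W ∘ₗ σ)
    (S := LinearMap.id) (s := s) (T := LinearMap.id) (t := t) rfl rfl
  rwa [TensorProduct.map_id, LinearMap.comp_id] at h

theorem act_lTensor (ρ : V →ₗ[k] V ⊗[k] C) (s : C →ₗ[k] C') (f : C' →ₗ[k] k) :
    act (s.lTensor V ∘ₗ ρ) f = act ρ (f ∘ₗ s) := by
  rw [act, ← LinearMap.comp_assoc _ _ (LinearMap.lTensor _ _), ← LinearMap.lTensor_comp]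
  rfl

theorem act_ext (ρ : V →ₗ[k] V ⊗[k] C) (σ : W →ₗ[k] W ⊗[k] D) (f : C →ₗ[k] k)
    (g : D →ₗ[k] k) : act (ext ρ σ) ((TensorProduct.lid k k).toLinearMap ∘ₗ
      TensorProduct.map f g) = TensorProduct.map (act ρ f) (act σ g) := by
  have h : (TensorProduct.rid k (V ⊗[k] W)).toLinearMap ∘ₗ
      ((TensorProduct.lid k k).toLinearMap ∘ₗ TensorProduct.map f g).lTensor _ ∘ₗ
      (TensorProduct.tensorTensorTensorComm k V C W D).toLinearMap =
      TensorProduct.map ((TensorProduct.rid k V).toLinearMap ∘ₗ f.lTensor V)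
        ((TensorProduct.rid k W).toLinearMap ∘ₗ g.lTensor W) := by
    ext v c w d
    simp [smul_tmul', tmul_smul, smul_smul, mul_comm]
  calc _ = ((TensorProduct.rid k (V ⊗[k] W)).toLinearMap ∘ₗ
      ((TensorProduct.lid k k).toLinearMap ∘ₗ TensorProduct.map f g).lTensor _ ∘ₗ
      (TensorProduct.tensorTensorTensorComm k V C W D).toLinearMap) ∘ₗ
        TensorProduct.map ρ σ := rfl
    _ = _ := by rw [h, ← TensorProduct.map_comp]; rfl

theorem ext_assoc {X E : Type*} [AddCommGroup X] [Module k X] [AddCommGroup E] [Module k E]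
    (ρ : V →ₗ[k] V ⊗[k] C) (σ : W →ₗ[k] W ⊗[k] D) (τ : X →ₗ[k] X ⊗[k] E) :
    ext ρ (ext σ τ) ∘ₗ (TensorProduct.assoc k V W X).toLinearMap =
      TensorProduct.map (TensorProduct.assoc k V W X).toLinearMap
        (TensorProduct.assoc k C D E).toLinearMap ∘ₗ ext (ext ρ σ) τ := by
  ext v w x
  simp only [TensorProduct.AlgebraTensorModule.curry_apply,
    TensorProduct.curry_apply, LinearMap.coe_restrictScalars, LinearMap.comp_apply,
    LinearEquiv.coe_coe, TensorProduct.assoc_tmul, ext_tmul]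
  generalize ρ v = a
  generalize σ w = b
  generalize τ x = e
  induction a with
  | zero => simp
  | add a b ha hb => simp only [add_tmul, map_add, ha, hb]
  | tmul v c =>
    induction b with
    | zero => simp
    | add a b ha hb => simp only [add_tmul, tmul_add, map_add, ha, hb]
    | tmul v c =>
      induction e with
      | zero => simp
      | add a b ha hb => simp only [tmul_add, map_add, ha, hb]
      | tmul v c => simp

end ExtLemmas

section Classes

variable (k : Type*) [Field k]
variable (H : Type*) [NonAssocRing H] [Module k H] [IsScalarTower k H H] [SMulCommClass k H H]

/-- `h ⊗ (g ⊗ l) ↦ h (g l)`. -/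
def mulR : H ⊗[k] (H ⊗[k] H) →ₗ[k] H := LinearMap.mul' k H ∘ₗ (LinearMap.mul' k H).lTensor H

/-- `h ⊗ (g ⊗ l) ↦ (h g) l`. -/
def mulL : H ⊗[k] (H ⊗[k] H) →ₗ[k] H :=
  LinearMap.mul' k H ∘ₗ (LinearMap.mul' k H).rTensor H ∘ₗ
    (TensorProduct.assoc k H H H).symm.toLinearMap

/-- A coquasi-bialgebra over `k`: a coassociative coalgebra `H` with a unital (not necessarily
associative) multiplication, such that multiplication and unit are coalgebra maps, together with
a convolution invertible `ω : H ⊗ H ⊗ H → k` satisfying the axioms below. -/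
class CoquasiBialgebra [Coalgebra k H] where
  /-- multiplication is a coalgebra map -/
  comul_mul : Coalgebra.comul (R := k) ∘ₗ LinearMap.mul' k H =
    TensorProduct.map (LinearMap.mul' k H) (LinearMap.mul' k H) ∘ₗ Coalgebra.comul (R := k)
  counit_mul : Coalgebra.counit (R := k) ∘ₗ LinearMap.mul' k H = Coalgebra.counit (R := k)
  /-- the unit is a coalgebra map -/
  comul_one : Coalgebra.comul (R := k) (1 : H) = 1 ⊗ₜ[k] 1
  counit_one : Coalgebra.counit (R := k) (1 : H) = 1
  /-- the reassociator -/
  ω : H ⊗[k] (H ⊗[k] H) →ₗ[k] k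
  /-- the convolution inverse of the reassociator -/
  ωInv : H ⊗[k] (H ⊗[k] H) →ₗ[k] k
  ω_conv_ωInv : conv ω ωInv = Coalgebra.counit
  ωInv_conv_ω : conv ωInv ω = Coalgebra.counit
  /-- `h₁(g₁l₁) ω(h₂,g₂,l₂) = ω(h₁,g₁,l₁) (h₂g₂)l₂` -/
  quasi_assoc : mulR k H ∘ₗ hitRight ω = mulL k H ∘ₗ hitLeft ω
  /-- `ω(h₁,g₁,l₁m₁) ω(h₂g₂,l₂,m₂) = ω(g₁,l₁,m₁) ω(h₁,g₂l₂,m₂) ω(h₂,g₃,l₃)`; the five factors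
  are, in this order, functionals of `h ⊗ (g ⊗ (l ⊗ m))`. -/
  cocycle :
    conv (ω ∘ₗ ((LinearMap.mul' k H).lTensor H).lTensor H)
      (ω ∘ₗ (LinearMap.mul' k H).rTensor (H ⊗[k] H) ∘ₗ
        (TensorProduct.assoc k H H (H ⊗[k] H)).symm.toLinearMap) =
    conv ((TensorProduct.lid k k).toLinearMap ∘ₗ TensorProduct.map Coalgebra.counit ω)
      (conv (ω ∘ₗ ((LinearMap.mul' k H).rTensor H ∘ₗ
          (TensorProduct.assoc k H H H).symm.toLinearMap).lTensor H)
        ((TensorProduct.lid k k).toLinearMap ∘ₗ TensorProduct.map ω Coalgebra.counit ∘ₗ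
          (TensorProduct.assoc k H (H ⊗[k] H) H).symm.toLinearMap ∘ₗ
          (TensorProduct.assoc k H H H).symm.toLinearMap.lTensor H))
  ω_one : ∀ h g : H, ω (h ⊗ₜ (1 ⊗ₜ g)) =
    Coalgebra.counit (R := k) h * Coalgebra.counit (R := k) g

/-- A coquasi-Hopf algebra over `k`: a coquasi-bialgebra with an antipode `S` and functionals
`α`, `β`. -/
class CoquasiHopfAlgebra [Coalgebra k H] extends CoquasiBialgebra k H where
  /-- the antipode -/
  S : H →ₗ[k] H
  α : H →ₗ[k] k
  β : H →ₗ[k] k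
  /-- `S` is an antihomomorphism of coalgebras: `S(h)₁ ⊗ S(h)₂ = S(h₂) ⊗ S(h₁)` -/
  comul_S : Coalgebra.comul (R := k) ∘ₗ S = TensorProduct.map S S ∘ₗ
    (TensorProduct.comm k H H).toLinearMap ∘ₗ Coalgebra.comul (R := k)
  counit_S : Coalgebra.counit (R := k) ∘ₗ S = Coalgebra.counit (R := k)
  /-- `S(h₁) α(h₂) h₃ = α(h) 1` -/
  S_α_id : ∀ h : H, LinearMap.mul' k H (TensorProduct.map S (hitLeft α)
    (Coalgebra.comul (R := k) h)) = α h • (1 : H)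
  /-- `h₁ β(h₂) S(h₃) = β(h) 1` -/
  id_β_S : ∀ h : H, LinearMap.mul' k H (TensorProduct.map (hitRight β) S
    (Coalgebra.comul (R := k) h)) = β h • (1 : H)
  /-- `ω(h₁β(h₂), S(h₃), α(h₄)h₅) = ε(h)` -/
  ω_S : ∀ h : H, ω (TensorProduct.map (hitRight β)
    (TensorProduct.map S (hitLeft α) ∘ₗ Coalgebra.comul (R := k))
      (Coalgebra.comul (R := k) h)) = Coalgebra.counit (R := k) h
  /-- `ω⁻¹(S(h₁), α(h₂)h₃β(h₄), S(h₅)) = ε(h)` -/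
  ωInv_S : ∀ h : H, ωInv (TensorProduct.map S
    (TensorProduct.map (hitLeft α ∘ₗ hitRight β) S ∘ₗ Coalgebra.comul (R := k))
      (Coalgebra.comul (R := k) h)) = Coalgebra.counit (R := k) h

end Classes

section Reassociator

open CoquasiBialgebra

variable {k : Type*} [Field k]
variable {H : Type*} [NonAssocRing H] [Module k H] [IsScalarTower k H H] [SMulCommClass k H H]
variable {U V W X : Type*} [AddCommGroup U] [Module k U] [AddCommGroup V] [Module k V]
  [AddCommGroup W] [Module k W] [AddCommGroup X] [Module k X]

/-- The codiagonal coaction `v ⊗ w ↦ (v₀ ⊗ w₀) ⊗ v₁w₁` on the tensor product. -/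
def codiagCoact (ρ : V →ₗ[k] V ⊗[k] H) (σ : W →ₗ[k] W ⊗[k] H) :
    V ⊗[k] W →ₗ[k] (V ⊗[k] W) ⊗[k] H :=
  (LinearMap.mul' k H).lTensor (V ⊗[k] W) ∘ₗ ext ρ σ

theorem codiag_codiag (ρ : U →ₗ[k] U ⊗[k] H) (σ : V →ₗ[k] V ⊗[k] H) (τ : W →ₗ[k] W ⊗[k] H) :
    codiagCoact ρ (codiagCoact σ τ) = (mulR k H).lTensor _ ∘ₗ ext ρ (ext σ τ) := by
  have h := ext_lTensor ρ (ext σ τ) LinearMap.id (LinearMap.mul' k H)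
  rw [LinearMap.lTensor_id, LinearMap.id_comp] at h
  rw [codiagCoact, codiagCoact, h, ← LinearMap.comp_assoc, ← LinearMap.lTensor_comp]
  rfl

theorem codiag_codiag' (ρ : U →ₗ[k] U ⊗[k] H) (σ : V →ₗ[k] V ⊗[k] H) (τ : W →ₗ[k] W ⊗[k] H) :
    (TensorProduct.assoc k U V W).toLinearMap.rTensor H ∘ₗ codiagCoact (codiagCoact ρ σ) τ =
      ((mulL k H).lTensor _ ∘ₗ ext ρ (ext σ τ)) ∘ₗ
        (TensorProduct.assoc k U V W).toLinearMap := by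
  have h := ext_lTensor (ext ρ σ) τ (LinearMap.mul' k H) LinearMap.id
  rw [LinearMap.lTensor_id, LinearMap.id_comp] at h
  rw [LinearMap.comp_assoc, ext_assoc, codiagCoact, codiagCoact, h, ← LinearMap.comp_assoc,
    ← LinearMap.comp_assoc, ← LinearMap.comp_assoc]
  congr 1
  ext
  simp [mulL]

variable [Coalgebra k H] [CoquasiBialgebra k H]

theorem IsCoaction.codiagCoact {ρ : V →ₗ[k] V ⊗[k] H} {σ : W →ₗ[k] W ⊗[k] H} (hρ : IsCoaction ρ)
    (hσ : IsCoaction σ) : IsCoaction (codiagCoact ρ σ) :=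
  (hρ.ext hσ).map _ comul_mul counit_mul

/-- The reassociator `(u ⊗ v) ⊗ w ↦ u₀ ⊗ (v₀ ⊗ w₀) ω(u₁, v₁, w₁)`. -/
def reassoc (ρ : U →ₗ[k] U ⊗[k] H) (σ : V →ₗ[k] V ⊗[k] H) (τ : W →ₗ[k] W ⊗[k] H) :
    (U ⊗[k] V) ⊗[k] W →ₗ[k] U ⊗[k] (V ⊗[k] W) :=
  act (ext ρ (ext σ τ)) (ω (k := k) (H := H)) ∘ₗ (TensorProduct.assoc k U V W).toLinearMap

/-- The inverse reassociator `u ⊗ (v ⊗ w) ↦ (u₀ ⊗ v₀) ⊗ w₀ ω⁻¹(u₁, v₁, w₁)`. -/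
def reassocInv (ρ : U →ₗ[k] U ⊗[k] H) (σ : V →ₗ[k] V ⊗[k] H) (τ : W →ₗ[k] W ⊗[k] H) :
    U ⊗[k] (V ⊗[k] W) →ₗ[k] (U ⊗[k] V) ⊗[k] W :=
  (TensorProduct.assoc k U V W).symm.toLinearMap ∘ₗ
    act (ext ρ (ext σ τ)) (ωInv (k := k) (H := H))

theorem reassoc_inv {ρ : U →ₗ[k] U ⊗[k] H} {σ : V →ₗ[k] V ⊗[k] H} {τ : W →ₗ[k] W ⊗[k] H}
    (hρ : IsCoaction ρ) (hσ : IsCoaction σ) (hτ : IsCoaction τ) :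
    reassocInv ρ σ τ ∘ₗ reassoc ρ σ τ = LinearMap.id := by
  calc _ = (TensorProduct.assoc k U V W).symm.toLinearMap ∘ₗ
      (act (ext ρ (ext σ τ)) ωInv ∘ₗ act (ext ρ (ext σ τ)) ω) ∘ₗ
      (TensorProduct.assoc k U V W).toLinearMap := rfl
    _ = _ := by
      rw [← act_conv (hρ.ext (hσ.ext hτ)), ωInv_conv_ω, act_counit (hρ.ext (hσ.ext hτ))]
      ext
      simp

theorem inv_reassoc {ρ : U →ₗ[k] U ⊗[k] H} {σ : V →ₗ[k] V ⊗[k] H} {τ : W →ₗ[k] W ⊗[k] H}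
    (hρ : IsCoaction ρ) (hσ : IsCoaction σ) (hτ : IsCoaction τ) :
    reassoc ρ σ τ ∘ₗ reassocInv ρ σ τ = LinearMap.id := by
  calc _ = act (ext ρ (ext σ τ)) ω ∘ₗ ((TensorProduct.assoc k U V W).toLinearMap ∘ₗ
      (TensorProduct.assoc k U V W).symm.toLinearMap) ∘ₗ act (ext ρ (ext σ τ)) ωInv := rfl
    _ = act (ext ρ (ext σ τ)) ω ∘ₗ act (ext ρ (ext σ τ)) ωInv := by
      congr 1
      ext
      simp
    _ = _ := by
      rw [← act_conv (hρ.ext (hσ.ext hτ)), ω_conv_ωInv, act_counit (hρ.ext (hσ.ext hτ))]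

theorem reassoc_colinear {ρ : U →ₗ[k] U ⊗[k] H} {σ : V →ₗ[k] V ⊗[k] H} {τ : W →ₗ[k] W ⊗[k] H}
    (hρ : IsCoaction ρ) (hσ : IsCoaction σ) (hτ : IsCoaction τ) :
    codiagCoact ρ (codiagCoact σ τ) ∘ₗ reassoc ρ σ τ =
    (reassoc ρ σ τ).rTensor H ∘ₗ codiagCoact (codiagCoact ρ σ) τ := by
  rw [codiag_codiag, reassoc, ← LinearMap.comp_assoc,
    act_colinear (hρ.ext (hσ.ext hτ)) quasi_assoc, LinearMap.rTensor_comp,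
    LinearMap.comp_assoc (codiagCoact (codiagCoact ρ σ) τ), codiag_codiag']
  rfl

theorem reassoc_pentagon {ρ : U →ₗ[k] U ⊗[k] H} {σ : V →ₗ[k] V ⊗[k] H} {τ : W →ₗ[k] W ⊗[k] H}
    (hρ : IsCoaction ρ) (hσ : IsCoaction σ) (hτ : IsCoaction τ)
    {υ : X →ₗ[k] X ⊗[k] H} (hυ : IsCoaction υ) :
    (reassoc σ τ υ).lTensor U ∘ₗ reassoc ρ (codiagCoact σ τ) υ ∘ₗ (reassoc ρ σ τ).rTensor X =
      reassoc ρ σ (codiagCoact τ υ) ∘ₗ reassoc (codiagCoact ρ σ) τ υ := by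
  have hE := hρ.ext (hσ.ext (hτ.ext hυ))
  have h1 : reassoc ρ σ (codiagCoact τ υ) =
      act (ext ρ (ext σ (ext τ υ))) (ω ∘ₗ ((LinearMap.mul' k H).lTensor H).lTensor H) ∘ₗ
        (TensorProduct.assoc k U V (W ⊗[k] X)).toLinearMap := by
    have e1 := ext_lTensor σ (ext τ υ) LinearMap.id (LinearMap.mul' k H)
    rw [LinearMap.lTensor_id, LinearMap.id_comp] at e1
    have e2 := ext_lTensor ρ (ext σ (ext τ υ)) LinearMap.id
      (TensorProduct.map LinearMap.id (LinearMap.mul' k H))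
    rw [LinearMap.lTensor_id, LinearMap.id_comp] at e2
    rw [reassoc, codiagCoact, e1, e2, act_lTensor]
    rfl
  have h2 : reassoc (codiagCoact ρ σ) τ υ =
      act (ext (ext ρ σ) (ext τ υ)) (ω ∘ₗ (LinearMap.mul' k H).rTensor (H ⊗[k] H)) ∘ₗ
        (TensorProduct.assoc k (U ⊗[k] V) W X).toLinearMap := by
    have e1 := ext_lTensor (ext ρ σ) (ext τ υ) (LinearMap.mul' k H) LinearMap.id
    rw [LinearMap.lTensor_id, LinearMap.id_comp] at e1
    rw [reassoc, codiagCoact, e1, act_lTensor]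
    rfl
  have h2' : (TensorProduct.assoc k U V (W ⊗[k] X)).toLinearMap ∘ₗ
      act (ext (ext ρ σ) (ext τ υ)) (ω ∘ₗ (LinearMap.mul' k H).rTensor (H ⊗[k] H)) =
      act (ext ρ (ext σ (ext τ υ))) (ω ∘ₗ (LinearMap.mul' k H).rTensor (H ⊗[k] H) ∘ₗ
        (TensorProduct.assoc k H H (H ⊗[k] H)).symm.toLinearMap) ∘ₗ
      (TensorProduct.assoc k U V (W ⊗[k] X)).toLinearMap := by
    rw [act_natural (ext_assoc ρ σ (ext τ υ))]
    congr 2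
    ext
    simp
  have h3 : (reassoc σ τ υ).lTensor U = act (ext ρ (ext σ (ext τ υ)))
      ((TensorProduct.lid k k).toLinearMap ∘ₗ TensorProduct.map Coalgebra.counit ω) ∘ₗ
      (TensorProduct.assoc k V W X).toLinearMap.lTensor U := by
    rw [act_ext, act_counit hρ, reassoc, LinearMap.lTensor_comp]
    rfl
  have nat : ext ρ (ext σ (ext τ υ)) ∘ₗ (TensorProduct.assoc k V W X).toLinearMap.lTensor U =
      TensorProduct.map ((TensorProduct.assoc k V W X).toLinearMap.lTensor U)
        ((TensorProduct.assoc k H H H).toLinearMap.lTensor H) ∘ₗ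
          ext ρ (ext (ext σ τ) υ) :=
    ext_natural (S := LinearMap.id) (s := LinearMap.id)
      (by rw [TensorProduct.map_id]; rfl) (ext_assoc σ τ υ)
  have h4 : (TensorProduct.assoc k V W X).toLinearMap.lTensor U ∘ₗ reassoc ρ (codiagCoact σ τ) υ =
      act (ext ρ (ext σ (ext τ υ))) (ω ∘ₗ ((LinearMap.mul' k H).rTensor H ∘ₗ
          (TensorProduct.assoc k H H H).symm.toLinearMap).lTensor H) ∘ₗ
      (TensorProduct.assoc k V W X).toLinearMap.lTensor U ∘ₗ
        (TensorProduct.assoc k U (V ⊗[k] W) X).toLinearMap := by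
    have e1 := ext_lTensor (ext σ τ) υ (LinearMap.mul' k H) LinearMap.id
    rw [LinearMap.lTensor_id, LinearMap.id_comp] at e1
    have e2 := ext_lTensor ρ (ext (ext σ τ) υ) LinearMap.id
      (TensorProduct.map (LinearMap.mul' k H) LinearMap.id)
    rw [LinearMap.lTensor_id, LinearMap.id_comp] at e2
    rw [reassoc, codiagCoact, e1, e2, act_lTensor, ← LinearMap.comp_assoc, ← LinearMap.comp_assoc,
      act_natural nat]
    congr 3
    ext
    simp
  have h5 : (TensorProduct.assoc k V W X).toLinearMap.lTensor U ∘ₗ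
        (TensorProduct.assoc k U (V ⊗[k] W) X).toLinearMap ∘ₗ (reassoc ρ σ τ).rTensor X =
      act (ext ρ (ext σ (ext τ υ))) ((TensorProduct.lid k k).toLinearMap ∘ₗ
          TensorProduct.map ω Coalgebra.counit ∘ₗ
          (TensorProduct.assoc k H (H ⊗[k] H) H).symm.toLinearMap ∘ₗ
          (TensorProduct.assoc k H H H).symm.toLinearMap.lTensor H) ∘ₗ
      (TensorProduct.assoc k V W X).toLinearMap.lTensor U ∘ₗ
        (TensorProduct.assoc k U (V ⊗[k] W) X).toLinearMap ∘ₗ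
          (TensorProduct.assoc k U V W).toLinearMap.rTensor X := by
    have e : (reassoc ρ σ τ).rTensor X = act (ext (ext ρ (ext σ τ)) υ)
        ((TensorProduct.lid k k).toLinearMap ∘ₗ TensorProduct.map ω Coalgebra.counit) ∘ₗ
        (TensorProduct.assoc k U V W).toLinearMap.rTensor X := by
      rw [act_ext, act_counit hυ, reassoc, LinearMap.rTensor_comp]
      rfl
    rw [e, ← LinearMap.comp_assoc, ← LinearMap.comp_assoc, ← LinearMap.comp_assoc,
      ← LinearMap.comp_assoc, LinearMap.comp_assoc _ _ (LinearMap.lTensor _ _)]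
    congr 1
    have nat2 : ext ρ (ext σ (ext τ υ)) ∘ₗ
        ((TensorProduct.assoc k V W X).toLinearMap.lTensor U ∘ₗ
          (TensorProduct.assoc k U (V ⊗[k] W) X).toLinearMap) =
        TensorProduct.map ((TensorProduct.assoc k V W X).toLinearMap.lTensor U ∘ₗ
            (TensorProduct.assoc k U (V ⊗[k] W) X).toLinearMap)
          ((TensorProduct.assoc k H H H).toLinearMap.lTensor H ∘ₗ
            (TensorProduct.assoc k H (H ⊗[k] H) H).toLinearMap) ∘ₗ
          ext (ext ρ (ext σ τ)) υ := by
      rw [TensorProduct.map_comp, LinearMap.comp_assoc, ← ext_assoc, ← LinearMap.comp_assoc,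
        nat, LinearMap.comp_assoc]
    rw [LinearMap.comp_assoc]
    have := act_natural nat2 ((TensorProduct.lid k k).toLinearMap ∘ₗ
          TensorProduct.map ω Coalgebra.counit ∘ₗ
          (TensorProduct.assoc k H (H ⊗[k] H) H).symm.toLinearMap ∘ₗ
          (TensorProduct.assoc k H H H).symm.toLinearMap.lTensor H)
    rw [LinearMap.comp_assoc] at this
    rw [this, LinearMap.comp_assoc]
    congr 3
    ext
    simp
  rw [h3, LinearMap.comp_assoc, ← LinearMap.comp_assoc _ _ (LinearMap.lTensor _ _), h4,
    LinearMap.comp_assoc, LinearMap.comp_assoc, h5, h1, h2, LinearMap.comp_assoc,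
    ← LinearMap.comp_assoc _ _ (TensorProduct.assoc k U V (W ⊗[k] X)).toLinearMap, h2']
  have key := congrArg (act (ext ρ (ext σ (ext τ υ)))) (cocycle (k := k) (H := H))
  rw [act_conv hE, act_conv hE, act_conv hE] at key
  have hP : (TensorProduct.assoc k U V (W ⊗[k] X)).toLinearMap ∘ₗ
      (TensorProduct.assoc k (U ⊗[k] V) W X).toLinearMap =
      (TensorProduct.assoc k V W X).toLinearMap.lTensor U ∘ₗ
        (TensorProduct.assoc k U (V ⊗[k] W) X).toLinearMap ∘ₗ
          (TensorProduct.assoc k U V W).toLinearMap.rTensor X := by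
    ext
    simp
  rw [LinearMap.comp_assoc _ (TensorProduct.assoc k U V (W ⊗[k] X)).toLinearMap, hP]
  refine LinearMap.ext fun x => ?_
  exact (LinearMap.congr_fun key _).symm

/-- The reassociator is trivial on a coinvariant in the middle. -/
theorem reassoc_middle {ρ : U →ₗ[k] U ⊗[k] H} {σ : V →ₗ[k] V ⊗[k] H} {τ : W →ₗ[k] W ⊗[k] H}
    (hρ : IsCoaction ρ) (hτ : IsCoaction τ) {v : V} (hv : σ v = v ⊗ₜ 1) (u : U) (w : W) :
    reassoc ρ σ τ ((u ⊗ₜ v) ⊗ₜ w) = u ⊗ₜ (v ⊗ₜ w) := by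
  let T : U ⊗[k] W →ₗ[k] U ⊗[k] (V ⊗[k] W) := (TensorProduct.mk k V W v).lTensor U
  let t : H ⊗[k] H →ₗ[k] H ⊗[k] (H ⊗[k] H) := (TensorProduct.mk k H H 1).lTensor H
  have h : ext ρ (ext σ τ) ∘ₗ T = TensorProduct.map T t ∘ₗ ext ρ τ := by
    refine ext_natural (S := LinearMap.id) (s := LinearMap.id)
      (by rw [TensorProduct.map_id]; rfl) ?_
    ext w
    simp only [LinearMap.comp_apply, TensorProduct.mk_apply, ext_tmul, hv]
    generalize τ w = x
    induction x with
    | zero => simp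
    | add a b ha hb => simp only [tmul_add, map_add, ha, hb]
    | tmul a b => simp
  have h2 : ω ∘ₗ t = Coalgebra.counit (R := k) := by
    ext a b
    simp [t, ω_one, mul_comm]
  have h3 := act_natural h (ω (k := k) (H := H))
  rw [h2, act_counit (hρ.ext hτ)] at h3
  exact LinearMap.congr_fun h3 (u ⊗ₜ w)

end Reassociator

end Coquasi

noncomputable section Comodules

/-- A right comodule over the `k`-coalgebra `C`. -/
structure Comod (k : Type u) [Field k] (C : Type u) [AddCommGroup C] [Module k C]
    [Coalgebra k C] where
  carrier : Type u
  [addCommGroup : AddCommGroup carrier]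
  [module : Module k carrier]
  coact : carrier →ₗ[k] carrier ⊗[k] C
  isCoaction : IsCoaction coact

namespace Comod

attribute [instance] addCommGroup module

section Category

variable {k : Type u} [Field k] {C : Type u} [AddCommGroup C] [Module k C] [Coalgebra k C]

/-- A morphism of comodules: a colinear map. -/
@[ext]
structure Hom (M N : Comod k C) where
  lin : M.carrier →ₗ[k] N.carrier
  colinear : N.coact ∘ₗ lin = lin.rTensor C ∘ₗ M.coact

instance : Category (Comod k C) where
  Hom := Hom
  id M := ⟨LinearMap.id, by rw [LinearMap.rTensor_id]; rfl⟩
  comp f g := ⟨g.lin ∘ₗ f.lin, by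
    rw [LinearMap.rTensor_comp, LinearMap.comp_assoc, ← f.colinear, ← LinearMap.comp_assoc,
      g.colinear, LinearMap.comp_assoc]⟩

@[ext]
theorem hom_ext {M N : Comod k C} {f g : M ⟶ N} (h : f.lin = g.lin) : f = g := Hom.ext h

@[simp]
theorem id_lin (M : Comod k C) : Hom.lin (𝟙 M) = LinearMap.id := rfl

@[simp]
theorem comp_lin {M N P : Comod k C} (f : M ⟶ N) (g : N ⟶ P) :
    (f ≫ g).lin = g.lin ∘ₗ f.lin := rfl

variable (k C) in
/-- The forgetful functor from comodules to vector spaces. -/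
def forget : Comod k C ⥤ ModuleCat.{u} k where
  obj M := ModuleCat.of k M.carrier
  map f := ModuleCat.ofHom f.lin

/-- An isomorphism of comodules from mutually inverse linear maps, the first of them colinear. -/
def mkIso {M N : Comod k C} (f : M.carrier →ₗ[k] N.carrier) (g : N.carrier →ₗ[k] M.carrier)
    (hf : N.coact ∘ₗ f = f.rTensor C ∘ₗ M.coact) (hfg : g ∘ₗ f = LinearMap.id)
    (hgf : f ∘ₗ g = LinearMap.id) : M ≅ N where
  hom := ⟨f, hf⟩
  inv := ⟨g, by
    calc _ = ((g ∘ₗ f).rTensor C ∘ₗ M.coact) ∘ₗ g := by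
          rw [hfg, LinearMap.rTensor_id]; rfl
      _ = g.rTensor C ∘ₗ (f.rTensor C ∘ₗ M.coact) ∘ₗ g := by
          rw [LinearMap.rTensor_comp]; rfl
      _ = g.rTensor C ∘ₗ N.coact ∘ₗ (f ∘ₗ g) := by rw [← hf]; rfl
      _ = _ := by rw [hgf]; rfl⟩
  hom_inv_id := hom_ext hfg
  inv_hom_id := hom_ext hgf

instance : (forget k C).Faithful where
  map_injective h := hom_ext (congrArg ModuleCat.Hom.hom h)

instance : (forget k C).ReflectsIsomorphisms where
  reflects {M N} f hf := by
    have h1 := congrArg ModuleCat.Hom.hom (IsIso.hom_inv_id ((forget k C).map f))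
    have h2 := congrArg ModuleCat.Hom.hom (IsIso.inv_hom_id ((forget k C).map f))
    exact (mkIso f.lin (inv ((forget k C).map f)).hom f.colinear h1 h2).isIso_hom

section Colimits

theorem coassoc_comp {V W : Type u} [AddCommGroup V] [Module k V] [AddCommGroup W] [Module k W]
    {ρ : V →ₗ[k] V ⊗[k] C} (hρ : IsCoaction ρ) {σ : W →ₗ[k] W ⊗[k] C} {T : V →ₗ[k] W}
    (h : σ ∘ₗ T = T.rTensor C ∘ₗ ρ) :
    ((TensorProduct.assoc k W C C).toLinearMap ∘ₗ σ.rTensor C ∘ₗ σ) ∘ₗ T =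
      ((Coalgebra.comul (R := k) (A := C)).lTensor W ∘ₗ σ) ∘ₗ T := by
  have h1 : (TensorProduct.assoc k W C C).toLinearMap ∘ₗ (T.rTensor C).rTensor C =
      T.rTensor (C ⊗[k] C) ∘ₗ (TensorProduct.assoc k V C C).toLinearMap := by
    ext; simp
  have h2 : T.rTensor (C ⊗[k] C) ∘ₗ (Coalgebra.comul (R := k) (A := C)).lTensor V =
      (Coalgebra.comul (R := k) (A := C)).lTensor W ∘ₗ T.rTensor C := by
    ext; simp
  rw [LinearMap.comp_assoc, LinearMap.comp_assoc, LinearMap.comp_assoc, h,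
    ← LinearMap.comp_assoc _ _ (LinearMap.rTensor C σ),
    ← LinearMap.rTensor_comp, h, LinearMap.rTensor_comp,
    ← LinearMap.comp_assoc, ← LinearMap.comp_assoc, h1, LinearMap.comp_assoc,
    LinearMap.comp_assoc, hρ.coassoc, ← LinearMap.comp_assoc, h2]
  rfl

theorem counit_comp {V W : Type u} [AddCommGroup V] [Module k V] [AddCommGroup W] [Module k W]
    {ρ : V →ₗ[k] V ⊗[k] C} (hρ : IsCoaction ρ) {σ : W →ₗ[k] W ⊗[k] C} {T : V →ₗ[k] W}
    (h : σ ∘ₗ T = T.rTensor C ∘ₗ ρ) :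
    ((TensorProduct.rid k W).toLinearMap ∘ₗ
      (Coalgebra.counit (R := k) (A := C)).lTensor W ∘ₗ σ) ∘ₗ T = LinearMap.id ∘ₗ T := by
  have h2 : (TensorProduct.rid k W).toLinearMap ∘ₗ
      (Coalgebra.counit (R := k) (A := C)).lTensor W ∘ₗ T.rTensor C =
      T ∘ₗ (TensorProduct.rid k V).toLinearMap ∘ₗ
      (Coalgebra.counit (R := k) (A := C)).lTensor V := by
    ext; simp
  rw [LinearMap.comp_assoc, LinearMap.comp_assoc, h,
    ← LinearMap.comp_assoc, ← LinearMap.comp_assoc,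
    LinearMap.comp_assoc _ _ (TensorProduct.rid k W).toLinearMap, h2]
  calc _ = T ∘ₗ ((TensorProduct.rid k V).toLinearMap ∘ₗ
      (Coalgebra.counit (R := k) (A := C)).lTensor V ∘ₗ ρ) := rfl
    _ = _ := by rw [hρ.counit]; rfl

variable {J : Type} [Category.{0} J] (F : J ⥤ Comod k C) (c : Cocone (F ⋙ forget k C))
  (hc : IsColimit c)

/-- The linear maps into the vertex of a cocone of vector spaces. -/
def leg (j : J) : (F.obj j).carrier →ₗ[k] c.pt := (c.ι.app j).hom

theorem leg_w {i j : J} (f : i ⟶ j) : leg F c j ∘ₗ (F.map f).lin = leg F c i :=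
  congrArg ModuleCat.Hom.hom (c.w f)

/-- The coaction on a colimit of comodules. -/
def colimCoact : c.pt →ₗ[k] c.pt ⊗[k] C :=
  (hc.desc (Cocone.mk (ModuleCat.of k (c.pt ⊗[k] C))
    { app := fun j => ModuleCat.ofHom ((leg F c j).rTensor C ∘ₗ (F.obj j).coact)
      naturality := fun i j f => by
        ext : 1
        change ((leg F c j).rTensor C ∘ₗ (F.obj j).coact) ∘ₗ (F.map f).lin =
          (leg F c i).rTensor C ∘ₗ (F.obj i).coact
        rw [LinearMap.comp_assoc, (F.map f).colinear, ← LinearMap.comp_assoc,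
          ← LinearMap.rTensor_comp, leg_w] })).hom

theorem colimCoact_leg (j : J) : colimCoact F c hc ∘ₗ leg F c j =
    (leg F c j).rTensor C ∘ₗ (F.obj j).coact :=
  congrArg ModuleCat.Hom.hom (hc.fac _ j)

theorem colim_linear_ext (F : J ⥤ Comod k C) (c : Cocone (F ⋙ forget k C))
    (hc : IsColimit c) {W : Type u} [AddCommGroup W] [Module k W] {f g : c.pt →ₗ[k] W}
    (h : ∀ j, f ∘ₗ leg F c j = g ∘ₗ leg F c j) : f = g := by
  have : ModuleCat.ofHom f = ModuleCat.ofHom g :=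
    hc.hom_ext fun j => ModuleCat.hom_ext (h j)
  exact congrArg ModuleCat.Hom.hom this

/-- The colimit cocone of comodules over a colimit cocone of vector spaces. -/
def colimCocone : Cocone F where
  pt :=
    { carrier := c.pt
      coact := colimCoact F c hc
      isCoaction :=
        { coassoc := colim_linear_ext F c hc fun j =>
            coassoc_comp (F.obj j).isCoaction (colimCoact_leg F c hc j)
          counit := colim_linear_ext F c hc fun j =>
            counit_comp (F.obj j).isCoaction (colimCoact_leg F c hc j) } }
  ι :=
    { app := fun j => ⟨leg F c j, colimCoact_leg F c hc j⟩
      naturality := fun _ _ f => hom_ext (congrArg ModuleCat.Hom.hom (c.ι.naturality f)) }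

/-- The underlying linear map of the universal map out of the colimit. -/
def colimDesc (s : Cocone F) : c.pt →ₗ[k] s.pt.carrier :=
  (hc.desc ((forget k C).mapCocone s)).hom

theorem colimDesc_leg (s : Cocone F) (j : J) :
    colimDesc F c hc s ∘ₗ leg F c j = (s.ι.app j).lin :=
  congrArg ModuleCat.Hom.hom (hc.fac ((forget k C).mapCocone s) j)

/-- The cocone constructed above is a colimit. -/
def colimCoconeIsColimit : IsColimit (colimCocone F c hc) where
  desc s := ⟨colimDesc F c hc s, by
    have h (j : J) : s.pt.coact ∘ₗ colimDesc F c hc s ∘ₗ leg F c j =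
        (colimDesc F c hc s).rTensor C ∘ₗ colimCoact F c hc ∘ₗ leg F c j := by
      have h0 : s.pt.coact ∘ₗ (s.ι.app j).lin = (s.ι.app j).lin.rTensor C ∘ₗ (F.obj j).coact :=
        (s.ι.app j).colinear
      rw [colimDesc_leg, h0, colimCoact_leg, ← colimDesc_leg F c hc,
        LinearMap.rTensor_comp, LinearMap.comp_assoc]
    exact colim_linear_ext F c hc h⟩
  fac s j := hom_ext (colimDesc_leg F c hc s j)
  uniq s m h := hom_ext (congrArg ModuleCat.Hom.hom
    (hc.uniq ((forget k C).mapCocone s) ((forget k C).map m)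
      fun j => ModuleCat.hom_ext (congrArg Hom.lin (h j))))

instance : CreatesColimitsOfSize.{0, 0} (forget k C) where
  CreatesColimitsOfShape :=
    { CreatesColimit := fun {F} => createsColimitOfReflectsIso fun c hc =>
        { liftedCocone := colimCocone F c hc
          validLift := Iso.refl _
          makesColimit := colimCoconeIsColimit F c hc } }

end Colimits

instance : HasCoequalizers (Comod k C) :=
  hasColimitsOfShape_of_hasColimitsOfShape_createsColimitsOfShape (forget k C)

instance : PreservesColimitsOfSize.{0, 0} (forget k C) where
  preservesColimitsOfShape := inferInstance

instance : ReflectsColimitsOfSize.{0, 0} (forget k C) where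
  reflectsColimitsOfShape := inferInstance

end Category

section Monoidal

variable {k : Type u} [Field k]
variable {H : Type u} [NonAssocRing H] [Module k H] [IsScalarTower k H H] [SMulCommClass k H H]
  [Coalgebra k H]

theorem codiag_natural {M M' N N' : Comod k H} (f : M ⟶ M') (g : N ⟶ N') :
    codiagCoact M'.coact N'.coact ∘ₗ TensorProduct.map f.lin g.lin =
      (TensorProduct.map f.lin g.lin).rTensor H ∘ₗ codiagCoact M.coact N.coact := by
  rw [codiagCoact, LinearMap.comp_assoc, ext_natural (s := LinearMap.id) (t := LinearMap.id)
    f.colinear g.colinear, TensorProduct.map_id, ← LinearMap.comp_assoc, codiagCoact,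
    ← LinearMap.comp_assoc]
  congr 1
  ext
  simp

variable [CoquasiBialgebra k H]

/-- The trivial coaction `v ↦ v ⊗ 1`. -/
def trivialCoact (V : Type u) [AddCommGroup V] [Module k V] : V →ₗ[k] V ⊗[k] H :=
  (TensorProduct.mk k V H).flip 1

theorem trivialCoact_isCoaction (V : Type u) [AddCommGroup V] [Module k V] :
    IsCoaction (trivialCoact (k := k) (H := H) V) where
  coassoc := by
    ext v
    simp [trivialCoact, CoquasiBialgebra.comul_one]
  counit := by
    ext v
    simp [trivialCoact, CoquasiBialgebra.counit_one]

/-- The tensor product of comodules over `k`, with the codiagonal coaction. -/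
abbrev tensorComod (M N : Comod k H) : Comod k H where
  carrier := M.carrier ⊗[k] N.carrier
  coact := codiagCoact M.coact N.coact
  isCoaction := M.isCoaction.codiagCoact N.isCoaction

/-- The base field with the trivial coaction. -/
abbrev unitComod : Comod k H where
  carrier := k
  coact := trivialCoact k
  isCoaction := trivialCoact_isCoaction k

theorem leftUnitor_colinear (M : Comod k H) :
    M.coact ∘ₗ (TensorProduct.lid k M.carrier).toLinearMap =
      (TensorProduct.lid k M.carrier).toLinearMap.rTensor H ∘ₗ
        codiagCoact (unitComod (k := k) (H := H)).coact M.coact := by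
  ext m
  simp only [codiagCoact, trivialCoact, AlgebraTensorModule.curry_apply,
    LinearMap.restrictScalars_self, curry_apply, LinearMap.comp_apply, LinearEquiv.coe_coe,
    lid_tmul, one_smul, ext_tmul, LinearMap.flip_apply, mk_apply]
  generalize M.coact m = x
  induction x with
  | zero => simp
  | add a b ha hb => rw [tmul_add, map_add, map_add, map_add, ← ha, ← hb]
  | tmul a b => simp

theorem rightUnitor_colinear (M : Comod k H) :
    M.coact ∘ₗ (TensorProduct.rid k M.carrier).toLinearMap =
      (TensorProduct.rid k M.carrier).toLinearMap.rTensor H ∘ₗ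
        codiagCoact M.coact (unitComod (k := k) (H := H)).coact := by
  ext m
  simp only [codiagCoact, trivialCoact, AlgebraTensorModule.curry_apply,
    LinearMap.restrictScalars_self, curry_apply, LinearMap.comp_apply, LinearEquiv.coe_coe,
    rid_tmul, one_smul, ext_tmul, LinearMap.flip_apply, mk_apply]
  generalize M.coact m = x
  induction x with
  | zero => simp
  | add a b ha hb => rw [add_tmul, map_add, map_add, map_add, ← ha, ← hb]
  | tmul a b => simp

theorem reassoc_natural {M M' N N' P P' : Comod k H} (f : M ⟶ M') (g : N ⟶ N') (h : P ⟶ P') :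
    reassoc M'.coact N'.coact P'.coact ∘ₗ
        TensorProduct.map (TensorProduct.map f.lin g.lin) h.lin =
      TensorProduct.map f.lin (TensorProduct.map g.lin h.lin) ∘ₗ
        reassoc M.coact N.coact P.coact := by
  have e := ext_natural (s := LinearMap.id) f.colinear
    (ext_natural (s := LinearMap.id) (t := LinearMap.id) g.colinear h.colinear)
  rw [TensorProduct.map_id, TensorProduct.map_id] at e
  have e2 := act_natural e (CoquasiBialgebra.ω (k := k) (H := H))
  rw [LinearMap.comp_id] at e2
  rw [reassoc, reassoc, ← LinearMap.comp_assoc, ← e2, LinearMap.comp_assoc, LinearMap.comp_assoc]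
  congr 1
  ext
  simp

instance : MonoidalCategoryStruct (Comod k H) where
  tensorObj := tensorComod
  whiskerLeft M _ _ f := ⟨f.lin.lTensor M.carrier, codiag_natural (𝟙 M) f⟩
  whiskerRight f N := ⟨f.lin.rTensor N.carrier, codiag_natural f (𝟙 N)⟩
  tensorHom f g := ⟨TensorProduct.map f.lin g.lin, codiag_natural f g⟩
  tensorUnit := unitComod
  associator M N P := mkIso (reassoc M.coact N.coact P.coact)
    (reassocInv M.coact N.coact P.coact)
    (reassoc_colinear M.isCoaction N.isCoaction P.isCoaction)
    (reassoc_inv M.isCoaction N.isCoaction P.isCoaction)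
    (inv_reassoc M.isCoaction N.isCoaction P.isCoaction)
  leftUnitor M := mkIso (TensorProduct.lid k M.carrier).toLinearMap
    (TensorProduct.lid k M.carrier).symm.toLinearMap (leftUnitor_colinear M)
    (by ext; simp) (by ext; simp)
  rightUnitor M := mkIso (TensorProduct.rid k M.carrier).toLinearMap
    (TensorProduct.rid k M.carrier).symm.toLinearMap (rightUnitor_colinear M)
    (by ext; simp) (by ext; simp)

instance : MonoidalCategory (Comod k H) where
  tensorHom_def f g := hom_ext (LinearMap.lTensor_comp_rTensor ..).symm
  id_tensorHom_id M N := hom_ext TensorProduct.map_id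
  tensorHom_comp_tensorHom f g h i := hom_ext (TensorProduct.map_comp _ _ _ _).symm
  whiskerLeft_id M N := hom_ext (LinearMap.lTensor_id _ _)
  id_whiskerRight M N := hom_ext (LinearMap.rTensor_id _ _)
  associator_naturality f g h := hom_ext (reassoc_natural f g h)
  leftUnitor_naturality f := hom_ext (TensorProduct.ext' fun a b => by
    change (TensorProduct.lid k _) ((f.lin.lTensor k) (a ⊗ₜ b)) =
      f.lin ((TensorProduct.lid k _) (a ⊗ₜ b))
    simp)
  rightUnitor_naturality f := hom_ext (TensorProduct.ext' fun a b => by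
    change (TensorProduct.rid k _) ((f.lin.rTensor k) (a ⊗ₜ b)) =
      f.lin ((TensorProduct.rid k _) (a ⊗ₜ b))
    simp)
  pentagon M N P Q := hom_ext (reassoc_pentagon M.isCoaction N.isCoaction P.isCoaction
    Q.isCoaction)
  triangle M N := hom_ext (TensorProduct.ext_threefold fun a b c => by
    change ((TensorProduct.lid k _).toLinearMap.lTensor _) (reassoc _ _ _ _) =
      ((TensorProduct.rid k _).toLinearMap.rTensor _) (a ⊗ₜ b ⊗ₜ c)
    rw [reassoc_middle M.isCoaction N.isCoaction rfl]
    simp [smul_tmul])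

/-- The linear map underlying `M ◁ f`. -/
@[simp]
theorem whiskerLeft_lin (M : Comod k H) {N N' : Comod k H} (f : N ⟶ N') :
    (M ◁ f).lin = f.lin.lTensor M.carrier := rfl

@[simp]
theorem whiskerRight_lin {M M' : Comod k H} (f : M ⟶ M') (N : Comod k H) :
    (f ▷ N).lin = f.lin.rTensor N.carrier := rfl

@[simp]
theorem associator_hom_lin (M N P : Comod k H) :
    (α_ M N P).hom.lin = reassoc M.coact N.coact P.coact := rfl

instance (M : Comod k H) : PreservesColimitsOfSize.{0, 0} (tensorLeft M) := by
  have : PreservesColimitsOfSize.{0, 0} (tensorLeft M ⋙ forget k H) :=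
    preservesColimits_of_natIso (F := forget k H ⋙ tensorLeft ((forget k H).obj M))
      (Iso.refl _)
  exact preservesColimits_of_reflects_of_preserves (tensorLeft M) (forget k H)

instance (M : Comod k H) : PreservesColimitsOfSize.{0, 0} (tensorRight M) := by
  have : PreservesColimitsOfSize.{0, 0} (tensorRight M ⋙ forget k H) :=
    preservesColimits_of_natIso (F := forget k H ⋙ tensorRight ((forget k H).obj M))
      (Iso.refl _)
  exact preservesColimits_of_reflects_of_preserves (tensorRight M) (forget k H)

end Monoidal

end Comod

end Comodules

noncomputable section Modules

section Generic

variable {C : Type*} [Category* C] [MonoidalCategory C]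

/-- A right module over a monoid object of a monoidal category. -/
structure RightMod (A : Mon C) where
  X : C
  act : X ⊗ A.X ⟶ X
  act_one : X ◁ MonObj.one ≫ act = (ρ_ X).hom
  act_assoc : act ▷ A.X ≫ act = (α_ X A.X A.X).hom ≫ X ◁ MonObj.mul ≫ act

namespace RightMod

variable {A : Mon C}

/-- A morphism of right modules. -/
@[ext]
structure Hom (M N : RightMod A) where
  hom : M.X ⟶ N.X
  act_hom : M.act ≫ hom = hom ▷ A.X ≫ N.act

instance : Category (RightMod A) where
  Hom := Hom
  id M := ⟨𝟙 M.X, by simp⟩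
  comp f g := ⟨f.hom ≫ g.hom, by
    rw [comp_whiskerRight, Category.assoc, ← g.act_hom, ← Category.assoc, f.act_hom,
      Category.assoc]⟩

@[ext]
theorem hom_ext {M N : RightMod A} {f g : M ⟶ N} (h : f.hom = g.hom) : f = g := Hom.ext h

end RightMod

/-- The functor from `A`-`B`-bimodules to right `B`-modules forgetting the left action. -/
def forgetLeft (A B : Mon C) : Bimod A B ⥤ RightMod B where
  obj M :=
    { X := M.X
      act := M.actRight
      act_one := M.actRight_one
      act_assoc := by rw [M.right_assoc, Iso.hom_inv_id_assoc] }
  map f := ⟨f.hom, f.right_act_hom⟩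

variable [HasCoequalizers C] [∀ X : C, PreservesColimitsOfSize.{0, 0} (tensorLeft X)]
  [∀ X : C, PreservesColimitsOfSize.{0, 0} (tensorRight X)]

/-- The endomorphism category of `A` in the bicategory of monoids and bimodules. -/
@[reducible]
def bimodEnd (A : Mon C) : MonoidalCategory (Bimod A A) :=
  letI : Bicategory (Mon C) := Bimod.monBicategory
  @instMonoidalCategoryHom (Mon C) Bimod.monBicategory A

/-- The monoidal category of `A`-bimodules, with the tensor product over `A` (the coequalizer of
the two maps `(M ⊗ A) ⊗ N ⟶ M ⊗ N`) and with unit object `A`. -/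
instance bimodMonoidal (A : Mon C) : MonoidalCategory (Bimod A A) where
  tensorObj M N := M.tensorBimod N
  whiskerLeft M _ _ f := Bimod.whiskerLeft M f
  whiskerRight f N := Bimod.whiskerRight f N
  tensorUnit := Bimod.regular A
  associator M N P := Bimod.associatorBimod M N P
  leftUnitor M := Bimod.leftUnitorBimod M
  rightUnitor M := Bimod.rightUnitorBimod M
  tensorHom_comp_tensorHom := (bimodEnd A).tensorHom_comp_tensorHom
  whiskerLeft_id := (bimodEnd A).whiskerLeft_id
  id_whiskerRight := (bimodEnd A).id_whiskerRight
  id_tensorHom_id := (bimodEnd A).id_tensorHom_id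
  associator_naturality := (bimodEnd A).associator_naturality
  leftUnitor_naturality := (bimodEnd A).leftUnitor_naturality
  rightUnitor_naturality := (bimodEnd A).rightUnitor_naturality
  pentagon := (bimodEnd A).pentagon
  triangle := (bimodEnd A).triangle

/-- The projection `M ⊗ N ⟶ M ⊗_A N` onto the tensor product over `A`. -/
def tensorProj {A : Mon C} (M N : Bimod A A) : M.X ⊗ N.X ⟶ (M ⊗ N : Bimod A A).X :=
  coequalizer.π (M.actRight ▷ N.X) ((α_ _ _ _).hom ≫ M.X ◁ N.actLeft)

end Generic

end Modules

noncomputable section ComoduleAlgebras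

/-- A right `H`-comodule algebra: an algebra in the monoidal category of right `H`-comodules. -/
class ComoduleAlgebra (k : Type*) [Field k] (H : Type*) [NonAssocRing H] [Module k H]
    [IsScalarTower k H H] [SMulCommClass k H H] [Coalgebra k H] [CoquasiBialgebra k H]
    (A : Type*) [NonAssocRing A] [Module k A] [IsScalarTower k A A] [SMulCommClass k A A] where
  /-- the coaction `a ↦ a₀ ⊗ a₁` -/
  coact : A →ₗ[k] A ⊗[k] H
  isCoaction : IsCoaction coact
  /-- `(ab)₀ ⊗ (ab)₁ = a₀b₀ ⊗ a₁b₁` -/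
  coact_mul : coact ∘ₗ LinearMap.mul' k A =
    (LinearMap.mul' k A).rTensor H ∘ₗ codiagCoact coact coact
  coact_one : coact 1 = 1 ⊗ₜ 1
  /-- `(ab)c = a₀(b₀c₀) ω(a₁,b₁,c₁)` -/
  quasi_assoc : LinearMap.mul' k A ∘ₗ (LinearMap.mul' k A).rTensor A =
    LinearMap.mul' k A ∘ₗ (LinearMap.mul' k A).lTensor A ∘ₗ reassoc coact coact coact

section

variable (k : Type u) [Field k]
variable (H : Type u) [NonAssocRing H] [Module k H] [IsScalarTower k H H] [SMulCommClass k H H]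
  [Coalgebra k H] [CoquasiBialgebra k H]
variable (A : Type u) [NonAssocRing A] [Module k A] [IsScalarTower k A A] [SMulCommClass k A A]
  [ComoduleAlgebra k H A]

/-- `A` as an `H`-comodule. -/
abbrev algComod : Comod k H where
  carrier := A
  coact := ComoduleAlgebra.coact
  isCoaction := ComoduleAlgebra.isCoaction

/-- `A` as a monoid object in the category of `H`-comodules. -/
instance algMonObj : MonObj (algComod k H A) where
  one := ⟨LinearMap.toSpanSingleton k A 1, by
    ext
    change ComoduleAlgebra.coact ((1 : k) • (1 : A)) = ((1 : k) • (1 : A)) ⊗ₜ (1 : H)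
    rw [one_smul, ComoduleAlgebra.coact_one]⟩
  mul := ⟨LinearMap.mul' k A, ComoduleAlgebra.coact_mul⟩
  one_mul := Comod.hom_ext (TensorProduct.ext' fun r a => by
    change (r • (1 : A)) * a = r • a
    rw [smul_mul_assoc, one_mul])
  mul_one := Comod.hom_ext (TensorProduct.ext' fun a r => by
    change a * (r • (1 : A)) = r • a
    rw [mul_smul_comm, mul_one])
  mul_assoc := Comod.hom_ext ComoduleAlgebra.quasi_assoc

/-- `A` as a bundled monoid object in the category of `H`-comodules. -/
abbrev algMon : Mon (Comod k H) := ⟨algComod k H A⟩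

end

section Coinvariants

variable {k : Type u} [Field k]
variable {H : Type u} [NonAssocRing H] [Module k H] [IsScalarTower k H H] [SMulCommClass k H H]
  [Coalgebra k H] [CoquasiBialgebra k H]

/-- The coinvariants `{m ∈ M | m₀ ⊗ m₁ = m ⊗ 1}` of a comodule. -/
def Comod.coinv (M : Comod k H) : Submodule k M.carrier :=
  LinearMap.eqLocus M.coact (Comod.trivialCoact M.carrier)

set_option linter.unusedSectionVars false in
theorem Comod.mem_coinv {M : Comod k H} {m : M.carrier} :
    m ∈ M.coinv ↔ M.coact m = m ⊗ₜ 1 := Iff.rfl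

theorem Comod.map_mem_coinv {M N : Comod k H} (f : M ⟶ N) {m : M.carrier} (hm : m ∈ M.coinv) :
    f.lin m ∈ N.coinv := by
  rw [Comod.mem_coinv] at *
  have h := LinearMap.congr_fun f.colinear m
  simp only [LinearMap.comp_apply, hm, LinearMap.rTensor_tmul] at h
  exact h

theorem Comod.tmul_mem_coinv {M N : Comod k H} {m : M.carrier} (hm : m ∈ M.coinv)
    {n : N.carrier} (hn : n ∈ N.coinv) : (m ⊗ₜ[k] n : (M ⊗ N : Comod k H).carrier) ∈
      (M ⊗ N : Comod k H).coinv := by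
  rw [Comod.mem_coinv] at *
  change codiagCoact M.coact N.coact (m ⊗ₜ n) = (m ⊗ₜ n) ⊗ₜ 1
  simp [codiagCoact, ext_tmul, hm, hn]

/-- The linear map on coinvariants induced by a morphism of comodules. -/
def Comod.coinvMap {M N : Comod k H} (f : M ⟶ N) : M.coinv →ₗ[k] N.coinv :=
  f.lin.restrict fun _ => Comod.map_mem_coinv f

/-- The linear map `M^coH ⊗ N^coH → P^coH` induced by a morphism of comodules `M ⊗ N ⟶ P`. -/
def Comod.coinvMap₂ {M N P : Comod k H} (f : M ⊗ N ⟶ P) :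
    M.coinv ⊗[k] N.coinv →ₗ[k] P.coinv :=
  LinearMap.codRestrict P.coinv
    (f.lin ∘ₗ TensorProduct.map M.coinv.subtype N.coinv.subtype) fun x => by
      induction x with
      | zero => rw [map_zero]; exact zero_mem _
      | add a b ha hb => rw [map_add]; exact add_mem ha hb
      | tmul m n => exact Comod.map_mem_coinv f (Comod.tmul_mem_coinv m.2 n.2)

theorem Comod.coinvMap₂_tmul {M N P : Comod k H} (f : M ⊗ N ⟶ P) (m : M.coinv) (n : N.coinv) :
    (Comod.coinvMap₂ f (m ⊗ₜ n) : P.carrier) = f.lin (m.1 ⊗ₜ n.1) := rfl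

end Coinvariants

section CoinvariantAlgebra

variable (k : Type u) [Field k]
variable (H : Type u) [NonAssocRing H] [Module k H] [IsScalarTower k H H] [SMulCommClass k H H]
  [Coalgebra k H] [CoquasiBialgebra k H]
variable (A : Type u) [NonAssocRing A] [Module k A] [IsScalarTower k A A] [SMulCommClass k A A]
  [ComoduleAlgebra k H A]

/-- The algebra `B = A^coH` of coinvariants of a comodule algebra. -/
def CoinvAlg : Type u := (algComod k H A).coinv

namespace CoinvAlg

instance : AddCommGroup (CoinvAlg k H A) := inferInstanceAs (AddCommGroup (algComod k H A).coinv)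
instance : Module k (CoinvAlg k H A) := inferInstanceAs (Module k (algComod k H A).coinv)

variable {k H A}

/-- The inclusion of `B` into `A`. -/
def val : CoinvAlg k H A →ₗ[k] A := (algComod k H A).coinv.subtype

theorem val_injective : Function.Injective (val : CoinvAlg k H A → A) := Subtype.val_injective

theorem coact_val (b : CoinvAlg k H A) :
    ComoduleAlgebra.coact (k := k) (H := H) (val b) = val b ⊗ₜ 1 := b.2

/-- Associativity in a comodule algebra when the middle factor is coinvariant. -/
theorem assoc_middle (a : A) (b : CoinvAlg k H A) (c : A) :
    (a * val b) * c = a * (val b * c) := by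
  have h := LinearMap.congr_fun (ComoduleAlgebra.quasi_assoc (k := k) (H := H) (A := A))
    ((a ⊗ₜ val b) ⊗ₜ c)
  simp only [LinearMap.comp_apply] at h
  rw [reassoc_middle ComoduleAlgebra.isCoaction ComoduleAlgebra.isCoaction (coact_val b)] at h
  exact h

instance : One (CoinvAlg k H A) := ⟨⟨1, ComoduleAlgebra.coact_one⟩⟩

instance : Mul (CoinvAlg k H A) := ⟨fun b c => ⟨val b * val c,
  Comod.map_mem_coinv (MonObj.mul (X := algComod k H A)) (Comod.tmul_mem_coinv b.2 c.2)⟩⟩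

@[simp] theorem val_one : val (1 : CoinvAlg k H A) = 1 := rfl

@[simp] theorem val_mul (b c : CoinvAlg k H A) : val (b * c) = val b * val c := rfl

instance : Ring (CoinvAlg k H A) where
  left_distrib a b c := val_injective (by simp [mul_add])
  right_distrib a b c := val_injective (by simp [add_mul])
  zero_mul a := val_injective (by simp)
  mul_zero a := val_injective (by simp)
  mul_assoc a b c := val_injective (by simp [assoc_middle])
  one_mul a := val_injective (by simp)
  mul_one a := val_injective (by simp)
  zsmul := (· • ·)
  zsmul_zero' a := zero_zsmul a
  zsmul_succ' n a := SubNegMonoid.zsmul_succ' n a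
  zsmul_neg' n a := SubNegMonoid.zsmul_neg' n a
  neg_add_cancel := neg_add_cancel
  sub_eq_add_neg := sub_eq_add_neg
  nsmul := (· • ·)
  nsmul_zero := zero_nsmul
  nsmul_succ n a := succ_nsmul a n

instance : Algebra k (CoinvAlg k H A) :=
  Algebra.ofModule (fun r a b => val_injective (by simp [smul_mul_assoc]))
    (fun r a b => val_injective (by simp [mul_smul_comm]))

/-- `A` as a left `B`-module. -/
instance : Module (CoinvAlg k H A) A where
  smul b a := val b * a
  one_smul a := one_mul a
  mul_smul b c a := assoc_middle (val b) c a
  smul_zero _ := mul_zero _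
  smul_add _ := mul_add _
  add_smul b c a := add_mul (val b) (val c) a
  zero_smul a := zero_mul a

theorem smul_def (b : CoinvAlg k H A) (a : A) : b • a = val b * a := rfl

/-- `A` as a right `B`-module. -/
instance : Module (CoinvAlg k H A)ᵐᵒᵖ A where
  smul b a := a * val b.unop
  one_smul a := mul_one a
  mul_smul b c a := (assoc_middle a c.unop (val b.unop)).symm
  smul_zero _ := zero_mul _
  smul_add _ a a' := add_mul a a' _
  add_smul b c a := mul_add a (val b.unop) (val c.unop)
  zero_smul a := mul_zero a

theorem op_smul_def (b : CoinvAlg k H A) (a : A) : MulOpposite.op b • a = a * val b := rfl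

end CoinvAlg

/-- `B = A^coH` as a monoid object in the category of vector spaces. -/
def coinvMon : Mon (ModuleCat.{u} k) :=
  letI : MonObj (ModuleCat.of k (CoinvAlg k H A)) :=
    ModuleCat.MonModuleEquivalenceAlgebra.inverseObj (AlgCat.of k (CoinvAlg k H A))
  ⟨ModuleCat.of k (CoinvAlg k H A)⟩

end CoinvariantAlgebra

end ComoduleAlgebras

noncomputable section BalancedTensor

variable (k : Type u) [Field k] (R : Type u) [Ring R] [Algebra k R]

section

variable (N : Type u) [AddCommGroup N] [Module k N] [Module Rᵐᵒᵖ N]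
  (P : Type u) [AddCommGroup P] [Module k P] [Module R P]

/-- The relations `nr ⊗ p = n ⊗ rp`. -/
def balancedRel : Submodule k (N ⊗[k] P) :=
  Submodule.span k {x | ∃ (n : N) (r : R) (p : P),
    x = (MulOpposite.op r • n) ⊗ₜ[k] p - n ⊗ₜ[k] (r • p)}

/-- The tensor product `N ⊗_R P` of a right `R`-module `N` and a left `R`-module `P` over a
`k`-algebra `R`. -/
abbrev BalancedTensor : Type u := (N ⊗[k] P) ⧸ balancedRel k R N P

end

/-- `f ⊗_R P : N ⊗_R P → N' ⊗_R P` for a map `f` of right `R`-modules. -/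
def BalancedTensor.map {N N' : Type u} [AddCommGroup N] [Module k N] [Module Rᵐᵒᵖ N]
    [IsScalarTower k Rᵐᵒᵖ N] [AddCommGroup N'] [Module k N'] [Module Rᵐᵒᵖ N']
    [IsScalarTower k Rᵐᵒᵖ N'] (P : Type u) [AddCommGroup P] [Module k P] [Module R P]
    (f : N →ₗ[Rᵐᵒᵖ] N') : BalancedTensor k R N P →ₗ[k] BalancedTensor k R N' P :=
  Submodule.mapQ _ _ ((f.restrictScalars k).rTensor P) (by
    rw [balancedRel, Submodule.span_le]
    rintro _ ⟨n, r, p, rfl⟩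
    refine Submodule.subset_span ⟨f n, r, p, ?_⟩
    simp)

/-- A left `R`-module `P` over a `k`-algebra `R` is faithfully flat: a sequence of right
`R`-modules is exact if and only if it is exact after applying `- ⊗_R P`. -/
def IsLeftFaithfullyFlat (P : Type u) [AddCommGroup P] [Module k P] [Module R P] : Prop :=
  ∀ (N₁ N₂ N₃ : Type u) [AddCommGroup N₁] [Module k N₁] [Module Rᵐᵒᵖ N₁]
    [IsScalarTower k Rᵐᵒᵖ N₁] [AddCommGroup N₂] [Module k N₂] [Module Rᵐᵒᵖ N₂]
    [IsScalarTower k Rᵐᵒᵖ N₂] [AddCommGroup N₃] [Module k N₃] [Module Rᵐᵒᵖ N₃]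
    [IsScalarTower k Rᵐᵒᵖ N₃] (f : N₁ →ₗ[Rᵐᵒᵖ] N₂) (g : N₂ →ₗ[Rᵐᵒᵖ] N₃),
    Function.Exact f g ↔
      Function.Exact (BalancedTensor.map k R P f) (BalancedTensor.map k R P g)

end BalancedTensor

noncomputable section Galois

variable (k : Type u) [Field k]
variable (H : Type u) [NonAssocRing H] [Module k H] [IsScalarTower k H H] [SMulCommClass k H H]
  [Coalgebra k H] [CoquasiHopfAlgebra k H]
variable (A : Type u) [NonAssocRing A] [Module k A] [IsScalarTower k A A] [SMulCommClass k A A]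
  [ComoduleAlgebra k H A]

open CoquasiBialgebra CoquasiHopfAlgebra

/-- `h ↦ h₁β(h₂) ⊗ (S(h₃) ⊗ h₄)`. -/
def galoisSplit : H →ₗ[k] H ⊗[k] (H ⊗[k] H) :=
  TensorProduct.map (hitRight β) ((S (k := k) (H := H)).rTensor H ∘ₗ Coalgebra.comul) ∘ₗ
    Coalgebra.comul

/-- `g ⊗ h ↦ ω⁻¹(g, h₁β(h₂), S(h₃)) h₄`. -/
def galoisTwist : H ⊗[k] H →ₗ[k] H :=
  (TensorProduct.lid k H).toLinearMap ∘ₗ (ωInv (k := k) (H := H)).rTensor H ∘ₗ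
    (TensorProduct.assoc k H (H ⊗[k] H) H).symm.toLinearMap ∘ₗ
    (TensorProduct.assoc k H H H).symm.toLinearMap.lTensor H ∘ₗ
    (galoisSplit k H).lTensor H

/-- `a ⊗ b ↦ a₀b₀ ⊗ ω⁻¹(a₁, b₁β(b₂), S(b₃)) b₄` on `A ⊗ A`. -/
def galoisLin : A ⊗[k] A →ₗ[k] A ⊗[k] H :=
  TensorProduct.map (LinearMap.mul' k A) (galoisTwist k H) ∘ₗ
    ext (ComoduleAlgebra.coact (k := k) (H := H) (A := A)) ComoduleAlgebra.coact

theorem galoisLin_balanced (a : A) (b : CoinvAlg k H A) (c : A) :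
    galoisLin k H A ((MulOpposite.op b • a) ⊗ₜ c) = galoisLin k H A (a ⊗ₜ (b • c)) := by
  have h1 : ComoduleAlgebra.coact (k := k) (H := H) (MulOpposite.op b • a) =
      (LinearMap.mulRight k (CoinvAlg.val b)).rTensor H
        (ComoduleAlgebra.coact (k := k) (H := H) a) := by
    have h := LinearMap.congr_fun (ComoduleAlgebra.coact_mul (k := k) (H := H) (A := A))
      (a ⊗ₜ CoinvAlg.val b)
    simp only [LinearMap.comp_apply, codiagCoact, ext_tmul, CoinvAlg.coact_val] at h
    rw [CoinvAlg.op_smul_def]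
    refine h.trans ?_
    generalize ComoduleAlgebra.coact (k := k) (H := H) a = x
    induction x with
    | zero => simp
    | add x y hx hy => simp only [add_tmul, map_add, hx, hy]
    | tmul x y => simp
  have h2 : ComoduleAlgebra.coact (k := k) (H := H) (b • c) =
      (LinearMap.mulLeft k (CoinvAlg.val b)).rTensor H
        (ComoduleAlgebra.coact (k := k) (H := H) c) := by
    have h := LinearMap.congr_fun (ComoduleAlgebra.coact_mul (k := k) (H := H) (A := A))
      (CoinvAlg.val b ⊗ₜ c)
    simp only [LinearMap.comp_apply, codiagCoact, ext_tmul, CoinvAlg.coact_val] at h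
    rw [CoinvAlg.smul_def]
    refine h.trans ?_
    generalize ComoduleAlgebra.coact (k := k) (H := H) c = x
    induction x with
    | zero => simp
    | add x y hx hy => simp only [tmul_add, map_add, hx, hy]
    | tmul x y => simp
  simp only [galoisLin, LinearMap.comp_apply, ext_tmul, h1, h2]
  generalize ComoduleAlgebra.coact (k := k) (H := H) a = x
  generalize ComoduleAlgebra.coact (k := k) (H := H) c = y
  induction x with
  | zero => simp
  | add x x' hx hx' => simp only [add_tmul, map_add, hx, hx']
  | tmul x g =>
    induction y with
    | zero => simp
    | add y y' hy hy' => simp only [tmul_add, map_add, hy, hy']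
    | tmul y h => simp [CoinvAlg.assoc_middle]

/-- The Galois map `A ⊗_B A → A ⊗ H`,
`a ⊗_B b ↦ a₀b₀ ⊗ ω⁻¹(a₁, b₁β(b₂), S(b₃)) b₄`, where `B = A^coH`. -/
def can : BalancedTensor k (CoinvAlg k H A) A A →ₗ[k] A ⊗[k] H :=
  Submodule.liftQ _ (galoisLin k H A) (by
    rw [balancedRel, Submodule.span_le]
    rintro _ ⟨a, b, c, rfl⟩
    rw [SetLike.mem_coe, LinearMap.mem_ker, map_sub, galoisLin_balanced, sub_self])

/-- `A` is a Galois extension of `B = A^coH`: the Galois map is bijective. -/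
def IsGaloisExtension : Prop := Function.Bijective (can k H A)

end Galois

noncomputable section Functors

variable (k : Type u) [Field k]
variable (H : Type u) [NonAssocRing H] [Module k H] [IsScalarTower k H H] [SMulCommClass k H H]
  [Coalgebra k H] [CoquasiBialgebra k H]
variable (A : Type u) [NonAssocRing A] [Module k A] [IsScalarTower k A A] [SMulCommClass k A A]
  [ComoduleAlgebra k H A]

/-- The category of right relative Hopf modules `M_A^H`: right `A`-modules in the monoidal
category of right `H`-comodules. -/
abbrev RightHopfMod := RightMod (algMon k H A)

/-- The category `M_B` of right modules over `B = A^coH`. -/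
abbrev RightCoinvMod := RightMod (coinvMon k H A)

/-- The category of two-sided Hopf modules `_A M_A^H`: `A`-bimodules in the monoidal category of
right `H`-comodules, with the tensor product over `A`. -/
abbrev HopfBimod := Bimod (algMon k H A) (algMon k H A)

/-- The category `_B M_B` of bimodules over `B = A^coH`, with the tensor product over `B`. -/
abbrev CoinvBimod := Bimod (coinvMon k H A) (coinvMon k H A)

section

variable {k H A}

theorem right_assoc_coinv (M : RightHopfMod k H A) (m : M.X.carrier) (b : CoinvAlg k H A)
    (c : A) : M.act.lin (M.act.lin (m ⊗ₜ[k] CoinvAlg.val b) ⊗ₜ[k] c) =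
      M.act.lin (m ⊗ₜ[k] (CoinvAlg.val b * c)) := by
  have h := LinearMap.congr_fun (congrArg Comod.Hom.lin M.act_assoc)
    ((m ⊗ₜ[k] CoinvAlg.val b) ⊗ₜ[k] c)
  refine h.trans ?_
  change M.act.lin ((LinearMap.mul' k A).lTensor M.X.carrier (reassoc _ _ _ _)) = _
  rw [reassoc_middle M.X.isCoaction ComoduleAlgebra.isCoaction (CoinvAlg.coact_val b)]
  rfl

theorem right_one (M : RightHopfMod k H A) (m : M.X.carrier) :
    M.act.lin (m ⊗ₜ[k] (1 : A)) = m := by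
  have h := LinearMap.congr_fun (congrArg Comod.Hom.lin M.act_one) (m ⊗ₜ[k] (1 : k))
  refine Eq.trans ?_ (h.trans (one_smul k m))
  change _ = M.act.lin (m ⊗ₜ[k] ((1 : k) • (1 : A)))
  rw [one_smul]

theorem left_assoc_coinv (M : HopfBimod k H A) (a : A) (b : CoinvAlg k H A)
    (m : M.X.carrier) : M.actLeft.lin ((a * CoinvAlg.val b) ⊗ₜ[k] m) =
      M.actLeft.lin (a ⊗ₜ[k] M.actLeft.lin (CoinvAlg.val b ⊗ₜ[k] m)) := by
  have h := LinearMap.congr_fun (congrArg Comod.Hom.lin M.left_assoc)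
    ((a ⊗ₜ[k] CoinvAlg.val b) ⊗ₜ[k] m)
  refine h.trans ?_
  change M.actLeft.lin (M.actLeft.lin.lTensor A (reassoc _ _ _ _)) = _
  rw [reassoc_middle ComoduleAlgebra.isCoaction M.X.isCoaction (CoinvAlg.coact_val b)]
  rfl

theorem left_one (M : HopfBimod k H A) (m : M.X.carrier) :
    M.actLeft.lin ((1 : A) ⊗ₜ[k] m) = m := by
  have h := LinearMap.congr_fun (congrArg Comod.Hom.lin M.one_actLeft) ((1 : k) ⊗ₜ[k] m)
  refine Eq.trans ?_ (h.trans (one_smul k m))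
  change _ = M.actLeft.lin (((1 : k) • (1 : A)) ⊗ₜ[k] m)
  rw [one_smul]

theorem middle_assoc_coinv (M : HopfBimod k H A) (a : A) (m : M.X.coinv) (c : A) :
    M.actRight.lin (M.actLeft.lin (a ⊗ₜ[k] m.1) ⊗ₜ[k] c) =
      M.actLeft.lin (a ⊗ₜ[k] M.actRight.lin (m.1 ⊗ₜ[k] c)) := by
  have h := LinearMap.congr_fun (congrArg Comod.Hom.lin M.middle_assoc)
    ((a ⊗ₜ[k] m.1) ⊗ₜ[k] c)
  refine h.trans ?_
  change M.actLeft.lin (M.actRight.lin.lTensor A (reassoc _ _ _ _)) = _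
  rw [reassoc_middle ComoduleAlgebra.isCoaction ComoduleAlgebra.isCoaction m.2]
  rfl

end

/-- The functor of coinvariants `M_A^H ⥤ M_B`. -/
def coinvRight : RightHopfMod k H A ⥤ RightCoinvMod k H A where
  obj M :=
    { X := ModuleCat.of k M.X.coinv
      act := ModuleCat.ofHom (Comod.coinvMap₂ M.act)
      act_one := by
        refine ModuleCat.hom_ext (TensorProduct.ext' fun m r => Subtype.ext ?_)
        change M.act.lin (m.1 ⊗ₜ[k] CoinvAlg.val (algebraMap k (CoinvAlg k H A) r)) = r • m.1
        rw [Algebra.algebraMap_eq_smul_one, map_smul, tmul_smul, map_smul, CoinvAlg.val_one,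
          right_one]
      act_assoc := by
        refine ModuleCat.hom_ext (TensorProduct.ext_threefold fun m b c => Subtype.ext ?_)
        exact right_assoc_coinv M m.1 b (CoinvAlg.val c) }
  map f := ⟨ModuleCat.ofHom (Comod.coinvMap f.hom), by
    refine ModuleCat.hom_ext (TensorProduct.ext' fun m b => Subtype.ext ?_)
    exact LinearMap.congr_fun (congrArg Comod.Hom.lin f.act_hom) (m.1 ⊗ₜ[k] CoinvAlg.val b)⟩
  map_id M := rfl
  map_comp f g := rfl

/-- The functor of coinvariants `_A M_A^H ⥤ _B M_B`. -/
def coinvBimod : HopfBimod k H A ⥤ CoinvBimod k H A where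
  obj M :=
    { X := ModuleCat.of k M.X.coinv
      actLeft := ModuleCat.ofHom (Comod.coinvMap₂ M.actLeft)
      one_actLeft := by
        refine ModuleCat.hom_ext (TensorProduct.ext' fun r m => Subtype.ext ?_)
        change M.actLeft.lin (CoinvAlg.val (algebraMap k (CoinvAlg k H A) r) ⊗ₜ[k] m.1) = r • m.1
        rw [Algebra.algebraMap_eq_smul_one, map_smul, ← smul_tmul', map_smul, CoinvAlg.val_one,
          left_one]
      left_assoc := by
        refine ModuleCat.hom_ext (TensorProduct.ext_threefold fun b c m => Subtype.ext ?_)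
        exact left_assoc_coinv M (CoinvAlg.val b) c m.1
      actRight := ModuleCat.ofHom (Comod.coinvMap₂ M.actRight)
      actRight_one := ((coinvRight k H A).obj ((forgetLeft (algMon k H A) (algMon k H A)).obj M)).act_one
      right_assoc := (Iso.eq_inv_comp _).2
        ((coinvRight k H A).obj ((forgetLeft (algMon k H A) (algMon k H A)).obj M)).act_assoc.symm
      middle_assoc := by
        refine ModuleCat.hom_ext (TensorProduct.ext_threefold fun b m c => Subtype.ext ?_)
        exact middle_assoc_coinv M (CoinvAlg.val b) m (CoinvAlg.val c) }
  map f :=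
    { hom := ModuleCat.ofHom (Comod.coinvMap f.hom)
      left_act_hom := by
        refine ModuleCat.hom_ext (TensorProduct.ext' fun b m => Subtype.ext ?_)
        exact LinearMap.congr_fun (congrArg Comod.Hom.lin f.left_act_hom)
          (CoinvAlg.val b ⊗ₜ[k] m.1)
      right_act_hom := ((coinvRight k H A).map ((forgetLeft (algMon k H A) (algMon k H A)).map f)).act_hom }
  map_id M := rfl
  map_comp f g := rfl

end Functors

end CoquasiGalois

open CoquasiGalois

/-! The Galois map is rewritten as a morphism of the monoidal category of comodules. Let `H'` be `H`
with the coaction `h ↦ h₂ ⊗ S(h₁)` (`anti`). For every comodule `V` the map `v ↦ v₀ ⊗ β(v₁)v₂` is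
colinear from `V` with trivial coaction to `V ⊗ H'`, by the axiom on `h₁β(h₂)S(h₃)`
(`coevLin_colinear`), and it is injective, by the axiom on `ω(h₁β(h₂), S(h₃), α(h₄)h₅)`
(`coevLin_injective`). For a relative Hopf module `M`, applying this coevaluation to `A`,
reassociating and letting `A` act gives `canHom M`, from `M ⊗ A` with `A` made trivial to `M ⊗ H'`.
For `M = A` it is the given Galois map (`canHom_regular`): the factor `ω⁻¹` is the inverse
associator. Colinearity and naturality in `M` are then formal.

Bijectivity of the map `M ⊗_B A → M ⊗ H` spreads from `M = A` to the free modules `V ⊗ A`, where it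
is `V ⊗ can` up to associators, and from these to all `M` through a presentation by free modules
that splits over `k` (`canBal_bijective`).

For the counit `M^coH ⊗_B A → M`, write `M^coH` as the kernel of the right `B`-linear map `m ↦ m₀ ⊗
m₁ - m ⊗ 1`. By flatness `M^coH ⊗_B A` is the corresponding kernel in `M ⊗_B A`, which the Galois
map identifies with the coinvariants of `M ⊗ H'`. Under this identification the counit followed by
the coevaluation of `M` is the inclusion (`canBal_map_coinvIncl`). Since the coevaluation is
injective with coinvariant values, the counit is bijective. The unit of the adjunction becomes
invertible after `- ⊗_B A` by a triangle identity, hence is invertible by faithful flatness.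

For the monoidal structure, the associator is trivial as soon as one of its three arguments is
coinvariant, so `m ⊗_B n ↦ [m ⊗ n]` is well defined and coherent as in the associative case.
Faithful flatness allows bijectivity to be tested after `- ⊗_B A`, and there the inverse is the
chain `M ⊗_A N ≅ (M^coH ⊗_B A) ⊗_A N ≅ M^coH ⊗_B N ≅ (M^coH ⊗_B N^coH) ⊗_B A`. -/

namespace CoquasiGalois

set_option linter.unusedSectionVars false

/-! ### Coinvariants as morphisms from the unit, and the associator on them -/

noncomputable section Coevaluation

open CoquasiBialgebra CoquasiHopfAlgebra

section Reassociator

variable {k : Type u} [Field k]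
variable {H : Type u} [NonAssocRing H] [Module k H] [IsScalarTower k H H] [SMulCommClass k H H]
  [Coalgebra k H] [CoquasiBialgebra k H]

namespace Comod

theorem tensorHom_lin {M M' N N' : Comod k H} (f : M ⟶ M') (g : N ⟶ N') :
    (f ⊗ₘ g).lin = TensorProduct.map f.lin g.lin := rfl

theorem comp_lin_apply {M N P : Comod k H} (f : M ⟶ N) (g : N ⟶ P) (x : M.carrier) :
    (f ≫ g).lin x = g.lin (f.lin x) := rfl

/-- A coinvariant as a morphism from the unit object. -/
def ofCoinv {M : Comod k H} {m : M.carrier} (hm : M.coact m = m ⊗ₜ 1) :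
    𝟙_ (Comod k H) ⟶ M :=
  ⟨LinearMap.toSpanSingleton k M.carrier m, by
    ext
    change M.coact ((1 : k) • m) = ((1 : k) • m) ⊗ₜ (1 : H)
    rw [one_smul, hm]⟩

theorem ofCoinv_one {M : Comod k H} {m : M.carrier} (hm : M.coact m = m ⊗ₜ 1) :
    (ofCoinv hm).lin (1 : k) = m := one_smul k m

/-- Vectors with the trivial coaction, as a comodule. -/
abbrev triv (k H : Type u) [Field k] [NonAssocRing H] [Module k H] [IsScalarTower k H H]
    [SMulCommClass k H H] [Coalgebra k H] [CoquasiBialgebra k H]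
    (V : Type u) [AddCommGroup V] [Module k V] : Comod k H where
  carrier := V
  coact := trivialCoact V
  isCoaction := trivialCoact_isCoaction V

/-- A linear map as a morphism of trivial comodules. -/
def trivMap {V W : Type u} [AddCommGroup V] [Module k V] [AddCommGroup W] [Module k W]
    (f : V →ₗ[k] W) : triv k H V ⟶ triv k H W := ⟨f, by ext; rfl⟩

theorem epi_of_surjective {M N : Comod k H} (f : M ⟶ N) (h : Function.Surjective f.lin) :
    Epi f where
  left_cancellation g g' e := hom_ext <| LinearMap.ext fun x => by
    obtain ⟨y, rfl⟩ := h x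
    exact LinearMap.congr_fun (congrArg Hom.lin e) y

end Comod

open Comod

/-- The reassociator is trivial on a coinvariant on the left. -/
theorem reassoc_left (U V W : Comod k H) {u : U.carrier} (hu : U.coact u = u ⊗ₜ[k] 1)
    (v : V.carrier) (w : W.carrier) :
    reassoc U.coact V.coact W.coact ((u ⊗ₜ[k] v) ⊗ₜ[k] w) = u ⊗ₜ[k] (v ⊗ₜ[k] w) := by
  have h1 := LinearMap.congr_fun (congrArg Hom.lin (leftUnitor_tensor_hom V W))
    ((1 : k) ⊗ₜ[k] (v ⊗ₜ[k] w))
  -- The case of the unit object is coherence in a monoidal category: both sides have the same image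
  -- under the left unitor of `V ⊗ W`, which is injective.
  have h0 : (α_ (𝟙_ (Comod k H)) V W).hom.lin (((1 : k) ⊗ₜ[k] v) ⊗ₜ[k] w) = (1 : k) ⊗ₜ[k] (v ⊗ₜ[k] w) := by
    have h2 := LinearMap.congr_fun (congrArg Hom.lin (leftUnitor_tensor_hom V W))
      ((α_ (𝟙_ (Comod k H)) V W).hom.lin (((1 : k) ⊗ₜ[k] v) ⊗ₜ[k] w))
    have h3 : (α_ (𝟙_ (Comod k H)) V W).inv.lin
        ((α_ (𝟙_ (Comod k H)) V W).hom.lin (((1 : k) ⊗ₜ[k] v) ⊗ₜ[k] w)) = ((1 : k) ⊗ₜ[k] v) ⊗ₜ[k] w :=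
      LinearMap.congr_fun (congrArg Hom.lin (α_ (𝟙_ (Comod k H)) V W).hom_inv_id) _
    rw [comp_lin_apply, h3] at h2
    refine (TensorProduct.lid k (V.carrier ⊗[k] W.carrier)).injective (h2.trans ?_)
    change ((1 : k) • v) ⊗ₜ[k] w = (1 : k) • (v ⊗ₜ[k] w)
    rw [one_smul, one_smul]
  -- Naturality of the associator along the morphism `1 ↦ u` carries the unit case over to `u`. The
  -- axiom on `ω(h, 1, g)` enters only through the triangle identity.
  have h4 := LinearMap.congr_fun (congrArg Hom.lin
    (associator_naturality (ofCoinv hu) (𝟙 V) (𝟙 W))) (((1 : k) ⊗ₜ[k] v) ⊗ₜ[k] w)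
  rw [comp_lin_apply, comp_lin_apply, h0] at h4
  simp only [tensorHom_lin, associator_hom_lin] at h4
  erw [TensorProduct.map_tmul, TensorProduct.map_tmul, TensorProduct.map_tmul,
    TensorProduct.map_tmul] at h4
  rwa [ofCoinv_one] at h4

/-- The reassociator is trivial on a coinvariant on the right. -/
theorem reassoc_right (U V W : Comod k H) (u : U.carrier) (v : V.carrier) {w : W.carrier}
    (hw : W.coact w = w ⊗ₜ[k] 1) :
    reassoc U.coact V.coact W.coact ((u ⊗ₜ[k] v) ⊗ₜ[k] w) = u ⊗ₜ[k] (v ⊗ₜ[k] w) := by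
  have h0 : (α_ U V (𝟙_ (Comod k H))).hom.lin ((u ⊗ₜ[k] v) ⊗ₜ[k] (1 : k)) = u ⊗ₜ[k] (v ⊗ₜ[k] (1 : k)) := by
    have h2 := LinearMap.congr_fun (congrArg Hom.lin (rightUnitor_tensor_hom U V))
      ((u ⊗ₜ[k] v) ⊗ₜ[k] (1 : k))
    rw [comp_lin_apply] at h2
    refine ((TensorProduct.rid k V.carrier).lTensor U.carrier).injective (h2.symm.trans ?_)
    change (1 : k) • (u ⊗ₜ[k] v) = u ⊗ₜ[k] ((1 : k) • v)
    rw [one_smul, one_smul]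
  have h4 := LinearMap.congr_fun (congrArg Hom.lin
    (associator_naturality (𝟙 U) (𝟙 V) (ofCoinv hw))) ((u ⊗ₜ[k] v) ⊗ₜ[k] (1 : k))
  rw [comp_lin_apply, comp_lin_apply, h0] at h4
  simp only [tensorHom_lin, associator_hom_lin] at h4
  erw [TensorProduct.map_tmul, TensorProduct.map_tmul, TensorProduct.map_tmul,
    TensorProduct.map_tmul] at h4
  rwa [ofCoinv_one] at h4

theorem reassocInv_left (U V W : Comod k H) {u : U.carrier} (hu : U.coact u = u ⊗ₜ 1)
    (x : V.carrier ⊗[k] W.carrier) :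
    reassocInv U.coact V.coact W.coact (u ⊗ₜ x) =
      (TensorProduct.assoc k U.carrier V.carrier W.carrier).symm (u ⊗ₜ x) := by
  induction x with
  | zero => simp
  | add a b ha hb => rw [tmul_add, map_add, map_add, ha, hb]
  | tmul v w =>
    refine Eq.trans ?_ (LinearMap.congr_fun
      (reassoc_inv U.isCoaction V.isCoaction W.isCoaction) ((u ⊗ₜ v) ⊗ₜ w))
    rw [LinearMap.comp_apply, reassoc_left U V W hu]

end Reassociator

/-! ### The comodule `H` with coaction through the antipode, and the coevaluation -/

variable {k : Type u} [Field k]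
variable {H : Type u} [NonAssocRing H] [Module k H] [IsScalarTower k H H] [SMulCommClass k H H]
  [Coalgebra k H] [CoquasiHopfAlgebra k H]

open Comod

/-- `h ↦ h₂ ⊗ S(h₁)`. -/
def antiCoact : H →ₗ[k] H ⊗[k] H :=
  (S (k := k) (H := H)).lTensor H ∘ₗ (TensorProduct.comm k H H).toLinearMap ∘ₗ Coalgebra.comul

/-- The flip turns the left coaction of `H` on itself into one that is coassociative in the opposite
order; `S` reverses comultiplication and restores the order. -/
theorem antiCoact_isCoaction : IsCoaction (antiCoact (k := k) (H := H)) where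
  coassoc := by
    let L : H ⊗[k] (H ⊗[k] H) →ₗ[k] H ⊗[k] (H ⊗[k] H) :=
      (TensorProduct.map S S).lTensor H ∘ₗ (TensorProduct.assoc k H H H).toLinearMap ∘ₗ
        (TensorProduct.comm k H H).toLinearMap.rTensor H ∘ₗ
        (TensorProduct.comm k H (H ⊗[k] H)).toLinearMap
    have h1 : (TensorProduct.assoc k H H H).toLinearMap ∘ₗ antiCoact.rTensor H ∘ₗ
        (S (k := k) (H := H)).lTensor H ∘ₗ (TensorProduct.comm k H H).toLinearMap =
        L ∘ₗ Coalgebra.comul.lTensor H := by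
      ext a b
      simp only [antiCoact, L, AlgebraTensorModule.curry_apply, curry_apply,
        LinearMap.coe_restrictScalars, LinearMap.comp_apply, LinearEquiv.coe_coe, comm_tmul,
        LinearMap.lTensor_tmul, LinearMap.rTensor_tmul]
      generalize (Coalgebra.comul (R := k) b) = x
      induction x with
      | zero => simp
      | add x y hx hy => simp only [add_tmul, map_add, hx, hy]
      | tmul x y => simp
    have h2 : (Coalgebra.comul (R := k) (A := H)).lTensor H ∘ₗ
        (S (k := k) (H := H)).lTensor H ∘ₗ (TensorProduct.comm k H H).toLinearMap =
        L ∘ₗ (TensorProduct.assoc k H H H).toLinearMap ∘ₗ Coalgebra.comul.rTensor H := by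
      ext a b
      have hS := LinearMap.congr_fun (comul_S (k := k) (H := H)) a
      simp only [LinearMap.comp_apply, LinearEquiv.coe_coe] at hS
      simp only [L, AlgebraTensorModule.curry_apply, curry_apply,
        LinearMap.coe_restrictScalars, LinearMap.comp_apply, LinearEquiv.coe_coe, comm_tmul,
        LinearMap.lTensor_tmul, LinearMap.rTensor_tmul, hS]
      generalize (Coalgebra.comul (R := k) a) = x
      induction x with
      | zero => simp
      | add x y hx hy => simp only [add_tmul, map_add, hx, hy, tmul_add]
      | tmul x y => simp
    have h3 := Coalgebra.coassoc (R := k) (A := H)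
    calc _ = ((TensorProduct.assoc k H H H).toLinearMap ∘ₗ antiCoact.rTensor H ∘ₗ
        (S (k := k) (H := H)).lTensor H ∘ₗ (TensorProduct.comm k H H).toLinearMap) ∘ₗ
          Coalgebra.comul := rfl
      _ = L ∘ₗ (Coalgebra.comul.lTensor H ∘ₗ Coalgebra.comul) := by rw [h1]; rfl
      _ = (L ∘ₗ (TensorProduct.assoc k H H H).toLinearMap ∘ₗ Coalgebra.comul.rTensor H) ∘ₗ
          Coalgebra.comul := by rw [← h3]; rfl
      _ = _ := by rw [← h2]; rfl
  counit := by
    have h1 : (TensorProduct.rid k H).toLinearMap ∘ₗ (Coalgebra.counit (R := k)).lTensor H ∘ₗ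
        (S (k := k) (H := H)).lTensor H ∘ₗ (TensorProduct.comm k H H).toLinearMap =
        (TensorProduct.lid k H).toLinearMap ∘ₗ (Coalgebra.counit (R := k)).rTensor H := by
      ext a b
      have := LinearMap.congr_fun (counit_S (k := k) (H := H)) a
      simp only [LinearMap.comp_apply] at this
      simp [this]
    calc _ = ((TensorProduct.rid k H).toLinearMap ∘ₗ (Coalgebra.counit (R := k)).lTensor H ∘ₗ
        (S (k := k) (H := H)).lTensor H ∘ₗ (TensorProduct.comm k H H).toLinearMap) ∘ₗ
        Coalgebra.comul := rfl
      _ = _ := by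
        rw [h1]
        ext h
        simp

variable (k H) in
/-- `H` with the coaction `h ↦ h₂ ⊗ S(h₁)`. -/
abbrev anti : Comod k H where
  carrier := H
  coact := antiCoact
  isCoaction := antiCoact_isCoaction

/-- `v ↦ v₀ ⊗ β(v₁)v₂`. -/
def coevLin {V : Type*} [AddCommGroup V] [Module k V] (ρ : V →ₗ[k] V ⊗[k] H) :
    V →ₗ[k] V ⊗[k] H := (hitLeft (β (k := k) (H := H))).lTensor V ∘ₗ ρ

theorem comul_isCoaction : IsCoaction (Coalgebra.comul (R := k) (A := H)) where
  coassoc := Coalgebra.coassoc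
  counit := by ext h; simp

/-- `h₁ ⊗ f(h₂)h₃`, computed in two ways. -/
theorem lTensor_hitLeft_comul (f : H →ₗ[k] k) :
    (hitLeft f).lTensor H ∘ₗ Coalgebra.comul = (hitRight f).rTensor H ∘ₗ Coalgebra.comul :=
  lTensor_hitLeft comul_isCoaction f

/-- Coassociativity lets `β` change sides: `v₀ ⊗ v₁ ⊗ Q(β(v₂)v₃) = v₀ ⊗ v₁β(v₂) ⊗ Q(v₃)`. Two
choices of `Q` produce the two antipode axioms: one gives injectivity of the coevaluation, the other
its colinearity. -/
theorem rTensor_coevLin {V : Type*} [AddCommGroup V] [Module k V] {ρ : V →ₗ[k] V ⊗[k] H}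
    (hρ : IsCoaction ρ) {W : Type*} [AddCommGroup W] [Module k W] (Q : H →ₗ[k] W) :
    TensorProduct.map ρ Q ∘ₗ coevLin ρ = (TensorProduct.assoc k V H W).symm.toLinearMap ∘ₗ
      (TensorProduct.map (hitRight β) Q ∘ₗ Coalgebra.comul).lTensor V ∘ₗ ρ := by
  have h1 : TensorProduct.map ρ Q ∘ₗ (hitLeft (β (k := k) (H := H))).lTensor V =
      (TensorProduct.assoc k V H W).symm.toLinearMap ∘ₗ
        (Q.lTensor H ∘ₗ (hitLeft β).lTensor H).lTensor V ∘ₗ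
          (TensorProduct.assoc k V H H).toLinearMap ∘ₗ ρ.rTensor H := by
    ext v h
    simp only [AlgebraTensorModule.curry_apply, curry_apply,
        LinearMap.coe_restrictScalars, LinearMap.comp_apply, LinearEquiv.coe_coe,
        LinearMap.lTensor_tmul, LinearMap.rTensor_tmul, map_tmul]
    generalize ρ v = x
    induction x with
    | zero => simp
    | add x y hx hy => simp only [map_add, hx, hy, add_tmul]
    | tmul x y => simp
  have h2 : (Q.lTensor H ∘ₗ (hitLeft β).lTensor H) ∘ₗ Coalgebra.comul =
      TensorProduct.map (hitRight (β (k := k) (H := H))) Q ∘ₗ Coalgebra.comul := by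
    rw [LinearMap.comp_assoc, lTensor_hitLeft_comul, ← LinearMap.comp_assoc,
      LinearMap.lTensor_comp_rTensor]
  calc _ = (TensorProduct.map ρ Q ∘ₗ (hitLeft (β (k := k) (H := H))).lTensor V) ∘ₗ ρ := rfl
    _ = (TensorProduct.assoc k V H W).symm.toLinearMap ∘ₗ
        (Q.lTensor H ∘ₗ (hitLeft β).lTensor H).lTensor V ∘ₗ
          ((TensorProduct.assoc k V H H).toLinearMap ∘ₗ ρ.rTensor H ∘ₗ ρ) := by rw [h1]; rfl
    _ = _ := by
      rw [hρ.coassoc, ← LinearMap.comp_assoc _ _ (LinearMap.lTensor _ _), ← LinearMap.lTensor_comp,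
        h2]

/-- A left inverse is `v ⊗ h ↦ v₀ ω(v₁, S(h₁), α(h₂)h₃)`: on `v₀ ⊗ β(v₁)v₂` it gives `v₀ ω(v₁β(v₂),
S(v₃), α(v₄)v₅)`, which is `v` by `ω_S` and counitality. -/
theorem coevLin_injective (V : Comod k H) : Function.Injective (coevLin V.coact) := by
  have h := rTensor_coevLin V.isCoaction
    (TensorProduct.map (S (k := k) (H := H)) (hitLeft α) ∘ₗ Coalgebra.comul)
  have h2 : ω (k := k) (H := H) ∘ₗ (TensorProduct.map (hitRight β)
      (TensorProduct.map S (hitLeft α) ∘ₗ Coalgebra.comul) ∘ₗ Coalgebra.comul) =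
      Coalgebra.counit := LinearMap.ext fun h => ω_S h
  refine Function.LeftInverse.injective (g := (TensorProduct.rid k V.carrier).toLinearMap ∘ₗ
    (ω (k := k) (H := H)).lTensor V.carrier ∘ₗ (TensorProduct.assoc k _ _ _).toLinearMap ∘ₗ
    TensorProduct.map V.coact (TensorProduct.map (S (k := k) (H := H)) (hitLeft α) ∘ₗ
      Coalgebra.comul)) fun v => ?_
  have h3 := LinearMap.congr_fun h v
  simp only [LinearMap.comp_apply, LinearEquiv.coe_coe] at h3 ⊢
  erw [h3]
  rw [LinearEquiv.apply_symm_apply, ← LinearMap.comp_apply (LinearMap.lTensor _ _),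
    ← LinearMap.lTensor_comp, h2]
  exact LinearMap.congr_fun V.isCoaction.counit v

/-- Before multiplication, the two coactions on `v₀ ⊗ β(v₁)v₂` yield exactly the legs `v₁β(v₂) ⊗
S(v₃) ⊗ v₄` of `galoisSplit`, the last two exchanged. Multiplying the first two legs gives
colinearity; feeding them to `ω⁻¹` gives the Galois formula. -/
theorem ext_coevLin (V : Comod k H) : ext V.coact antiCoact ∘ₗ coevLin V.coact =
    (TensorProduct.tensorTensorTensorComm k V.carrier H H H).toLinearMap ∘ₗ
      (TensorProduct.comm k H H).toLinearMap.lTensor _ ∘ₗ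
      (TensorProduct.assoc k V.carrier H (H ⊗[k] H)).symm.toLinearMap ∘ₗ
      (galoisSplit k H).lTensor V.carrier ∘ₗ V.coact := by
  have h1 : antiCoact (k := k) (H := H) = (TensorProduct.comm k H H).toLinearMap ∘ₗ
      S.rTensor H ∘ₗ Coalgebra.comul := by
    rw [antiCoact, ← LinearMap.comp_assoc, ← LinearMap.comp_assoc]
    congr 1
    ext
    simp
  have h2 : TensorProduct.map V.coact (antiCoact (k := k) (H := H)) =
      (TensorProduct.comm k H H).toLinearMap.lTensor _ ∘ₗ TensorProduct.map V.coact
      (S.rTensor H ∘ₗ Coalgebra.comul) := by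
    rw [h1, LinearMap.lTensor_comp_map]
  rw [ext, LinearMap.comp_assoc, h2, LinearMap.comp_assoc, rTensor_coevLin V.isCoaction]
  rfl

/-- After regrouping by coassociativity, the product of the first two legs is `h₁β(h₂)S(h₃)`, which
the antipode axiom `id_β_S` replaces by a scalar. -/
theorem galoisSplit_mul (h : H) : (LinearMap.mul' k H).rTensor H
    ((TensorProduct.assoc k H H H).symm (galoisSplit k H h)) = 1 ⊗ₜ[k] hitLeft (β (k := k)) h := by
  have h1 : (TensorProduct.assoc k H H H).symm.toLinearMap ∘ₗ
      TensorProduct.map (hitRight β) ((S (k := k) (H := H)).rTensor H ∘ₗ Coalgebra.comul) =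
      (TensorProduct.map (hitRight β) S).rTensor H ∘ₗ
        (TensorProduct.assoc k H H H).symm.toLinearMap ∘ₗ Coalgebra.comul.lTensor H := by
    ext a b
    simp only [AlgebraTensorModule.curry_apply, curry_apply,
        LinearMap.coe_restrictScalars, LinearMap.comp_apply, LinearEquiv.coe_coe,
        LinearMap.lTensor_tmul, map_tmul]
    generalize (Coalgebra.comul (R := k) b) = x
    induction x with
    | zero => simp
    | add x y hx hy => simp only [map_add, hx, hy, tmul_add]
    | tmul x y => simp
  have h2 : LinearMap.mul' k H ∘ₗ TensorProduct.map (hitRight β) S ∘ₗ Coalgebra.comul =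
      (TensorProduct.lid k H).toLinearMap ∘ₗ (TensorProduct.mk k k H).flip 1 ∘ₗ β :=
    LinearMap.ext fun h => by simpa using id_β_S (k := k) h
  have h3 : galoisSplit k H h = TensorProduct.map (hitRight β) ((S (k := k) (H := H)).rTensor H ∘ₗ
    Coalgebra.comul) (Coalgebra.comul h) := rfl
  have h4 := LinearMap.congr_fun h1 (Coalgebra.comul h)
  simp only [LinearMap.comp_apply, LinearEquiv.coe_coe, Coalgebra.coassoc_symm_apply] at h4
  rw [h3]
  refine (congrArg _ h4).trans ?_
  rw [← LinearMap.comp_apply (LinearMap.rTensor _ _) (LinearMap.rTensor _ _),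
    ← LinearMap.rTensor_comp, ← LinearMap.comp_apply, ← LinearMap.rTensor_comp,
    LinearMap.comp_assoc, h2]
  simp only [hitLeft, LinearMap.comp_apply]
  generalize (Coalgebra.comul (R := k) h) = x
  induction x with
  | zero => simp
  | add x y hx hy => simp only [map_add, hx, hy, tmul_add]
  | tmul x y => simp [smul_tmul]

/-- The codiagonal coaction sends `v₀ ⊗ β(v₁)v₂` to `v₀ ⊗ v₄ ⊗ v₁β(v₂)S(v₃)`, and the last factor
collapses to `β` times `1`. This cancellation is the reason for the coaction chosen on `anti k H`.
-/
theorem coevLin_colinear (V : Comod k H) :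
    (V ⊗ anti k H).coact ∘ₗ coevLin V.coact =
      (coevLin V.coact).rTensor H ∘ₗ trivialCoact V.carrier := by
  ext v
  change (LinearMap.mul' k H).lTensor _ ((ext V.coact antiCoact ∘ₗ coevLin V.coact) v) =
    coevLin V.coact v ⊗ₜ 1
  rw [ext_coevLin]
  simp only [LinearMap.comp_apply, coevLin]
  generalize V.coact v = x
  induction x with
  | zero => simp
  | add x y hx hy => simp only [map_add, hx, hy, add_tmul]
  | tmul x y =>
    simp only [LinearMap.lTensor_tmul]
    have := galoisSplit_mul (k := k) y
    -- This is only a permutation of legs, valid for every `z`; the antipode enters through the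
    -- value of `z` at `galoisSplit k H y`.
    have h2 : ∀ z : H ⊗[k] (H ⊗[k] H), (LinearMap.mul' k H).lTensor _
        ((TensorProduct.tensorTensorTensorComm k V.carrier H H H).toLinearMap
        ((TensorProduct.comm k H H).toLinearMap.lTensor _
        ((TensorProduct.assoc k V.carrier H (H ⊗[k] H)).symm.toLinearMap (x ⊗ₜ z)))) =
        (TensorProduct.assoc k _ _ _).symm (x ⊗ₜ TensorProduct.comm k H H
          ((LinearMap.mul' k H).rTensor H ((TensorProduct.assoc k H H H).symm z))) := by
      intro z
      induction z with
      | zero => simp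
      | add x y hx hy => simp only [map_add, hx, hy, tmul_add]
      | tmul a z =>
        induction z with
        | zero => simp
        | add x y hx hy => simp only [map_add, hx, hy, tmul_add]
        | tmul b c => simp
    rw [h2, this]
    simp

/-- `v ↦ v₀ ⊗ β(v₁)v₂` as a morphism of comodules. -/
def coev (V : Comod k H) : triv k H V.carrier ⟶ V ⊗ anti k H :=
  ⟨coevLin V.coact, coevLin_colinear V⟩

theorem coev_natural {V W : Comod k H} (f : V ⟶ W) :
    trivMap f.lin ≫ coev W = coev V ≫ f ▷ anti k H := by
  refine hom_ext ?_
  change coevLin W.coact ∘ₗ f.lin = f.lin.rTensor H ∘ₗ coevLin V.coact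
  rw [coevLin, coevLin, LinearMap.comp_assoc, f.colinear, ← LinearMap.comp_assoc,
    ← LinearMap.comp_assoc, LinearMap.lTensor_comp_rTensor, LinearMap.rTensor_comp_lTensor]

end Coevaluation

/-! ### Free modules and maps twisted by a morphism `T ⟶ A ⊗ S`, in any monoidal category -/

noncomputable section RightModules

namespace RightMod

variable {C : Type*} [Category* C] [MonoidalCategory C]

/-- The right module `A`. -/
abbrev regular (A : Mon C) : RightMod A where
  X := A.X
  act := MonObj.mul
  act_one := MonObj.mul_one A.X
  act_assoc := MonObj.mul_assoc A.X

/-- The right module `V ⊗ A`. -/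
abbrev free (A : Mon C) (V : C) : RightMod A where
  X := V ⊗ A.X
  act := (α_ V A.X A.X).hom ≫ V ◁ MonObj.mul
  act_one := by
    rw [associator_naturality_right_assoc, ← whiskerLeft_comp, MonObj.mul_one,
      rightUnitor_tensor_hom]
  act_assoc := by
    rw [comp_whiskerRight, Category.assoc, associator_naturality_middle_assoc,
      ← whiskerLeft_comp, MonObj.mul_assoc, whiskerLeft_comp, pentagon_assoc,
      associator_naturality_right_assoc, whiskerLeft_comp]

/-- The action as a morphism of modules from a free module. -/
abbrev actHom {A : Mon C} (M : RightMod A) : free A M.X ⟶ M where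
  hom := M.act
  act_hom := by rw [Category.assoc]; exact M.act_assoc.symm

/-- A morphism of free modules induced by a morphism of the generators. -/
abbrev freeMap (A : Mon C) {V W : C} (f : V ⟶ W) : free A V ⟶ free A W where
  hom := f ▷ A.X
  act_hom := by rw [Category.assoc, associator_naturality_left_assoc, whisker_exchange]

/-- The morphism `M ⊗ T ⟶ (M ⊗ A) ⊗ S ⟶ M ⊗ S` induced by a morphism `T ⟶ A ⊗ S`. -/
abbrev twist {A : Mon C} {T S : C} (c : T ⟶ A.X ⊗ S) (M : RightMod A) : M.X ⊗ T ⟶ M.X ⊗ S :=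
  M.X ◁ c ≫ (α_ M.X A.X S).inv ≫ M.act ▷ S

theorem twist_natural {A : Mon C} {T S : C} (c : T ⟶ A.X ⊗ S) {M N : RightMod A} (f : M ⟶ N) :
    f.hom ▷ T ≫ twist c N = twist c M ≫ f.hom ▷ S := by
  rw [Category.assoc, Category.assoc, ← comp_whiskerRight, f.act_hom, comp_whiskerRight,
    ← associator_inv_naturality_left_assoc, whisker_exchange_assoc]

/-- By the pentagon, a twist on a free module is determined by the one on `A`. This reduces the
Galois map of `V ⊗ A` to that of `A`. -/
theorem twist_free {A : Mon C} {T S : C} (c : T ⟶ A.X ⊗ S) (V : C) :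
    twist c (free A V) = (α_ V A.X T).hom ≫ V ◁ twist c (regular A) ≫ (α_ V A.X S).inv := by
  rw [twist, twist, whiskerLeft_comp, whiskerLeft_comp, Category.assoc, Category.assoc,
    associator_inv_naturality_middle, comp_whiskerRight, ← associator_naturality_right_assoc,
    pentagon_hom_inv_inv_inv_hom_assoc]

/-- An element-free form of balancedness over `B`: for a coinvariant `b`, take right multiplication
by `b` on `M` for `r`, and left multiplication by `b` for `l` and `t`. The hypothesis `h'` then
reads `(mb)a = m(ba)`. -/
theorem twist_balanced {A : Mon C} {T S : C} (c : T ⟶ A.X ⊗ S) {M : RightMod A}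
    {l : A.X ⟶ A.X} {r : M.X ⟶ M.X} {t : T ⟶ T} (h : t ≫ c = c ≫ l ▷ S)
    (h' : r ▷ A.X ≫ M.act = M.X ◁ l ≫ M.act) : r ▷ T ≫ twist c M = M.X ◁ t ≫ twist c M := by
  rw [twist, ← whiskerLeft_comp_assoc, h, whiskerLeft_comp_assoc,
    associator_inv_naturality_middle_assoc, ← comp_whiskerRight, ← h', comp_whiskerRight,
    ← associator_inv_naturality_left_assoc, whisker_exchange_assoc]

/-- An isomorphism of modules from an isomorphism of the underlying objects. -/
def mkIso {A : Mon C} {M N : RightMod A} (f : M ⟶ N) (g : N.X ⟶ M.X) (hfg : f.hom ≫ g = 𝟙 _)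
    (hgf : g ≫ f.hom = 𝟙 _) : M ≅ N where
  hom := f
  inv := ⟨g, by
    calc _ = (g ≫ f.hom) ▷ A.X ≫ N.act ≫ g := by rw [hgf]; simp
      _ = g ▷ A.X ≫ (f.hom ▷ A.X ≫ N.act) ≫ g := by simp
      _ = g ▷ A.X ≫ M.act ≫ (f.hom ≫ g) := by rw [← f.act_hom]; simp
      _ = _ := by rw [hfg]; simp⟩
  hom_inv_id := hom_ext hfg
  inv_hom_id := hom_ext hgf

end RightMod

end RightModules

/-! ### Orbit maps `a ↦ ma` of coinvariants -/

noncomputable section OrbitMap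

open Comod

variable {k : Type u} [Field k]
variable {H : Type u} [NonAssocRing H] [Module k H] [IsScalarTower k H H] [SMulCommClass k H H]
  [Coalgebra k H] [CoquasiBialgebra k H]
variable {A : Type u} [NonAssocRing A] [Module k A] [IsScalarTower k A A] [SMulCommClass k A A]
  [ComoduleAlgebra k H A]

/-- The orbit map of a coinvariant. -/
def orbitMap (M : RightHopfMod k H A) {m : M.X.carrier} (hm : m ∈ M.X.coinv) :
    algComod k H A ⟶ M.X :=
  (λ_ _).inv ≫ ofCoinv hm ▷ algComod k H A ≫ M.act

theorem orbitMap_apply (M : RightHopfMod k H A) {m : M.X.carrier} (hm : m ∈ M.X.coinv) (a : A) :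
    (orbitMap M hm).lin a = M.act.lin (m ⊗ₜ[k] a) := by
  change M.act.lin (((1 : k) • m) ⊗ₜ[k] a) = _
  rw [one_smul]

end OrbitMap

/-! ### The Galois map of a relative Hopf module as a morphism of comodules -/

noncomputable section GaloisMorphism

open CoquasiBialgebra CoquasiHopfAlgebra Comod

variable {k : Type u} [Field k]
variable {H : Type u} [NonAssocRing H] [Module k H] [IsScalarTower k H H] [SMulCommClass k H H]
  [Coalgebra k H] [CoquasiHopfAlgebra k H]
variable {A : Type u} [NonAssocRing A] [Module k A] [IsScalarTower k A A] [SMulCommClass k A A]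
  [ComoduleAlgebra k H A]

/-- The Galois map `m ⊗ a ↦ m₀a₀ ⊗ ω⁻¹(m₁, a₁β(a₂), S(a₃)) a₄` of a relative Hopf module, as a
morphism of comodules. -/
def canHom (M : RightHopfMod k H A) : M.X ⊗ triv k H A ⟶ M.X ⊗ anti k H :=
  M.twist (coev (algComod k H A))

theorem canHom_natural {M N : RightHopfMod k H A} (f : M ⟶ N) :
    f.hom ▷ triv k H A ≫ canHom N = canHom M ≫ f.hom ▷ anti k H :=
  RightMod.twist_natural _ f

theorem canHom_free (V : Comod k H) : canHom (RightMod.free (algMon k H A) V) =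
    (α_ V (algComod k H A) (triv k H A)).hom ≫ V ◁ canHom (RightMod.regular (algMon k H A)) ≫
      (α_ V (algComod k H A) (anti k H)).inv :=
  RightMod.twist_free _ V

/-- The scalar `ω⁻¹(u₁, v₁β(v₂), S(v₃))` of the Galois formula is what the inverse associator of
`U`, `V` and `anti k H` contributes on a coevaluated element. -/
theorem reassocInv_coevLin (U V : Comod k H) (u : U.carrier) (v : V.carrier) :
    reassocInv U.coact V.coact antiCoact (u ⊗ₜ[k] coevLin V.coact v) =
      (galoisTwist k H).lTensor _ (ext U.coact V.coact (u ⊗ₜ[k] v)) := by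
  have h1 := LinearMap.congr_fun (ext_coevLin V) v
  simp only [LinearMap.comp_apply, LinearEquiv.coe_coe] at h1
  simp only [reassocInv, act, LinearMap.comp_apply, ext_tmul, h1]
  generalize U.coact u = x
  generalize V.coact v = y
  induction x with
  | zero => simp
  | add x x' hx hx' => simp only [add_tmul, map_add, hx, hx']
  | tmul x g =>
    induction y with
    | zero => simp
    | add y y' hy hy' => simp only [tmul_add, map_add, hy, hy']
    | tmul y h =>
      simp only [galoisTwist, LinearMap.lTensor_tmul, LinearMap.comp_apply, LinearEquiv.coe_coe,
        tensorTensorTensorComm_tmul]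
      generalize galoisSplit k H h = z
      induction z with
      | zero => simp
      | add z z' hz hz' => simp only [tmul_add, map_add, hz, hz']
      | tmul p z =>
        induction z with
        | zero => simp
        | add z z' hz hz' => simp only [tmul_add, map_add, hz, hz']
        | tmul q r => simp [smul_tmul']

theorem canHom_regular : (canHom (RightMod.regular (algMon k H A))).lin = galoisLin k H A := by
  refine TensorProduct.ext' fun a b => ?_
  refine (congrArg ((LinearMap.mul' k A).rTensor H)
    (reassocInv_coevLin (algComod k H A) (algComod k H A) a b)).trans ?_
  rw [← LinearMap.comp_apply, LinearMap.rTensor_comp_lTensor]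
  rfl

/-- Right multiplication by a coinvariant. -/
def mulRightCoinv (M : RightHopfMod k H A) (b : CoinvAlg k H A) : M.X ⟶ M.X :=
  (ρ_ M.X).inv ≫ M.X ◁ (ofCoinv (M := algComod k H A) b.2) ≫ M.act

theorem mulRightCoinv_apply (M : RightHopfMod k H A) (b : CoinvAlg k H A) (m : M.X.carrier) :
    (mulRightCoinv M b).lin m = M.act.lin (m ⊗ₜ[k] CoinvAlg.val b) := by
  change M.act.lin (m ⊗ₜ[k] ((1 : k) • CoinvAlg.val b)) = _
  rw [one_smul]

/-- Left multiplication by a coinvariant is a colinear endomorphism of `A`, so it commutes with the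
coevaluation, as `RightMod.twist_balanced` requires. -/
theorem canHom_balanced (M : RightHopfMod k H A) (m : M.X.carrier) (b : CoinvAlg k H A) (a : A) :
    (canHom M).lin (M.act.lin (m ⊗ₜ[k] CoinvAlg.val b) ⊗ₜ[k] a) =
      (canHom M).lin (m ⊗ₜ[k] (b • a)) := by
  let l : algComod k H A ⟶ algComod k H A := orbitMap (RightMod.regular (algMon k H A)) b.2
  have hl (a : A) : l.lin a = b • a := orbitMap_apply (RightMod.regular (algMon k H A)) b.2 a
  have h1 : mulRightCoinv M b ▷ algComod k H A ≫ M.act = M.X ◁ l ≫ M.act := by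
    refine hom_ext (TensorProduct.ext' fun m a => ?_)
    change M.act.lin ((mulRightCoinv M b).lin m ⊗ₜ[k] a) = M.act.lin (m ⊗ₜ[k] l.lin a)
    rw [mulRightCoinv_apply, hl]
    exact right_assoc_coinv M m b a
  have h3 := LinearMap.congr_fun (congrArg Hom.lin (RightMod.twist_balanced
    (coev (algComod k H A)) (coev_natural l) h1)) (m ⊗ₜ[k] a)
  change (canHom M).lin ((mulRightCoinv M b).lin m ⊗ₜ[k] a) =
    (canHom M).lin (m ⊗ₜ[k] l.lin a) at h3
  rw [mulRightCoinv_apply, hl] at h3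
  exact h3

/-- For coinvariant `m` the orbit map `a ↦ ma` is colinear, hence commutes with coevaluation, and
the inverse associator is trivial with `m` on the left. On `M^coH ⊗ A` the Galois map therefore
factors through the action into `M`. -/
theorem canHom_coinv (M : RightHopfMod k H A) {m : M.X.carrier} (hm : m ∈ M.X.coinv) (a : A) :
    (canHom M).lin (m ⊗ₜ[k] a) = coevLin M.X.coact (M.act.lin (m ⊗ₜ[k] a)) := by
  have h1 := LinearMap.congr_fun (congrArg Hom.lin (coev_natural (orbitMap M hm))) a
  change coevLin M.X.coact ((orbitMap M hm).lin a) = (orbitMap M hm).lin.rTensor H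
    (coevLin (algComod k H A).coact a) at h1
  rw [orbitMap_apply] at h1
  rw [h1]
  change M.act.lin.rTensor H (reassocInv M.X.coact (algComod k H A).coact (anti k H).coact
    (m ⊗ₜ[k] coevLin (algComod k H A).coact a)) = _
  rw [reassocInv_left M.X (algComod k H A) (anti k H) hm]
  generalize coevLin (algComod k H A).coact a = x
  induction x with
  | zero => simp
  | add x y hx hy => rw [tmul_add, map_add, map_add, map_add, hx, hy]
  | tmul x y =>
    rw [LinearMap.rTensor_tmul, orbitMap_apply]
    rfl

end GaloisMorphism

/-! ### Underlying modules over `B` of objects of `M_B` and of `M_A^H` -/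

noncomputable section CoinvariantModules

open CoquasiBialgebra Comod

variable {k : Type u} [Field k]
variable {H : Type u} [NonAssocRing H] [Module k H] [IsScalarTower k H H] [SMulCommClass k H H]
  [Coalgebra k H] [CoquasiBialgebra k H]
variable {A : Type u} [NonAssocRing A] [Module k A] [IsScalarTower k A A] [SMulCommClass k A A]
  [ComoduleAlgebra k H A]

/-- The underlying module over `Bᵐᵒᵖ` of an object of `M_B`. -/
def CoinvCarrier (N : RightCoinvMod k H A) : Type u := N.X

namespace CoinvCarrier

variable (N : RightCoinvMod k H A)

instance : AddCommGroup (CoinvCarrier N) := inferInstanceAs (AddCommGroup N.X)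
instance : Module k (CoinvCarrier N) := inferInstanceAs (Module k N.X)

/-- The action `n ⊗ b ↦ nb`. -/
def actLin : CoinvCarrier N ⊗[k] CoinvAlg k H A →ₗ[k] CoinvCarrier N := N.act.hom

theorem actLin_one (n : CoinvCarrier N) : actLin N (n ⊗ₜ 1) = n := by
  have h := LinearMap.congr_fun (congrArg ModuleCat.Hom.hom N.act_one) (n ⊗ₜ[k] (1 : k))
  refine Eq.trans ?_ (h.trans (one_smul k n))
  change _ = actLin N (n ⊗ₜ[k] algebraMap k (CoinvAlg k H A) 1)
  rw [map_one]

theorem actLin_mul (n : CoinvCarrier N) (b c : CoinvAlg k H A) :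
    actLin N (actLin N (n ⊗ₜ b) ⊗ₜ c) = actLin N (n ⊗ₜ (b * c)) :=
  LinearMap.congr_fun (congrArg ModuleCat.Hom.hom N.act_assoc) ((n ⊗ₜ[k] b) ⊗ₜ[k] c)

instance : Module (CoinvAlg k H A)ᵐᵒᵖ (CoinvCarrier N) where
  smul b n := actLin N (n ⊗ₜ b.unop)
  one_smul n := actLin_one N n
  mul_smul b c n := (actLin_mul N n c.unop b.unop).symm
  smul_zero b := (congrArg (actLin N) (zero_tmul _ b.unop)).trans (map_zero _)
  smul_add b n n' := (congrArg (actLin N) (add_tmul n n' b.unop)).trans (map_add _ _ _)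
  add_smul b c n := (congrArg (actLin N) (tmul_add n b.unop c.unop)).trans (map_add _ _ _)
  zero_smul n := (congrArg (actLin N) (tmul_zero _ n)).trans (map_zero _)

instance : IsScalarTower k (CoinvAlg k H A)ᵐᵒᵖ (CoinvCarrier N) where
  smul_assoc r b n := by
    change actLin N (n ⊗ₜ (r • b.unop)) = r • actLin N (n ⊗ₜ b.unop)
    rw [tmul_smul, map_smul]

variable {N} in
/-- A morphism of `M_B` as a linear map. -/
def map {N' : RightCoinvMod k H A} (f : N ⟶ N') :
    CoinvCarrier N →ₗ[(CoinvAlg k H A)ᵐᵒᵖ] CoinvCarrier N' where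
  toFun := f.hom.hom
  map_add' := f.hom.hom.map_add
  map_smul' b n := LinearMap.congr_fun (congrArg ModuleCat.Hom.hom f.act_hom) (n ⊗ₜ[k] b.unop)

variable {N} in
/-- A morphism of `M_B` from a linear map. -/
def mkHom {N' : RightCoinvMod k H A} (f : CoinvCarrier N →ₗ[k] CoinvCarrier N')
    (hf : ∀ n b, f (actLin N (n ⊗ₜ b)) = actLin N' (f n ⊗ₜ b)) : N ⟶ N' where
  hom := ModuleCat.ofHom f
  act_hom := ModuleCat.hom_ext (TensorProduct.ext' hf)

end CoinvCarrier

/-- The underlying module over `Bᵐᵒᵖ` of a relative Hopf module. -/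
def HopfCarrier (M : RightHopfMod k H A) : Type u := M.X.carrier

namespace HopfCarrier

variable (M : RightHopfMod k H A)

instance : AddCommGroup (HopfCarrier M) := inferInstanceAs (AddCommGroup M.X.carrier)
instance : Module k (HopfCarrier M) := inferInstanceAs (Module k M.X.carrier)

/-- The action `m ⊗ a ↦ ma`. -/
def actLin : HopfCarrier M ⊗[k] A →ₗ[k] HopfCarrier M := M.act.lin

theorem actLin_one (m : HopfCarrier M) : actLin M (m ⊗ₜ 1) = m := right_one M m

instance : Module (CoinvAlg k H A)ᵐᵒᵖ (HopfCarrier M) where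
  smul b n := actLin M (n ⊗ₜ CoinvAlg.val b.unop)
  one_smul n := actLin_one M n
  mul_smul b c n := (right_assoc_coinv M n c.unop (CoinvAlg.val b.unop)).symm
  smul_zero _ := (congrArg (actLin M) (zero_tmul _ _)).trans (map_zero _)
  smul_add _ n n' := (congrArg (actLin M) (add_tmul n n' _)).trans (map_add _ _ _)
  add_smul _ _ n := (congrArg (actLin M) (tmul_add n _ _)).trans (map_add _ _ _)
  zero_smul n := (congrArg (actLin M) (tmul_zero _ n)).trans (map_zero _)

theorem op_smul_def (b : CoinvAlg k H A) (m : HopfCarrier M) :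
    MulOpposite.op b • m = actLin M (m ⊗ₜ CoinvAlg.val b) := rfl

instance : IsScalarTower k (CoinvAlg k H A)ᵐᵒᵖ (HopfCarrier M) where
  smul_assoc r b n := by
    change actLin M (n ⊗ₜ CoinvAlg.val (r • b.unop)) = r • actLin M (n ⊗ₜ CoinvAlg.val b.unop)
    rw [map_smul, tmul_smul, map_smul]

/-- The coaction. -/
def coactLin : HopfCarrier M →ₗ[k] HopfCarrier M ⊗[k] H := M.X.coact

/-- The relations defining `M ⊗_B A`. -/
abbrev rel : Submodule k (HopfCarrier M ⊗[k] A) :=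
  balancedRel k (CoinvAlg k H A) (HopfCarrier M) A

variable {M}

/-- The underlying linear map of a morphism. -/
def map {N : RightHopfMod k H A} (f : M ⟶ N) : HopfCarrier M →ₗ[k] HopfCarrier N := f.hom.lin

theorem map_actLin {N : RightHopfMod k H A} (f : M ⟶ N) (m : HopfCarrier M) (a : A) :
    map f (actLin M (m ⊗ₜ a)) = actLin N (map f m ⊗ₜ a) :=
  LinearMap.congr_fun (congrArg Comod.Hom.lin f.act_hom) (m ⊗ₜ[k] a)

theorem map_comp {N P : RightHopfMod k H A} (f : M ⟶ N) (g : N ⟶ P) :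
    map (f ≫ g) = map g ∘ₗ map f := rfl

theorem map_rel {N : RightHopfMod k H A} (f : M ⟶ N) {x : HopfCarrier M ⊗[k] A} (hx : x ∈ rel M) :
    (map f).rTensor A x ∈ rel N := by
  refine (Submodule.span_le (p := (rel N).comap ((map f).rTensor A))).2 ?_ hx
  rintro _ ⟨m, b, a, rfl⟩
  rw [SetLike.mem_coe, Submodule.mem_comap, map_sub]
  refine Submodule.subset_span ⟨map f m, b, a, ?_⟩
  rw [LinearMap.rTensor_tmul, LinearMap.rTensor_tmul, op_smul_def, map_actLin, op_smul_def]

end HopfCarrier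

end CoinvariantModules

/-! ### The Galois map `M ⊗_B A → M ⊗ H` is bijective for every relative Hopf module -/

noncomputable section Counit

open CoquasiBialgebra CoquasiHopfAlgebra Comod

variable {k : Type u} [Field k]
variable {H : Type u} [NonAssocRing H] [Module k H] [IsScalarTower k H H] [SMulCommClass k H H]
  [Coalgebra k H] [CoquasiHopfAlgebra k H]
variable {A : Type u} [NonAssocRing A] [Module k A] [IsScalarTower k A A] [SMulCommClass k A A]
  [ComoduleAlgebra k H A]

/-- The underlying linear map of the Galois map of a relative Hopf module. -/
def canLin (M : RightHopfMod k H A) : HopfCarrier M ⊗[k] A →ₗ[k] HopfCarrier M ⊗[k] H :=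
  (canHom M).lin

theorem canLin_natural {M N : RightHopfMod k H A} (f : M ⟶ N) (x : HopfCarrier M ⊗[k] A) :
    canLin N ((HopfCarrier.map f).rTensor A x) = (HopfCarrier.map f).rTensor H (canLin M x) :=
  LinearMap.congr_fun (congrArg Comod.Hom.lin (canHom_natural f)) x

theorem rel_le_ker_canLin (M : RightHopfMod k H A) :
    HopfCarrier.rel M ≤ LinearMap.ker (canLin M) := by
  rw [HopfCarrier.rel, balancedRel, Submodule.span_le]
  rintro _ ⟨m, b, a, rfl⟩
  rw [SetLike.mem_coe, LinearMap.mem_ker, map_sub, sub_eq_zero]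
  exact canHom_balanced M m b a

/-- Of the two associators in `canHom_free`, the first is trivial because the coaction on its third
argument is trivial. What is left is `V ⊗ can` followed by an invertible map. -/
theorem canLin_free (V : Comod k H) (x : (V.carrier ⊗[k] A) ⊗[k] A) :
    canLin (RightMod.free (algMon k H A) V) x =
      reassocInv V.coact (algComod k H A).coact antiCoact
        ((galoisLin k H A).lTensor V.carrier (TensorProduct.assoc k V.carrier A A x)) := by
  have h1 : canLin (RightMod.free (algMon k H A) V) x =
      reassocInv V.coact (algComod k H A).coact antiCoact
        ((canHom (RightMod.regular (algMon k H A))).lin.lTensor V.carrier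
          (reassoc V.coact (algComod k H A).coact (triv k H A).coact x)) :=
    LinearMap.congr_fun (congrArg Comod.Hom.lin (canHom_free V)) x
  have h2 : reassoc V.coact (algComod k H A).coact (triv k H A).coact =
      (TensorProduct.assoc k V.carrier A A).toLinearMap :=
    TensorProduct.ext_threefold fun v a b => reassoc_right V (algComod k H A) (triv k H A) v a rfl
  rw [h1, h2, canHom_regular]
  rfl

theorem canLin_free_surjective (hgal : IsGaloisExtension k H A) (V : Comod k H) :
    Function.Surjective (canLin (RightMod.free (algMon k H A) V)) := by
  have h : Function.Surjective (galoisLin k H A) :=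
    hgal.2.comp (Submodule.mkQ_surjective (balancedRel k (CoinvAlg k H A) A A))
  intro y
  obtain ⟨z, hz⟩ := LinearMap.lTensor_surjective V.carrier h
    (reassoc V.coact (algComod k H A).coact antiCoact y)
  refine ⟨(TensorProduct.assoc k V.carrier A A).symm z, ?_⟩
  rw [canLin_free, LinearEquiv.apply_symm_apply, hz]
  exact LinearMap.congr_fun (reassoc_inv V.isCoaction (algComod k H A).isCoaction
    antiCoact_isCoaction) y

/-- Compares the relations of `V ⊗ (A ⊗_B A)` with those of `(V ⊗ A) ⊗_B A`, so that the kernel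
computed by exactness of `V ⊗ -` lies in the relations of the free module. -/
theorem mem_rel_free (V : Comod k H) {x : (V.carrier ⊗[k] A) ⊗[k] A}
    (hx : TensorProduct.assoc k V.carrier A A x ∈
      LinearMap.range ((balancedRel k (CoinvAlg k H A) A A).subtype.lTensor V.carrier)) :
    x ∈ HopfCarrier.rel (RightMod.free (algMon k H A) V) := by
  obtain ⟨y, hy⟩ := hx
  rw [← (TensorProduct.assoc k V.carrier A A).symm_apply_apply x, ← hy]
  clear hy
  induction y with
  | zero => rw [map_zero, map_zero]; exact zero_mem _
  | add y z hy hz => rw [map_add, map_add]; exact add_mem hy hz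
  | tmul v z =>
    obtain ⟨z, hz⟩ := z
    refine Submodule.span_induction (p := fun z _ => (TensorProduct.assoc k V.carrier A A).symm
      (v ⊗ₜ z) ∈ HopfCarrier.rel (RightMod.free (algMon k H A) V)) ?_ ?_ ?_ ?_ hz
    · rintro _ ⟨a, b, c, rfl⟩
      rw [tmul_sub, map_sub, TensorProduct.assoc_symm_tmul, TensorProduct.assoc_symm_tmul]
      -- The action on a free module involves the associator in general, but not when the acting
      -- element is coinvariant.
      have h : v ⊗ₜ[k] (a * CoinvAlg.val b) =
          (RightMod.free (algMon k H A) V).act.lin ((v ⊗ₜ[k] a) ⊗ₜ[k] CoinvAlg.val b) := by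
        change _ = (LinearMap.mul' k A).lTensor V.carrier (reassoc V.coact (algComod k H A).coact
          (algComod k H A).coact ((v ⊗ₜ a) ⊗ₜ CoinvAlg.val b))
        rw [reassoc_right V (algComod k H A) (algComod k H A) v a (CoinvAlg.coact_val b)]
        rfl
      exact Submodule.subset_span ⟨v ⊗ₜ[k] a, b, c, congrArg
        (fun y : V.carrier ⊗[k] A => y ⊗ₜ[k] c - (v ⊗ₜ[k] a) ⊗ₜ[k] (b • c)) h⟩
    · rw [tmul_zero, map_zero]; exact zero_mem _
    · intro z z' _ _ hz hz'
      rw [tmul_add, map_add]; exact add_mem hz hz'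
    · intro r z _ hz
      rw [tmul_smul, map_smul]; exact Submodule.smul_mem _ r hz

/-- The Galois hypothesis says that the kernel of `galoisLin` is the relation subspace of `A ⊗_B A`;
this passes to `V ⊗ -`, which is exact over a field. -/
theorem ker_canLin_free (hgal : IsGaloisExtension k H A) (V : Comod k H) :
    LinearMap.ker (canLin (RightMod.free (algMon k H A) V)) ≤
      HopfCarrier.rel (RightMod.free (algMon k H A) V) := by
  intro x hx
  have hexact : Function.Exact (balancedRel k (CoinvAlg k H A) A A).subtype (galoisLin k H A) := by
    intro z
    rw [Submodule.coe_subtype, Subtype.range_coe]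
    constructor
    · intro hz
      have h : can k H A (Submodule.Quotient.mk z) = can k H A 0 := by
        rw [map_zero]
        exact hz
      exact (Submodule.Quotient.mk_eq_zero _).1 (hgal.1 h)
    · intro hz
      have h : can k H A (Submodule.Quotient.mk z) = can k H A 0 :=
        congrArg _ ((Submodule.Quotient.mk_eq_zero _).2 hz)
      exact h.trans (map_zero _)
  refine mem_rel_free V ((Module.Flat.lTensor_exact V.carrier hexact _).1 ?_)
  have h1 : reassocInv V.coact (algComod k H A).coact antiCoact
      ((galoisLin k H A).lTensor V.carrier (TensorProduct.assoc k V.carrier A A x)) = 0 :=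
    (canLin_free V x).symm.trans hx
  have h2 := LinearMap.congr_fun (inv_reassoc V.isCoaction (algComod k H A).isCoaction
    (antiCoact_isCoaction (k := k) (H := H)))
    ((galoisLin k H A).lTensor V.carrier (TensorProduct.assoc k V.carrier A A x))
  rw [LinearMap.comp_apply, h1, map_zero] at h2
  exact h2.symm

theorem actHom_surjective (M : RightHopfMod k H A) :
    Function.Surjective (HopfCarrier.map (RightMod.actHom M)) :=
  fun m => ⟨m ⊗ₜ[k] (1 : A), right_one M m⟩

theorem canLin_surjective (hgal : IsGaloisExtension k H A) (M : RightHopfMod k H A) :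
    Function.Surjective (canLin M) := by
  intro y
  obtain ⟨z, rfl⟩ := LinearMap.rTensor_surjective H (actHom_surjective M) y
  obtain ⟨x, rfl⟩ := canLin_free_surjective hgal M.X z
  exact ⟨_, canLin_natural (RightMod.actHom M) x⟩

/-- A diagram chase on the presentation of `M` by `F₀ = M ⊗ A` and `F₁ = (M ⊗ A) ⊗ A`, with `d₁`
acting in `F₀` and `d₂` acting in `M`. The pair `d₁, d₂` is contracted over `k` by inserting `1`.
The Galois maps commute with `p`, `d₁`, `d₂`, and the contractions need only be linear. -/
theorem ker_canLin_le (hgal : IsGaloisExtension k H A) (M : RightHopfMod k H A) :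
    LinearMap.ker (canLin M) ≤ HopfCarrier.rel M := by
  intro x hx
  rw [LinearMap.mem_ker] at hx
  let F₀ := RightMod.free (algMon k H A) M.X
  let F₁ := RightMod.free (algMon k H A) F₀.X
  let p : F₀ ⟶ M := RightMod.actHom M
  let d₁ : F₁ ⟶ F₀ := RightMod.actHom F₀
  let d₂ : F₁ ⟶ F₀ := RightMod.freeMap (algMon k H A) M.act
  let s : HopfCarrier M →ₗ[k] HopfCarrier F₀ := (TensorProduct.mk k M.X.carrier A).flip 1
  let s' : HopfCarrier F₀ →ₗ[k] HopfCarrier F₁ := (TensorProduct.mk k F₀.X.carrier A).flip 1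
  have hs : HopfCarrier.map p ∘ₗ s = LinearMap.id := LinearMap.ext fun m => right_one M m
  have hs₁ : HopfCarrier.map d₁ ∘ₗ s' = LinearMap.id := LinearMap.ext fun m => right_one F₀ m
  have hs₂ : HopfCarrier.map d₂ ∘ₗ s' = s ∘ₗ HopfCarrier.map p := rfl
  have hd : d₁ ≫ p = d₂ ≫ p := RightMod.hom_ext p.act_hom
  have hy : (HopfCarrier.map p).rTensor A (s.rTensor A x) = x := by
    rw [← LinearMap.comp_apply, ← LinearMap.rTensor_comp, hs, LinearMap.rTensor_id]; rfl
  -- The element `w` lifts the contracted image of `s x`. Since `d₁ s' = id` and `d₂ s' = s p`, the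
  -- images of `w` under `d₁` and `d₂` have the Galois images of `s x` and of `0`, the latter
  -- because `x` is in the kernel.
  obtain ⟨w, hw⟩ := canLin_free_surjective hgal F₀.X
    (s'.rTensor H (canLin F₀ (s.rTensor A x)))
  have h₁ : canLin F₀ ((HopfCarrier.map d₁).rTensor A w) = canLin F₀ (s.rTensor A x) := by
    rw [canLin_natural]
    refine (congrArg _ hw).trans ?_
    rw [← LinearMap.comp_apply, ← LinearMap.rTensor_comp, hs₁, LinearMap.rTensor_id]; rfl
  have h₂ : canLin F₀ ((HopfCarrier.map d₂).rTensor A w) = 0 := by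
    rw [canLin_natural]
    refine (congrArg _ hw).trans ?_
    rw [← LinearMap.comp_apply, ← LinearMap.rTensor_comp, hs₂, LinearMap.rTensor_comp,
      LinearMap.comp_apply, ← canLin_natural, hy, hx, map_zero]
  have h₃ : (HopfCarrier.map d₁).rTensor A w - (HopfCarrier.map d₂).rTensor A w - s.rTensor A x ∈
      HopfCarrier.rel F₀ := by
    refine ker_canLin_free hgal M.X ?_
    rw [LinearMap.mem_ker]
    refine (map_sub (canLin F₀) _ _).trans ?_
    rw [map_sub, h₁, h₂, sub_zero, sub_self]
  -- Since `p` coequalizes `d₁` and `d₂`, pushing the relation in `F₀` forward to `M` leaves only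
  -- `-x`.
  have h₄ := HopfCarrier.map_rel p h₃
  rw [map_sub, map_sub, hy, ← LinearMap.comp_apply, ← LinearMap.comp_apply,
    ← LinearMap.rTensor_comp, ← LinearMap.rTensor_comp, ← HopfCarrier.map_comp,
    ← HopfCarrier.map_comp, hd, sub_self, zero_sub] at h₄
  exact (Submodule.neg_mem_iff _).1 h₄

/-- The Galois map `M ⊗_B A → M ⊗ H` of a relative Hopf module. -/
def canBal (M : RightHopfMod k H A) :
    BalancedTensor k (CoinvAlg k H A) (HopfCarrier M) A →ₗ[k] HopfCarrier M ⊗[k] H :=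
  Submodule.liftQ _ (canLin M) (rel_le_ker_canLin M)

theorem canBal_bijective (hgal : IsGaloisExtension k H A) (M : RightHopfMod k H A) :
    Function.Bijective (canBal M) := by
  constructor
  · rw [← LinearMap.ker_eq_bot, canBal, Submodule.ker_liftQ_eq_bot _ _ _ (ker_canLin_le hgal M)]
  · intro y
    obtain ⟨x, rfl⟩ := canLin_surjective hgal M y
    exact ⟨Submodule.Quotient.mk x, rfl⟩

end Counit

/-! ### Consequences of faithful flatness for single maps -/

noncomputable section Flatness

variable {k : Type u} [Field k] {R : Type u} [Ring R] [Algebra k R]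
  {P : Type u} [AddCommGroup P] [Module k P] [Module R P]
  {N N' : Type u} [AddCommGroup N] [Module k N] [Module Rᵐᵒᵖ N] [IsScalarTower k Rᵐᵒᵖ N]
  [AddCommGroup N'] [Module k N'] [Module Rᵐᵒᵖ N'] [IsScalarTower k Rᵐᵒᵖ N']

theorem BalancedTensor.map_zero : BalancedTensor.map k R P (0 : N →ₗ[Rᵐᵒᵖ] N') = 0 := by
  refine Submodule.linearMap_qext _ (TensorProduct.ext' fun n p => ?_)
  change Submodule.Quotient.mk ((0 : N') ⊗ₜ[k] p) = _
  rw [zero_tmul]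
  rfl

/-- Injectivity is exactness of `0 → N → N'`, to which the defining equivalence applies. -/
theorem IsLeftFaithfullyFlat.map_injective_iff (h : IsLeftFaithfullyFlat k R P)
    (f : N →ₗ[Rᵐᵒᵖ] N') :
    Function.Injective (BalancedTensor.map k R P f) ↔ Function.Injective f := by
  have h1 := h N N N' (0 : N →ₗ[Rᵐᵒᵖ] N) f
  rw [BalancedTensor.map_zero] at h1
  have e1 : Function.Exact (0 : N →ₗ[Rᵐᵒᵖ] N) f ↔ Function.Injective f := by
    rw [← LinearMap.ker_eq_bot, LinearMap.exact_iff, LinearMap.range_zero]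
  have e2 : Function.Exact (0 : BalancedTensor k R N P →ₗ[k] BalancedTensor k R N P)
      (BalancedTensor.map k R P f) ↔ Function.Injective (BalancedTensor.map k R P f) := by
    rw [← LinearMap.ker_eq_bot, LinearMap.exact_iff, LinearMap.range_zero]
  rw [← e1, ← e2, h1]

/-- Surjectivity is exactness of `N → N' → 0`. -/
theorem IsLeftFaithfullyFlat.map_surjective_iff (h : IsLeftFaithfullyFlat k R P)
    (f : N →ₗ[Rᵐᵒᵖ] N') :
    Function.Surjective (BalancedTensor.map k R P f) ↔ Function.Surjective f := by
  have h1 := h N N' N' f (0 : N' →ₗ[Rᵐᵒᵖ] N')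
  rw [BalancedTensor.map_zero] at h1
  have e1 : Function.Exact f (0 : N' →ₗ[Rᵐᵒᵖ] N') ↔ Function.Surjective f := by
    rw [← LinearMap.range_eq_top, LinearMap.exact_iff, LinearMap.ker_zero, eq_comm]
  have e2 : Function.Exact (BalancedTensor.map k R P f)
      (0 : BalancedTensor k R N' P →ₗ[k] BalancedTensor k R N' P) ↔
      Function.Surjective (BalancedTensor.map k R P f) := by
    rw [← LinearMap.range_eq_top, LinearMap.exact_iff, LinearMap.ker_zero, eq_comm]
  rw [← e1, ← e2, h1]

variable (k R P) in
/-- `(N ⊗ X) ⊗_R P → (N ⊗_R P) ⊗ X`. -/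
def BalancedTensor.swap (N : Type u) [AddCommGroup N] [Module k N] [Module Rᵐᵒᵖ N]
    [IsScalarTower k Rᵐᵒᵖ N] (X : Type u) [AddCommGroup X] [Module k X] :
    BalancedTensor k R (N ⊗[k] X) P →ₗ[k] BalancedTensor k R N P ⊗[k] X :=
  Submodule.liftQ _ ((balancedRel k R N P).mkQ.rTensor X ∘ₗ
    (TensorProduct.rightComm k N X P).toLinearMap) (by
      rw [balancedRel, Submodule.span_le]
      rintro _ ⟨n, r, p, rfl⟩
      rw [SetLike.mem_coe, LinearMap.mem_ker, map_sub, sub_eq_zero]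
      induction n with
      | zero => simp
      | add n n' hn hn' => rw [smul_add, add_tmul, add_tmul, map_add, map_add, hn, hn']
      | tmul n x =>
        rw [TensorProduct.smul_tmul']
        simp only [LinearMap.comp_apply, LinearEquiv.coe_coe, rightComm_tmul,
          LinearMap.rTensor_tmul]
        congr 1
        exact (Submodule.Quotient.eq _).2 (Submodule.subset_span ⟨n, r, p, rfl⟩))

theorem BalancedTensor.swap_injective (X : Type u) [AddCommGroup X] [Module k X] :
    Function.Injective (BalancedTensor.swap k R P N X) := by
  -- The curried inverse, sending the class of `n ⊗ p` and `x` to the class of `(n ⊗ x) ⊗ p`.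
  let g : BalancedTensor k R N P →ₗ[k] X →ₗ[k] BalancedTensor k R (N ⊗[k] X) P :=
    Submodule.liftQ _ (TensorProduct.curry ((balancedRel k R (N ⊗[k] X) P).mkQ ∘ₗ
      (TensorProduct.rightComm k N P X).toLinearMap)) (by
      rw [balancedRel, Submodule.span_le]
      rintro _ ⟨n, r, p, rfl⟩
      rw [SetLike.mem_coe, LinearMap.mem_ker, map_sub, sub_eq_zero]
      ext x
      exact (Submodule.Quotient.eq _).2 (Submodule.subset_span ⟨n ⊗ₜ x, r, p, rfl⟩))
  refine Function.LeftInverse.injective (g := TensorProduct.lift g) fun y => ?_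
  have h : TensorProduct.lift g ∘ₗ BalancedTensor.swap k R P N X = LinearMap.id :=
    Submodule.linearMap_qext _ (TensorProduct.ext_threefold fun n x p => rfl)
  exact LinearMap.congr_fun h y

end Flatness

/-! ### The counit `M^coH ⊗_B A → M` and its bijectivity -/

noncomputable section CounitMap

variable {k : Type u} [Field k]
variable {H : Type u} [NonAssocRing H] [Module k H] [IsScalarTower k H H] [SMulCommClass k H H]
  [Coalgebra k H] [CoquasiBialgebra k H]
variable {A : Type u} [NonAssocRing A] [Module k A] [IsScalarTower k A A] [SMulCommClass k A A]
  [ComoduleAlgebra k H A]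

/-- `M^coH ⊗_B A → M`, `m ⊗ a ↦ ma`. -/
def indCounitLin (M : RightHopfMod k H A) :
    BalancedTensor k (CoinvAlg k H A) (CoinvCarrier ((coinvRight k H A).obj M)) A →ₗ[k]
      M.X.carrier :=
  Submodule.liftQ _ (M.act.lin ∘ₗ M.X.coinv.subtype.rTensor A) (by
    rw [balancedRel, Submodule.span_le]
    rintro _ ⟨m, b, a, rfl⟩
    rw [SetLike.mem_coe, LinearMap.mem_ker, map_sub, sub_eq_zero]
    exact right_assoc_coinv M m.1 b a)

end CounitMap

noncomputable section Counit

open CoquasiBialgebra CoquasiHopfAlgebra Comod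

variable {k : Type u} [Field k]
variable {H : Type u} [NonAssocRing H] [Module k H] [IsScalarTower k H H] [SMulCommClass k H H]
  [Coalgebra k H] [CoquasiHopfAlgebra k H]
variable {A : Type u} [NonAssocRing A] [Module k A] [IsScalarTower k A A] [SMulCommClass k A A]
  [ComoduleAlgebra k H A]

/-- The inclusion of the coinvariants. -/
def coinvIncl (M : RightHopfMod k H A) :
    CoinvCarrier ((coinvRight k H A).obj M) →ₗ[(CoinvAlg k H A)ᵐᵒᵖ] HopfCarrier M where
  toFun := M.X.coinv.subtype
  map_add' _ _ := rfl
  map_smul' _ _ := rfl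

/-- Right multiplication by a coinvariant is colinear. With `B` acting on `M ⊗ H` through `M`, this
makes the coaction `B`-linear, so flatness over `B` can be applied to it. -/
theorem coact_smul (M : RightHopfMod k H A) (b : (CoinvAlg k H A)ᵐᵒᵖ) (m : HopfCarrier M) :
    HopfCarrier.coactLin M (b • m) = b • HopfCarrier.coactLin M m := by
  have h := LinearMap.congr_fun (mulRightCoinv M b.unop).colinear m
  refine (congrArg (HopfCarrier.coactLin M) (mulRightCoinv_apply M b.unop m)).symm.trans
    (h.trans ?_)
  change (mulRightCoinv M b.unop).lin.rTensor H (HopfCarrier.coactLin M m) = _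
  generalize HopfCarrier.coactLin M m = x
  induction x with
  | zero => rw [smul_zero]; exact map_zero _
  | add x y hx hy => rw [smul_add, ← hx, ← hy]; exact map_add _ _ _
  | tmul x y =>
    rw [TensorProduct.smul_tmul']
    exact congrArg (· ⊗ₜ[k] y) (mulRightCoinv_apply M b.unop x)

/-- `m ↦ m₀ ⊗ m₁ - m ⊗ 1`. -/
def coactDiff (M : RightHopfMod k H A) :
    HopfCarrier M →ₗ[(CoinvAlg k H A)ᵐᵒᵖ] HopfCarrier M ⊗[k] H where
  toFun m := HopfCarrier.coactLin M m - m ⊗ₜ 1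
  map_add' m m' := by rw [map_add, add_tmul, add_sub_add_comm]
  map_smul' b m := by rw [RingHom.id_apply, coact_smul, smul_sub, TensorProduct.smul_tmul']

theorem exact_coactDiff (M : RightHopfMod k H A) :
    Function.Exact (coinvIncl M) (coactDiff M) := fun m =>
  ⟨fun h => ⟨⟨m, sub_eq_zero.1 h⟩, rfl⟩, fun ⟨m', h⟩ => h ▸ sub_eq_zero.2 m'.2⟩

/-- `m ↦ m₀ ⊗ β(m₁)m₂`. -/
def coevCarrier (M : RightHopfMod k H A) : HopfCarrier M →ₗ[k] HopfCarrier M ⊗[k] H :=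
  coevLin M.X.coact

/-- `m ⊗ h ↦ m₀ ⊗ h₂ ⊗ m₁S(h₁) - m ⊗ h ⊗ 1`. -/
def antiCoactDiff (M : RightHopfMod k H A) :
    HopfCarrier M ⊗[k] H →ₗ[k] (HopfCarrier M ⊗[k] H) ⊗[k] H :=
  (M.X ⊗ anti k H).coact - trivialCoact (HopfCarrier M ⊗[k] H)

theorem antiCoactDiff_coev (M : RightHopfMod k H A) (m : HopfCarrier M) :
    antiCoactDiff M (coevCarrier M m) = 0 :=
  sub_eq_zero.2 (LinearMap.congr_fun (coevLin_colinear M.X) m)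

/-- The commutative square behind both halves of bijectivity: on `M^coH ⊗_B A` the Galois map is the
counit followed by the coevaluation, by `canHom_coinv`. -/
theorem canBal_map_coinvIncl (M : RightHopfMod k H A)
    (x : BalancedTensor k (CoinvAlg k H A) (CoinvCarrier ((coinvRight k H A).obj M)) A) :
    canBal M (BalancedTensor.map k (CoinvAlg k H A) A (coinvIncl M) x) =
      coevCarrier M (indCounitLin M x) := by
  have h : canBal M ∘ₗ BalancedTensor.map k (CoinvAlg k H A) A (coinvIncl M) =
      coevCarrier M ∘ₗ indCounitLin M :=
    Submodule.linearMap_qext _ (TensorProduct.ext' fun m a => canHom_coinv M m.2 a)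
  exact LinearMap.congr_fun h x

/-- By flatness the inclusion `M^coH → M` stays injective after `- ⊗_B A`. Composed with the Galois
map it is injective, and this composite factors through the counit. -/
theorem indCounitLin_injective (hflat : IsLeftFaithfullyFlat k (CoinvAlg k H A) A)
    (hgal : IsGaloisExtension k H A) (M : RightHopfMod k H A) :
    Function.Injective (indCounitLin M) := by
  rw [injective_iff_map_eq_zero]
  intro x hx
  have h1 := (canBal_map_coinvIncl M x).trans
    ((congrArg (coevCarrier M) hx).trans (map_zero (coevCarrier M)))
  rw [← map_zero (canBal M)] at h1
  have h2 := (canBal_bijective hgal M).1 h1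
  rw [← map_zero (BalancedTensor.map k (CoinvAlg k H A) A (coinvIncl M))] at h2
  exact (hflat.map_injective_iff (coinvIncl M)).2 Subtype.val_injective h2

/-- Colinearity of the Galois map, read modulo `B`. As `A` is given the trivial coaction, the
coaction of the source lives on `M` alone, so the kernel of `coactDiff M ⊗_B A` corresponds to the
coinvariants of `M ⊗ anti k H`. -/
theorem swap_coactDiff (M : RightHopfMod k H A) :
    (canBal M).rTensor H ∘ₗ BalancedTensor.swap k (CoinvAlg k H A) A (HopfCarrier M) H ∘ₗ
      BalancedTensor.map k (CoinvAlg k H A) A (coactDiff M) = antiCoactDiff M ∘ₗ canBal M := by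
  refine Submodule.linearMap_qext _ (TensorProduct.ext' fun m a => ?_)
  have h1 : (canBal M).rTensor H ∘ₗ BalancedTensor.swap k (CoinvAlg k H A) A (HopfCarrier M) H ∘ₗ
      (balancedRel k (CoinvAlg k H A) (HopfCarrier M ⊗[k] H) A).mkQ =
      (canLin M).rTensor H ∘ₗ (TensorProduct.rightComm k (HopfCarrier M) H A).toLinearMap :=
    TensorProduct.ext_threefold fun m h a => rfl
  have h2 := LinearMap.congr_fun h1 (coactDiff M m ⊗ₜ a)
  refine h2.trans ?_
  have h3 : (M.X ⊗ anti k H).coact (canLin M (m ⊗ₜ a)) = (canLin M).rTensor H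
      (codiagCoact M.X.coact (triv k H A).coact (m ⊗ₜ[k] a)) :=
    LinearMap.congr_fun (canHom M).colinear (m ⊗ₜ[k] a)
  have h4 : codiagCoact M.X.coact (triv k H A).coact (m ⊗ₜ[k] a) =
      TensorProduct.rightComm k (HopfCarrier M) H A (HopfCarrier.coactLin M m ⊗ₜ a) := by
    change (LinearMap.mul' k H).lTensor (M.X.carrier ⊗[k] A)
      (tensorTensorTensorComm k M.X.carrier H A H (M.X.coact m ⊗ₜ (a ⊗ₜ (1 : H)))) =
      TensorProduct.rightComm k M.X.carrier H A (M.X.coact m ⊗ₜ a)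
    generalize M.X.coact m = x
    induction x with
    | zero => simp
    | add x y hx hy => simp only [add_tmul, map_add, hx, hy]
    | tmul x y => simp
  have h5 : coactDiff M m = HopfCarrier.coactLin M m - m ⊗ₜ 1 := rfl
  refine Eq.trans ?_ (congrArg (· - canLin M (m ⊗ₜ a) ⊗ₜ[k] (1 : H)) h3.symm)
  rw [h4, h5, sub_tmul, map_sub]
  rfl

/-- The coevaluation of `m` is coinvariant, so its preimage under the Galois map lies in the kernel
that flatness identifies with `M^coH ⊗_B A`. -/
theorem indCounitLin_surjective (hflat : IsLeftFaithfullyFlat k (CoinvAlg k H A) A)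
    (hgal : IsGaloisExtension k H A) (M : RightHopfMod k H A) :
    Function.Surjective (indCounitLin M) := by
  intro (m : HopfCarrier M)
  obtain ⟨y, hy⟩ := (canBal_bijective hgal M).2 (coevCarrier M m)
  have h1 : BalancedTensor.map k (CoinvAlg k H A) A (coactDiff M) y = 0 := by
    have h2 := LinearMap.congr_fun (swap_coactDiff M) y
    rw [LinearMap.comp_apply, LinearMap.comp_apply, LinearMap.comp_apply, hy,
      antiCoactDiff_coev] at h2
    -- Vanishing can be tested after `swap` and after tensoring the injective Galois map with `H`,
    -- where `swap_coactDiff` applies.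
    refine BalancedTensor.swap_injective H
      (Module.Flat.rTensor_preserves_injective_linearMap _ (canBal_bijective hgal M).1 ?_)
    rw [h2, map_zero, map_zero]
  obtain ⟨x, rfl⟩ := ((hflat _ _ _ _ _).1 (exact_coactDiff M) y).1 h1
  -- The element found has the right coevaluation, and injectivity of the coevaluation identifies
  -- its counit image with `m`.
  refine ⟨x, coevLin_injective M.X ?_⟩
  exact (canBal_map_coinvIncl M x).symm.trans hy

end Counit

/-- The module structure on a quotient of a right module. -/
abbrev RightMod.quotient {C : Type*} [Category* C] [MonoidalCategory C] {A : Mon C}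
    (M : RightMod A) {Y : C} (p : M.X ⟶ Y) (act : Y ⊗ A.X ⟶ Y) [Epi (p ▷ 𝟙_ C)]
    [Epi (p ▷ A.X ▷ A.X)] (h : p ▷ A.X ≫ act = M.act ≫ p) : RightMod A where
  X := Y
  act := act
  act_one := by
    rw [← cancel_epi (p ▷ 𝟙_ C), ← whisker_exchange_assoc, h, reassoc_of% M.act_one,
      rightUnitor_naturality]
  act_assoc := by
    rw [← cancel_epi (p ▷ A.X ▷ A.X), ← comp_whiskerRight_assoc, h, comp_whiskerRight_assoc, h,
      reassoc_of% M.act_assoc, associator_naturality_left_assoc, ← whisker_exchange_assoc, h]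

/-! ### The induction functor `N ↦ N ⊗_B A` and its adjunction with coinvariants -/

noncomputable section Induction

open CoquasiBialgebra Comod

variable {k : Type u} [Field k]
variable {H : Type u} [NonAssocRing H] [Module k H] [IsScalarTower k H H] [SMulCommClass k H H]
  [Coalgebra k H] [CoquasiBialgebra k H]
variable {A : Type u} [NonAssocRing A] [Module k A] [IsScalarTower k A A] [SMulCommClass k A A]
  [ComoduleAlgebra k H A]

/-- A linear map induced by a morphism of comodules on a quotient comodule is a morphism. -/
abbrev Comod.ofSurjective {X Y Z : Comod k H} (f : X ⟶ Y) (hf : Function.Surjective f.lin)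
    (g : X ⟶ Z) (h : Y.carrier →ₗ[k] Z.carrier) (hfg : h ∘ₗ f.lin = g.lin) : Y ⟶ Z where
  lin := h
  colinear := by
    rw [← LinearMap.cancel_right hf, LinearMap.comp_assoc, hfg, g.colinear, LinearMap.comp_assoc,
      f.colinear, ← LinearMap.comp_assoc, ← LinearMap.rTensor_comp, hfg]

theorem codiag_triv (V : Type u) [AddCommGroup V] [Module k V] (W : Comod k H) (v : V)
    (w : W.carrier) : codiagCoact (triv k H V).coact W.coact (v ⊗ₜ w) =
      (TensorProduct.assoc k V W.carrier H).symm (v ⊗ₜ W.coact w) := by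
  change (LinearMap.mul' k H).lTensor (V ⊗[k] W.carrier)
    (tensorTensorTensorComm k V H W.carrier H ((v ⊗ₜ (1 : H)) ⊗ₜ W.coact w)) = _
  generalize W.coact w = x
  induction x with
  | zero => simp
  | add x y hx hy => simp only [tmul_add, map_add, hx, hy]
  | tmul x y => simp

variable (N : RightCoinvMod k H A)

/-- The vector space `N ⊗_B A`. -/
abbrev IndCarrier : Type u := BalancedTensor k (CoinvAlg k H A) (CoinvCarrier N) A

/-- The class of `n ⊗ a` in `N ⊗_B A`. -/
def indMk : CoinvCarrier N ⊗[k] A →ₗ[k] IndCarrier N :=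
  (balancedRel k (CoinvAlg k H A) (CoinvCarrier N) A).mkQ

theorem indMk_surjective : Function.Surjective (indMk N) := Submodule.mkQ_surjective _

theorem indMk_balanced (n : CoinvCarrier N) (b : CoinvAlg k H A) (a : A) :
    indMk N (CoinvCarrier.actLin N (n ⊗ₜ b) ⊗ₜ a) = indMk N (n ⊗ₜ (CoinvAlg.val b * a)) :=
  (Submodule.Quotient.eq _).2 (Submodule.subset_span ⟨n, b, a, rfl⟩)

variable {N} in
/-- A linear map on `N ⊗_B A` from a balanced map. -/
def indLift {V : Type u} [AddCommGroup V] [Module k V] (f : CoinvCarrier N ⊗[k] A →ₗ[k] V)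
    (hf : ∀ (n : CoinvCarrier N) (b : CoinvAlg k H A) (a : A),
      f (CoinvCarrier.actLin N (n ⊗ₜ b) ⊗ₜ a) = f (n ⊗ₜ (CoinvAlg.val b * a))) :
    IndCarrier N →ₗ[k] V :=
  Submodule.liftQ _ f (by
    rw [balancedRel, Submodule.span_le]
    rintro _ ⟨n, b, a, rfl⟩
    rw [SetLike.mem_coe, LinearMap.mem_ker, map_sub, sub_eq_zero]
    exact hf n b a)

variable {N} in
theorem ind_hom_ext {V : Type u} [AddCommGroup V] [Module k V] {f g : IndCarrier N →ₗ[k] V}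
    (h : ∀ n a, f (indMk N (n ⊗ₜ a)) = g (indMk N (n ⊗ₜ a))) : f = g :=
  Submodule.linearMap_qext _ (TensorProduct.ext' h)

/-- With a coinvariant on the left, the quasi-associative action is strictly associative. Applied to
`A` itself, this makes left multiplication by `B` commute with right multiplication by `A`, so that
`A` can act on `N ⊗_B A`. -/
theorem act_assoc_of_mem_coinv (M : RightHopfMod k H A) {m : M.X.carrier} (hm : m ∈ M.X.coinv)
    (a c : A) : M.act.lin (M.act.lin (m ⊗ₜ[k] a) ⊗ₜ[k] c) = M.act.lin (m ⊗ₜ[k] (a * c)) := by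
  have h := LinearMap.congr_fun (congrArg Comod.Hom.lin M.act_assoc) ((m ⊗ₜ[k] a) ⊗ₜ[k] c)
  refine h.trans ?_
  change M.act.lin ((LinearMap.mul' k A).lTensor M.X.carrier (reassoc M.X.coact
      (algComod k H A).coact (algComod k H A).coact ((m ⊗ₜ[k] a) ⊗ₜ[k] c))) = _
  rw [reassoc_left M.X (algComod k H A) (algComod k H A) hm]
  rfl

theorem coinv_mul_assoc (b : CoinvAlg k H A) (a c : A) :
    CoinvAlg.val b * a * c = CoinvAlg.val b * (a * c) :=
  act_assoc_of_mem_coinv (RightMod.regular (algMon k H A)) b.2 a c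

theorem coact_coinv_mul (b : CoinvAlg k H A) (a : A) :
    ComoduleAlgebra.coact (k := k) (H := H) (CoinvAlg.val b * a) =
      (LinearMap.mulLeft k (CoinvAlg.val b)).rTensor H (ComoduleAlgebra.coact a) := by
  have h := LinearMap.congr_fun (ComoduleAlgebra.coact_mul (k := k) (H := H) (A := A))
    (CoinvAlg.val b ⊗ₜ a)
  simp only [LinearMap.comp_apply, codiagCoact, ext_tmul, CoinvAlg.coact_val] at h
  refine h.trans ?_
  generalize ComoduleAlgebra.coact (k := k) (H := H) a = x
  induction x with
  | zero => simp
  | add x y hx hy => simp only [tmul_add, map_add, hx, hy]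
  | tmul x y => simp

/-- The coaction `n ⊗ a ↦ n ⊗ a₀ ⊗ a₁` on `N ⊗_B A`. -/
def indCoact : IndCarrier N →ₗ[k] IndCarrier N ⊗[k] H :=
  indLift ((indMk N).rTensor H ∘ₗ
    codiagCoact (triv k H (CoinvCarrier N)).coact (algComod k H A).coact) fun n b a => by
    rw [LinearMap.comp_apply, LinearMap.comp_apply, codiag_triv, codiag_triv]
    erw [coact_coinv_mul]
    generalize (algComod k H A).coact a = x
    induction x with
    | zero => simp
    | add x y hx hy => simp only [tmul_add, map_add, hx, hy]
    | tmul x y =>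
      rw [LinearMap.rTensor_tmul, assoc_symm_tmul, assoc_symm_tmul, LinearMap.rTensor_tmul,
        LinearMap.rTensor_tmul, indMk_balanced]
      rfl

theorem indCoact_mk : indCoact N ∘ₗ indMk N = (indMk N).rTensor H ∘ₗ
    codiagCoact (triv k H (CoinvCarrier N)).coact (algComod k H A).coact := rfl

/-- The comodule `N ⊗_B A`. -/
abbrev indComod : Comod k H where
  carrier := IndCarrier N
  coact := indCoact N
  isCoaction :=
    have h := (triv k H (CoinvCarrier N)).isCoaction.codiagCoact (algComod k H A).isCoaction
    -- The comodule axioms descend from `N ⊗ A`, with trivial coaction on `N`, along the surjection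
    -- onto `N ⊗_B A`.
    { coassoc := (LinearMap.cancel_right (indMk_surjective N)).1
        (Comod.coassoc_comp h (indCoact_mk N))
      counit := (LinearMap.cancel_right (indMk_surjective N)).1
        (Comod.counit_comp h (indCoact_mk N)) }

/-- The projection `N ⊗ A ⟶ N ⊗_B A`. -/
def indProj : (RightMod.free (algMon k H A) (triv k H (CoinvCarrier N))).X ⟶ indComod N :=
  ⟨indMk N, indCoact_mk N⟩

/-- The action `(n ⊗ a) ⊗ c ↦ n ⊗ ac` on `N ⊗_B A`. -/
def indActLin : IndCarrier N ⊗[k] A →ₗ[k] IndCarrier N :=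
  TensorProduct.lift (indLift (TensorProduct.curry (indMk N ∘ₗ
    (LinearMap.mul' k A).lTensor (CoinvCarrier N) ∘ₗ
      (TensorProduct.assoc k (CoinvCarrier N) A A).toLinearMap)) fun n b a => by
    ext c
    simp only [curry_apply, LinearMap.comp_apply, LinearEquiv.coe_coe, assoc_tmul,
      LinearMap.lTensor_tmul, LinearMap.mul'_apply]
    rw [indMk_balanced, coinv_mul_assoc])

theorem indActLin_mk (n : CoinvCarrier N) (a c : A) :
    indActLin N (indMk N (n ⊗ₜ a) ⊗ₜ c) = indMk N (n ⊗ₜ (a * c)) := rfl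

theorem free_triv_act (V : Type u) [AddCommGroup V] [Module k V] (v : V) (a c : A) :
    (RightMod.free (algMon k H A) (triv k H V)).act.lin ((v ⊗ₜ[k] a) ⊗ₜ[k] c) =
      v ⊗ₜ[k] (a * c) := by
  change (LinearMap.mul' k A).lTensor V (reassoc (triv k H V).coact (algComod k H A).coact
    (algComod k H A).coact ((v ⊗ₜ[k] a) ⊗ₜ[k] c)) = _
  rw [reassoc_left (triv k H V) (algComod k H A) (algComod k H A) rfl]
  rfl

/-- The action on `N ⊗_B A` as a morphism of comodules. -/
def indAct : indComod N ⊗ algComod k H A ⟶ indComod N :=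
  Comod.ofSurjective (indProj N ▷ algComod k H A)
    (LinearMap.rTensor_surjective A (indMk_surjective N))
    ((RightMod.free (algMon k H A) (triv k H (CoinvCarrier N))).act ≫ indProj N) (indActLin N)
    (TensorProduct.ext_threefold fun _ _ _ =>
      (congrArg (indMk N) (free_triv_act (H := H) (CoinvCarrier N) _ _ _)).symm)

instance {X Y Z : Comod k H} (f : X ⟶ Y) [Epi f] : Epi (f ▷ Z) :=
  inferInstanceAs (Epi ((tensorRight Z).map f))

instance : Epi (indProj N) := epi_of_surjective _ (indMk_surjective N)

/-- The relative Hopf module `N ⊗_B A`. -/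
def indObj : RightHopfMod k H A :=
  RightMod.quotient (RightMod.free (algMon k H A) (triv k H (CoinvCarrier N)))
    (indProj N) (indAct N) (hom_ext (TensorProduct.ext_threefold fun _ _ _ =>
      (congrArg (indMk N) (free_triv_act (H := H) (CoinvCarrier N) _ _ _)).symm))

variable {N} in
/-- `f ⊗_B A`. -/
def indMapLin {N' : RightCoinvMod k H A} (f : N ⟶ N') : IndCarrier N →ₗ[k] IndCarrier N' :=
  BalancedTensor.map k (CoinvAlg k H A) A (CoinvCarrier.map f)

variable {N} in
theorem indMapLin_mk {N' : RightCoinvMod k H A} (f : N ⟶ N') (n : CoinvCarrier N) (a : A) :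
    indMapLin f (indMk N (n ⊗ₜ a)) = indMk N' (CoinvCarrier.map f n ⊗ₜ a) := rfl

variable {N} in
theorem indMapLin_act {N' : RightCoinvMod k H A} (f : N ⟶ N') (x : IndCarrier N) (c : A) :
    indMapLin f (indActLin N (x ⊗ₜ c)) = indActLin N' (indMapLin f x ⊗ₜ c) := by
  obtain ⟨x, rfl⟩ := indMk_surjective _ x
  induction x with
  | zero => simp
  | add x y hx hy => rw [map_add, add_tmul, map_add, map_add, map_add, add_tmul, map_add, hx, hy]
  | tmul m a => rw [indActLin_mk, indMapLin_mk, indMapLin_mk, indActLin_mk]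

variable {N} in
/-- `f ⊗_B A` as a morphism. -/
def indMap {N' : RightCoinvMod k H A} (f : N ⟶ N') : indObj N ⟶ indObj N' where
  hom := Comod.ofSurjective (indProj N) (indMk_surjective N)
    ((trivMap ((CoinvCarrier.map f).restrictScalars k) ▷ algComod k H A) ≫ indProj N')
    (indMapLin f) rfl
  act_hom := hom_ext (TensorProduct.ext' fun x c => indMapLin_act f x c)

theorem RightHopfMod.hom_ext {M N : RightHopfMod k H A} {f g : M ⟶ N}
    (h : f.hom.lin = g.hom.lin) : f = g := RightMod.hom_ext (Comod.hom_ext h)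

theorem RightCoinvMod.hom_ext {M N : RightCoinvMod k H A} {f g : M ⟶ N}
    (h : ∀ n : CoinvCarrier M, CoinvCarrier.map f n = CoinvCarrier.map g n) : f = g :=
  RightMod.hom_ext (ModuleCat.hom_ext (LinearMap.ext h))

theorem indMapLin_id : indMapLin (𝟙 N) = LinearMap.id := ind_hom_ext fun _ _ => rfl

variable {N} in
theorem indMapLin_comp {N' N'' : RightCoinvMod k H A} (f : N ⟶ N') (g : N' ⟶ N'') :
    indMapLin (f ≫ g) = indMapLin g ∘ₗ indMapLin f := ind_hom_ext fun _ _ => rfl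

variable (k H A) in
/-- The induction functor `N ↦ N ⊗_B A`. -/
def indFunctor : RightCoinvMod k H A ⥤ RightHopfMod k H A where
  obj N := indObj N
  map f := indMap f
  map_id N := RightHopfMod.hom_ext (indMapLin_id N)
  map_comp f g := RightHopfMod.hom_ext (indMapLin_comp f g)

/-- The unit `N ⟶ (N ⊗_B A)^coH`, `n ↦ n ⊗ 1`. -/
def indUnit : N ⟶ (coinvRight k H A).obj (indObj N) :=
  CoinvCarrier.mkHom (N' := (coinvRight k H A).obj (indObj N))
    (LinearMap.codRestrict (indComod N).coinv
      (indMk N ∘ₗ (TensorProduct.mk k (CoinvCarrier N) A).flip 1) fun n => by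
        change (indMk N).rTensor H (codiagCoact (triv k H (CoinvCarrier N)).coact
          (algComod k H A).coact (n ⊗ₜ 1)) = indMk N (n ⊗ₜ 1) ⊗ₜ 1
        rw [codiag_triv]
        erw [ComoduleAlgebra.coact_one]
        rfl) fun n b => Subtype.ext (by
      change indMk N (CoinvCarrier.actLin N (n ⊗ₜ b) ⊗ₜ 1) = indMk N (n ⊗ₜ (1 * CoinvAlg.val b))
      rw [indMk_balanced, one_mul, mul_one])

/-- The inclusion of the coinvariants as a morphism of comodules. -/
def Comod.coinvIncl (M : Comod k H) : triv k H M.coinv ⟶ M :=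
  ⟨M.coinv.subtype, LinearMap.ext fun m => m.2⟩

/-- The counit as a morphism of comodules. -/
def indCounitHom (M : RightHopfMod k H A) : indComod ((coinvRight k H A).obj M) ⟶ M.X :=
  Comod.ofSurjective (indProj ((coinvRight k H A).obj M)) (indMk_surjective _)
    (Comod.coinvIncl M.X ▷ algComod k H A ≫ M.act) (indCounitLin M) rfl

theorem indCounitLin_act (M : RightHopfMod k H A) (x : IndCarrier ((coinvRight k H A).obj M))
    (c : A) : indCounitLin M (indActLin _ (x ⊗ₜ c)) = M.act.lin (indCounitLin M x ⊗ₜ[k] c) := by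
  obtain ⟨x, rfl⟩ := indMk_surjective _ x
  induction x with
  | zero => simp
  | add x y hx hy => rw [map_add, add_tmul, map_add, map_add, map_add, add_tmul, map_add, hx, hy]
  | tmul m a => exact (act_assoc_of_mem_coinv M m.2 a c).symm

/-- The counit `M^coH ⊗_B A ⟶ M`, `m ⊗ a ↦ ma`. -/
def indCounit (M : RightHopfMod k H A) :
    indObj ((coinvRight k H A).obj M) ⟶ M where
  hom := indCounitHom M
  act_hom := hom_ext (TensorProduct.ext' fun x c => indCounitLin_act M x c)

theorem indCounit_naturality {M M' : RightHopfMod k H A} (f : M ⟶ M') :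
    indMap ((coinvRight k H A).map f) ≫ indCounit M' = indCounit M ≫ f := by
  refine RightHopfMod.hom_ext (ind_hom_ext fun m a => ?_)
  exact (LinearMap.congr_fun (congrArg Comod.Hom.lin f.act_hom)
    ((show M.X.coinv from m).1 ⊗ₜ[k] a)).symm

theorem ind_left_triangle (N : RightCoinvMod k H A) :
    indMap (indUnit N) ≫ indCounit (indObj N) = 𝟙 (indObj N) := by
  refine RightHopfMod.hom_ext (ind_hom_ext fun n a => ?_)
  change indActLin N (indMk N (n ⊗ₜ 1) ⊗ₜ a) = indMk N (n ⊗ₜ a)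
  rw [indActLin_mk, one_mul]

theorem ind_right_triangle (M : RightHopfMod k H A) :
    indUnit ((coinvRight k H A).obj M) ≫ (coinvRight k H A).map (indCounit M) = 𝟙 _ :=
  RightCoinvMod.hom_ext fun m => Subtype.ext (right_one M (show M.X.coinv from m).1)

variable (k H A) in
/-- Induction is left adjoint to coinvariants. -/
def indAdj : indFunctor k H A ⊣ coinvRight k H A :=
  Adjunction.mkOfUnitCounit
    { unit := { app := indUnit, naturality := fun _ _ _ => RightCoinvMod.hom_ext fun _ => rfl }
      counit := { app := indCounit, naturality := fun _ _ f => indCounit_naturality f }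
      left_triangle := NatTrans.ext <| funext fun N =>
        (congrArg (CategoryStruct.comp _) (Category.id_comp _)).trans (ind_left_triangle N)
      right_triangle := NatTrans.ext <| funext fun M =>
        (congrArg (CategoryStruct.comp _) (Category.id_comp _)).trans (ind_right_triangle M) }

theorem Comod.isIso_of_bijective {M N : Comod k H} (f : M ⟶ N) (h : Function.Bijective f.lin) :
    IsIso f := by
  have : IsIso ((Comod.forget k H).map f) :=
    (ConcreteCategory.isIso_iff_bijective ((Comod.forget k H).map f)).2 h
  exact isIso_of_reflects_iso f (Comod.forget k H)

theorem RightMod.isIso_of_isIso_hom {C : Type*} [Category* C] [MonoidalCategory C] {A : Mon C}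
    {M N : RightMod A} (f : M ⟶ N) [IsIso f.hom] : IsIso f :=
  (RightMod.mkIso f (inv f.hom) (IsIso.hom_inv_id _) (IsIso.inv_hom_id _)).isIso_hom

theorem RightHopfMod.isIso_of_bijective {M N : RightHopfMod k H A} (f : M ⟶ N)
    (h : Function.Bijective f.hom.lin) : IsIso f :=
  have := Comod.isIso_of_bijective f.hom h
  RightMod.isIso_of_isIso_hom f

theorem RightCoinvMod.isIso_of_bijective {M N : RightCoinvMod k H A} (f : M ⟶ N)
    (h : Function.Bijective (CoinvCarrier.map f)) : IsIso f :=
  have := (ConcreteCategory.isIso_iff_bijective f.hom).2 h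
  RightMod.isIso_of_isIso_hom f

end Induction

/-! ### Coinvariants `M_A^H → M_B` are an equivalence -/

noncomputable section Equivalence

variable {k : Type u} [Field k]
variable {H : Type u} [NonAssocRing H] [Module k H] [IsScalarTower k H H] [SMulCommClass k H H]
  [Coalgebra k H] [CoquasiHopfAlgebra k H]
variable {A : Type u} [NonAssocRing A] [Module k A] [IsScalarTower k A A] [SMulCommClass k A A]
  [ComoduleAlgebra k H A]

theorem indCounitLin_bijective (hflat : IsLeftFaithfullyFlat k (CoinvAlg k H A) A)
    (hgal : IsGaloisExtension k H A) (M : RightHopfMod k H A) :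
    Function.Bijective (indCounitLin M) :=
  ⟨indCounitLin_injective hflat hgal M, indCounitLin_surjective hflat hgal M⟩

/-- By the left triangle identity, the induced unit is a section of the counit of `N ⊗_B A`, which
is bijective. Faithful flatness then removes the induction from the unit itself. -/
theorem indMapLin_indUnit_bijective (hflat : IsLeftFaithfullyFlat k (CoinvAlg k H A) A)
    (hgal : IsGaloisExtension k H A) (N : RightCoinvMod k H A) :
    Function.Bijective (indMapLin (indUnit N)) := by
  have h1 : indCounitLin (indObj N) ∘ indMapLin (indUnit N) = id :=
    congrArg (fun f : indObj N ⟶ indObj N => (f.hom.lin : IndCarrier N → IndCarrier N))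
      (ind_left_triangle N)
  have h2 := indCounitLin_bijective hflat hgal (indObj N)
  refine (h2.of_comp_iff' _).1 ?_
  rw [h1]
  exact Function.bijective_id

theorem map_bijective_of_indMapLin (hflat : IsLeftFaithfullyFlat k (CoinvAlg k H A) A)
    {N N' : RightCoinvMod k H A} (f : N ⟶ N') (h : Function.Bijective (indMapLin f)) :
    Function.Bijective (CoinvCarrier.map f) :=
  ⟨(hflat.map_injective_iff _).1 h.1, (hflat.map_surjective_iff _).1 h.2⟩

theorem isEquivalence_coinvRight (hflat : IsLeftFaithfullyFlat k (CoinvAlg k H A) A)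
    (hgal : IsGaloisExtension k H A) : (coinvRight k H A).IsEquivalence := by
  have h1 (N : RightCoinvMod k H A) : IsIso ((indAdj k H A).unit.app N) :=
    RightCoinvMod.isIso_of_bijective (indUnit N)
      (map_bijective_of_indMapLin hflat _ (indMapLin_indUnit_bijective hflat hgal N))
  have h2 (M : RightHopfMod k H A) : IsIso ((indAdj k H A).counit.app M) :=
    RightHopfMod.isIso_of_bijective (indCounit M) (indCounitLin_bijective hflat hgal M)
  exact (indAdj k H A).toEquivalence.isEquivalence_inverse

end Equivalence

/-! ### The tensor product over a monoid, described through the projection `M ⊗ N ⟶ M ⊗_A N` -/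

section TensorProj

variable {C : Type*} [Category* C] [MonoidalCategory C]
  [HasCoequalizers C] [∀ X : C, PreservesColimitsOfSize.{0, 0} (tensorLeft X)]
  [∀ X : C, PreservesColimitsOfSize.{0, 0} (tensorRight X)] {A : Mon C}

theorem tensorProj_condition (M N : Bimod A A) :
    M.actRight ▷ N.X ≫ tensorProj M N = (α_ _ _ _).hom ≫ M.X ◁ N.actLeft ≫ tensorProj M N :=
  (coequalizer.condition _ _).trans (Category.assoc _ _ _)

/-- A morphism out of the tensor product over `A`. -/
noncomputable def tensorDesc {M N : Bimod A A} {Z : C} (f : M.X ⊗ N.X ⟶ Z)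
    (h : M.actRight ▷ N.X ≫ f = (α_ _ _ _).hom ≫ M.X ◁ N.actLeft ≫ f) :
    (M ⊗ N : Bimod A A).X ⟶ Z :=
  coequalizer.desc f (by rw [h, Category.assoc])

theorem tensorProj_desc {M N : Bimod A A} {Z : C} (f : M.X ⊗ N.X ⟶ Z)
    (h : M.actRight ▷ N.X ≫ f = (α_ _ _ _).hom ≫ M.X ◁ N.actLeft ≫ f) :
    tensorProj M N ≫ tensorDesc f h = f := coequalizer.π_desc _ _

instance (M N : Bimod A A) : Epi (tensorProj M N) :=
  inferInstanceAs (Epi (coequalizer.π _ _))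

instance (M N : Bimod A A) (X : C) : Epi (tensorProj M N ▷ X) :=
  inferInstanceAs (Epi ((tensorRight X).map (tensorProj M N)))

instance (M N : Bimod A A) (X : C) : Epi (X ◁ tensorProj M N) :=
  inferInstanceAs (Epi ((tensorLeft X).map (tensorProj M N)))

theorem tensorProj_actLeft (M N : Bimod A A) :
    A.X ◁ tensorProj M N ≫ (M ⊗ N : Bimod A A).actLeft =
      (α_ _ _ _).inv ≫ M.actLeft ▷ N.X ≫ tensorProj M N :=
  Bimod.TensorBimod.whiskerLeft_π_actLeft M N

theorem tensorProj_actRight (M N : Bimod A A) :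
    tensorProj M N ▷ A.X ≫ (M ⊗ N : Bimod A A).actRight =
      (α_ _ _ _).hom ≫ M.X ◁ N.actRight ≫ tensorProj M N :=
  Bimod.TensorBimod.π_tensor_id_actRight M N

theorem tensorProj_whiskerLeft (M : Bimod A A) {N N' : Bimod A A} (f : N ⟶ N') :
    tensorProj M N ≫ (M ◁ f).hom = M.X ◁ f.hom ≫ tensorProj M N' :=
  ι_colimMap _ WalkingParallelPair.one

theorem tensorProj_whiskerRight {M M' : Bimod A A} (f : M ⟶ M') (N : Bimod A A) :
    tensorProj M N ≫ (f ▷ N).hom = f.hom ▷ N.X ≫ tensorProj M' N :=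
  ι_colimMap _ WalkingParallelPair.one

theorem tensorProj_leftUnitor (M : Bimod A A) :
    tensorProj (𝟙_ (Bimod A A)) M ≫ (λ_ M).hom.hom = M.actLeft :=
  coequalizer.π_desc _ _

theorem tensorProj_rightUnitor (M : Bimod A A) :
    tensorProj M (𝟙_ (Bimod A A)) ≫ (ρ_ M).hom.hom = M.actRight :=
  coequalizer.π_desc _ _

theorem tensorProj_associator (M N P : Bimod A A) :
    tensorProj M N ▷ P.X ≫ tensorProj (M ⊗ N) P ≫ (α_ M N P).hom.hom =
      (α_ _ _ _).hom ≫ M.X ◁ tensorProj N P ≫ tensorProj M (N ⊗ P) := by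
  have h : tensorProj (M ⊗ N) P ≫ (α_ M N P).hom.hom = Bimod.AssociatorBimod.homAux M N P :=
    coequalizer.π_desc _ _
  rw [h]
  exact π_tensor_id_preserves_coequalizer_inv_desc _ _ _ _

end TensorProj

/-! ### Tensor products over a monoid, on underlying vector spaces -/

noncomputable section ComodTensor

open Comod

variable {k : Type u} [Field k]
variable {H : Type u} [NonAssocRing H] [Module k H] [IsScalarTower k H H] [SMulCommClass k H H]
  [Coalgebra k H] [CoquasiBialgebra k H] {A : Mon (Comod k H)}

theorem tensorProj_surjective (M N : Bimod A A) : Function.Surjective (tensorProj M N).lin :=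
  (ModuleCat.epi_iff_surjective ((Comod.forget k H).map (tensorProj M N))).1 inferInstance

/-- Linear maps out of the tensor product over an algebra in comodules. -/
theorem exists_tensorProj_lift {M N : Bimod A A} {V : Type u} [AddCommGroup V] [Module k V]
    (f : M.X.carrier ⊗[k] N.X.carrier →ₗ[k] V)
    (h : f ∘ₗ (M.actRight ▷ N.X).lin = f ∘ₗ ((α_ M.X A.X N.X).hom ≫ M.X ◁ N.actLeft).lin) :
    ∃ g : (M ⊗ N : Bimod A A).X.carrier →ₗ[k] V, ∀ x, g ((tensorProj M N).lin x) = f x := by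
  -- The forgetful functor preserves the coequalizer, so the target `V` needs no coaction and the
  -- map need not be colinear.
  let c := isColimitOfHasCoequalizerOfPreservesColimit (Comod.forget k H) (M.actRight ▷ N.X)
    ((α_ M.X A.X N.X).hom ≫ M.X ◁ N.actLeft)
  obtain ⟨g, hg⟩ := Cofork.IsColimit.desc' c (W := ModuleCat.of k V) (ModuleCat.ofHom f)
    (ModuleCat.hom_ext h)
  exact ⟨g.hom, fun x => LinearMap.congr_fun (congrArg ModuleCat.Hom.hom hg) x⟩

end ComodTensor

section ModuleTensor

variable {k : Type u} [Field k] {B : Mon (ModuleCat.{u} k)}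

theorem moduleTensorProj_surjective (M N : Bimod B B) :
    Function.Surjective (tensorProj M N).hom :=
  (ModuleCat.epi_iff_surjective (tensorProj M N)).1 inferInstance

end ModuleTensor

/-! ### The map `M^coH ⊗_B N^coH → (M ⊗_A N)^coH` -/

noncomputable section Multiplication

open Comod

variable {k : Type u} [Field k]
variable {H : Type u} [NonAssocRing H] [Module k H] [IsScalarTower k H H] [SMulCommClass k H H]
  [Coalgebra k H] [CoquasiBialgebra k H]
variable {A : Type u} [NonAssocRing A] [Module k A] [IsScalarTower k A A] [SMulCommClass k A A]
  [ComoduleAlgebra k H A]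

section Elements

variable (M N : HopfBimod k H A)

/-- The balancing relation of `M ⊗_A N` involves `ω`, which disappears when `m` is coinvariant,
although `a` and `n` are arbitrary. This is what allows elements of `A` to be moved across the
tensor sign later. -/
theorem tensorProj_balanced_left {m : M.X.carrier} (hm : m ∈ M.X.coinv) (a : A)
    (n : N.X.carrier) : (tensorProj M N).lin (M.actRight.lin (m ⊗ₜ[k] a) ⊗ₜ[k] n) =
      (tensorProj M N).lin (m ⊗ₜ[k] N.actLeft.lin (a ⊗ₜ[k] n)) := by
  have h := LinearMap.congr_fun (congrArg Comod.Hom.lin (tensorProj_condition M N))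
    ((m ⊗ₜ[k] a) ⊗ₜ[k] n)
  refine h.trans ?_
  change (tensorProj M N).lin (N.actLeft.lin.lTensor M.X.carrier
    (reassoc M.X.coact (algComod k H A).coact N.X.coact ((m ⊗ₜ[k] a) ⊗ₜ[k] n))) = _
  rw [reassoc_left M.X (algComod k H A) N.X hm]
  rfl

theorem tensorProj_balanced_coinv (m : M.X.carrier) (b : CoinvAlg k H A) (n : N.X.carrier) :
    (tensorProj M N).lin (M.actRight.lin (m ⊗ₜ[k] CoinvAlg.val b) ⊗ₜ[k] n) =
      (tensorProj M N).lin (m ⊗ₜ[k] N.actLeft.lin (CoinvAlg.val b ⊗ₜ[k] n)) := by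
  have h := LinearMap.congr_fun (congrArg Comod.Hom.lin (tensorProj_condition M N))
    ((m ⊗ₜ[k] CoinvAlg.val b) ⊗ₜ[k] n)
  refine h.trans ?_
  change (tensorProj M N).lin (N.actLeft.lin.lTensor M.X.carrier
    (reassoc M.X.coact (algComod k H A).coact N.X.coact ((m ⊗ₜ[k] CoinvAlg.val b) ⊗ₜ[k] n))) = _
  rw [reassoc_middle M.X.isCoaction N.X.isCoaction (CoinvAlg.coact_val b)]
  rfl

theorem tensorProj_act_right {m : M.X.carrier} (hm : m ∈ M.X.coinv) (n : N.X.carrier) (a : A) :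
    (M ⊗ N : HopfBimod k H A).actRight.lin ((tensorProj M N).lin (m ⊗ₜ[k] n) ⊗ₜ[k] a) =
      (tensorProj M N).lin (m ⊗ₜ[k] N.actRight.lin (n ⊗ₜ[k] a)) := by
  have h := LinearMap.congr_fun (congrArg Comod.Hom.lin (tensorProj_actRight M N))
    ((m ⊗ₜ[k] n) ⊗ₜ[k] a)
  refine h.trans ?_
  change (tensorProj M N).lin (N.actRight.lin.lTensor M.X.carrier
    (reassoc M.X.coact N.X.coact (algComod k H A).coact ((m ⊗ₜ[k] n) ⊗ₜ[k] a))) = _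
  rw [reassoc_left M.X N.X (algComod k H A) hm]
  rfl

theorem tensorProj_act_left (b : CoinvAlg k H A) (m : M.X.carrier) (n : N.X.carrier) :
    (M ⊗ N : HopfBimod k H A).actLeft.lin
        (CoinvAlg.val b ⊗ₜ[k] (tensorProj M N).lin (m ⊗ₜ[k] n)) =
      (tensorProj M N).lin (M.actLeft.lin (CoinvAlg.val b ⊗ₜ[k] m) ⊗ₜ[k] n) := by
  have h := LinearMap.congr_fun (congrArg Comod.Hom.lin (tensorProj_actLeft M N))
    (CoinvAlg.val b ⊗ₜ[k] (m ⊗ₜ[k] n))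
  refine h.trans ?_
  change (tensorProj M N).lin (M.actLeft.lin.rTensor N.X.carrier
    (reassocInv (algComod k H A).coact M.X.coact N.X.coact
      (CoinvAlg.val b ⊗ₜ[k] (m ⊗ₜ[k] n)))) = _
  rw [reassocInv_left (algComod k H A) M.X N.X (CoinvAlg.coact_val b)]
  rfl

theorem act_left_assoc_coinv (b : CoinvAlg k H A) (a : A) (n : N.X.carrier) :
    N.actLeft.lin ((CoinvAlg.val b * a) ⊗ₜ[k] n) =
      N.actLeft.lin (CoinvAlg.val b ⊗ₜ[k] N.actLeft.lin (a ⊗ₜ[k] n)) := by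
  have h := LinearMap.congr_fun (congrArg Comod.Hom.lin N.left_assoc)
    ((CoinvAlg.val b ⊗ₜ[k] a) ⊗ₜ[k] n)
  refine h.trans ?_
  change N.actLeft.lin (N.actLeft.lin.lTensor A
    (reassoc (algComod k H A).coact (algComod k H A).coact N.X.coact
      ((CoinvAlg.val b ⊗ₜ[k] a) ⊗ₜ[k] n))) = _
  rw [reassoc_left (algComod k H A) (algComod k H A) N.X (CoinvAlg.coact_val b)]
  rfl

end Elements

variable (M N : HopfBimod k H A)

/-- The right module underlying a two-sided Hopf module. -/
abbrev HopfBimod.toRight : RightHopfMod k H A := (forgetLeft (algMon k H A) (algMon k H A)).obj M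

/-- `M^coH ⊗_B N^coH`. -/
abbrev coinvTensor : CoinvBimod k H A := (coinvBimod k H A).obj M ⊗ (coinvBimod k H A).obj N

/-- `M^coH ⊗_B N^coH` as a right module. -/
abbrev coinvTensorRight : RightCoinvMod k H A :=
  (forgetLeft (coinvMon k H A) (coinvMon k H A)).obj (coinvTensor M N)

/-- The projection `M^coH ⊗ N^coH → M^coH ⊗_B N^coH`. -/
def coinvTmul : M.X.coinv ⊗[k] N.X.coinv →ₗ[k] CoinvCarrier (coinvTensorRight M N) :=
  (tensorProj ((coinvBimod k H A).obj M) ((coinvBimod k H A).obj N)).hom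

/-- The right action of `B` on coinvariants. -/
def coinvActRight : M.X.coinv ⊗[k] CoinvAlg k H A →ₗ[k] M.X.coinv := Comod.coinvMap₂ M.actRight

/-- The left action of `B` on coinvariants. -/
def coinvActLeft : CoinvAlg k H A ⊗[k] M.X.coinv →ₗ[k] M.X.coinv := Comod.coinvMap₂ M.actLeft

theorem coinvTmul_surjective : Function.Surjective (coinvTmul M N) :=
  moduleTensorProj_surjective _ _

theorem coinvTmul_balanced (m : M.X.coinv) (b : CoinvAlg k H A) (n : N.X.coinv) :
    coinvTmul M N (coinvActRight M (m ⊗ₜ b) ⊗ₜ n) =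
      coinvTmul M N (m ⊗ₜ coinvActLeft N (b ⊗ₜ n)) :=
  LinearMap.congr_fun (congrArg ModuleCat.Hom.hom (tensorProj_condition
    ((coinvBimod k H A).obj M) ((coinvBimod k H A).obj N))) ((m ⊗ₜ[k] b) ⊗ₜ[k] n)

theorem coinvTmul_actRight (m : M.X.coinv) (n : N.X.coinv) (b : CoinvAlg k H A) :
    CoinvCarrier.actLin (coinvTensorRight M N) (coinvTmul M N (m ⊗ₜ n) ⊗ₜ b) =
      coinvTmul M N (m ⊗ₜ coinvActRight N (n ⊗ₜ b)) :=
  LinearMap.congr_fun (congrArg ModuleCat.Hom.hom (tensorProj_actRight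
    ((coinvBimod k H A).obj M) ((coinvBimod k H A).obj N))) ((m ⊗ₜ[k] n) ⊗ₜ[k] b)

theorem coinvTmul_actLeft (b : CoinvAlg k H A) (m : M.X.coinv) (n : N.X.coinv) :
    (coinvTensor M N).actLeft.hom (b ⊗ₜ[k] coinvTmul M N (m ⊗ₜ n)) =
      coinvTmul M N (coinvActLeft M (b ⊗ₜ m) ⊗ₜ n) :=
  LinearMap.congr_fun (congrArg ModuleCat.Hom.hom (tensorProj_actLeft
    ((coinvBimod k H A).obj M) ((coinvBimod k H A).obj N))) (b ⊗ₜ[k] (m ⊗ₜ[k] n))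

/-- The projection to the tensor product over `A`, restricted to coinvariants. -/
abbrev coinvProj :
    ((coinvBimod k H A).obj M).X ⊗ ((coinvBimod k H A).obj N).X ⟶
      ((coinvBimod k H A).obj (M ⊗ N)).X :=
  ModuleCat.ofHom (Comod.coinvMap₂ (tensorProj M N))

theorem coinvProj_condition :
    ((coinvBimod k H A).obj M).actRight ▷ ((coinvBimod k H A).obj N).X ≫
        coinvProj M N =
      (α_ ((coinvBimod k H A).obj M).X (coinvMon k H A).X ((coinvBimod k H A).obj N).X).hom ≫
        ((coinvBimod k H A).obj M).X ◁ ((coinvBimod k H A).obj N).actLeft ≫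
          coinvProj M N :=
  ModuleCat.hom_ext (TensorProduct.ext_threefold fun m b n =>
    Subtype.ext (tensorProj_balanced_coinv M N m.1 b n.1))

/-- The map `M^coH ⊗_B N^coH → (M ⊗_A N)^coH` of vector spaces. -/
def coinvMu : (coinvTensor M N).X ⟶ ((coinvBimod k H A).obj (M ⊗ N)).X :=
  tensorDesc (coinvProj M N) (coinvProj_condition M N)

theorem tensorProj_coinvMu :
    tensorProj ((coinvBimod k H A).obj M) ((coinvBimod k H A).obj N) ≫ coinvMu M N =
      coinvProj M N :=
  tensorProj_desc _ _

theorem coinvMu_mk (m : M.X.coinv) (n : N.X.coinv) :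
    (M ⊗ N : HopfBimod k H A).X.coinv.subtype ((coinvMu M N).hom (coinvTmul M N (m ⊗ₜ n))) =
      (tensorProj M N).lin (m.1 ⊗ₜ[k] n.1) :=
  congrArg (M ⊗ N : HopfBimod k H A).X.coinv.subtype (LinearMap.congr_fun
    (congrArg ModuleCat.Hom.hom (tensorProj_coinvMu M N)) (m ⊗ₜ[k] n))

theorem coinvMu_actRight_mk (m : M.X.coinv) (n : N.X.coinv) (b : CoinvAlg k H A) :
    (M ⊗ N : HopfBimod k H A).X.coinv.subtype ((coinvMu M N).hom
      (CoinvCarrier.actLin (coinvTensorRight M N) (coinvTmul M N (m ⊗ₜ n) ⊗ₜ b))) =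
    (M ⊗ N : HopfBimod k H A).actRight.lin ((M ⊗ N : HopfBimod k H A).X.coinv.subtype
      ((coinvMu M N).hom (coinvTmul M N (m ⊗ₜ n))) ⊗ₜ[k] CoinvAlg.val b) := by
  rw [coinvTmul_actRight, coinvMu_mk, coinvMu_mk, tensorProj_act_right M N m.2]
  rfl

theorem coinvMu_actLeft_mk (b : CoinvAlg k H A) (m : M.X.coinv) (n : N.X.coinv) :
    (M ⊗ N : HopfBimod k H A).X.coinv.subtype ((coinvMu M N).hom
      ((coinvTensor M N).actLeft.hom (b ⊗ₜ[k] coinvTmul M N (m ⊗ₜ n)))) =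
    (M ⊗ N : HopfBimod k H A).actLeft.lin (CoinvAlg.val b ⊗ₜ[k]
      (M ⊗ N : HopfBimod k H A).X.coinv.subtype ((coinvMu M N).hom (coinvTmul M N (m ⊗ₜ n)))) := by
  rw [coinvTmul_actLeft, coinvMu_mk, coinvMu_mk, tensorProj_act_left M N]
  rfl

theorem coinvMu_actRight :
    (coinvTensor M N).actRight ≫ coinvMu M N =
      coinvMu M N ▷ (coinvMon k H A).X ≫ ((coinvBimod k H A).obj (M ⊗ N)).actRight := by
  -- Tensoring preserves the coequalizer, so the projection whiskered with `B` is still epi and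
  -- linearity can be tested on tensors `m ⊗ n ⊗ b`.
  rw [← cancel_epi (tensorProj ((coinvBimod k H A).obj M) ((coinvBimod k H A).obj N) ▷ _)]
  refine ModuleCat.hom_ext (TensorProduct.ext_threefold fun m n b => Subtype.ext ?_)
  exact coinvMu_actRight_mk M N m n b

theorem coinvMu_actLeft :
    (coinvTensor M N).actLeft ≫ coinvMu M N =
      (coinvMon k H A).X ◁ coinvMu M N ≫ ((coinvBimod k H A).obj (M ⊗ N)).actLeft := by
  rw [← cancel_epi ((coinvMon k H A).X ◁
    tensorProj ((coinvBimod k H A).obj M) ((coinvBimod k H A).obj N))]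
  refine ModuleCat.hom_ext (TensorProduct.ext (LinearMap.ext fun b =>
    TensorProduct.ext' fun m n => Subtype.ext ?_))
  exact coinvMu_actLeft_mk M N b m n

/-- The map `M^coH ⊗_B N^coH → (M ⊗_A N)^coH` of right modules. -/
def coinvMuRight : coinvTensorRight M N ⟶
    (coinvRight k H A).obj (HopfBimod.toRight (M ⊗ N : HopfBimod k H A)) where
  hom := coinvMu M N
  act_hom := coinvMu_actRight M N

end Multiplication

/-! ### Inverting the induced map `(M^coH ⊗_B N^coH) ⊗_B A → M ⊗_A N` -/

noncomputable section Inverse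

variable {k : Type u} [Field k]
variable {H : Type u} [NonAssocRing H] [Module k H] [IsScalarTower k H H] [SMulCommClass k H H]
  [Coalgebra k H] [CoquasiBialgebra k H]
variable {A : Type u} [NonAssocRing A] [Module k A] [IsScalarTower k A A] [SMulCommClass k A A]
  [ComoduleAlgebra k H A]

variable (M N : HopfBimod k H A)

/-- The vector space `M^coH ⊗_B A` for a two-sided Hopf module. -/
abbrev IndCoinv : Type u := IndCarrier ((coinvRight k H A).obj (HopfBimod.toRight M))

/-- The class of `m ⊗ a` in `M^coH ⊗_B A`. -/
def indCoinvMk : M.X.coinv ⊗[k] A →ₗ[k] IndCoinv M :=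
  indMk ((coinvRight k H A).obj (HopfBimod.toRight M))

theorem indCoinvMk_surjective : Function.Surjective (indCoinvMk M) := indMk_surjective _

/-- The map `m ⊗ a ↦ ma`. -/
def indCoinvCounit : IndCoinv M →ₗ[k] M.X.carrier := indCounitLin (HopfBimod.toRight M)

theorem indCoinvCounit_mk (m : M.X.coinv) (a : A) :
    indCoinvCounit M (indCoinvMk M (m ⊗ₜ a)) = M.actRight.lin (m.1 ⊗ₜ[k] a) := rfl

/-- The map `(m, n ⊗ a) ↦ (m ⊗ n) ⊗ a`. -/
def coinvTensorMk : M.X.coinv →ₗ[k] IndCoinv N →ₗ[k] IndCarrier (coinvTensorRight M N) where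
  toFun m := indLift (indMk (coinvTensorRight M N) ∘ₗ
      (coinvTmul M N ∘ₗ TensorProduct.mk k M.X.coinv N.X.coinv m).rTensor A) fun n b a => by
    refine (congrArg (fun x => indMk (coinvTensorRight M N) (x ⊗ₜ[k] a))
      (coinvTmul_actRight M N m n b)).symm.trans ?_
    exact indMk_balanced _ _ _ _
  map_add' m m' := ind_hom_ext fun (n : N.X.coinv) a => by
    change indMk (coinvTensorRight M N) (coinvTmul M N ((m + m') ⊗ₜ[k] n) ⊗ₜ[k] a) =
      indMk (coinvTensorRight M N) (coinvTmul M N (m ⊗ₜ[k] n) ⊗ₜ[k] a) +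
        indMk (coinvTensorRight M N) (coinvTmul M N (m' ⊗ₜ[k] n) ⊗ₜ[k] a)
    rw [add_tmul, map_add, add_tmul, map_add]
  map_smul' r m := ind_hom_ext fun (n : N.X.coinv) a => by
    change indMk (coinvTensorRight M N) (coinvTmul M N ((r • m) ⊗ₜ[k] n) ⊗ₜ[k] a) =
      r • indMk (coinvTensorRight M N) (coinvTmul M N (m ⊗ₜ[k] n) ⊗ₜ[k] a)
    rw [← smul_tmul', map_smul, ← smul_tmul', map_smul]

theorem coinvTensorMk_mk (m : M.X.coinv) (n : N.X.coinv) (a : A) :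
    coinvTensorMk M N m (indCoinvMk N (n ⊗ₜ a)) =
      indMk (coinvTensorRight M N) (coinvTmul M N (m ⊗ₜ n) ⊗ₜ a) := rfl

/-- The composite of `M^coH ⊗_B N^coH ⊗_B A → (M ⊗_A N)^coH ⊗_B A` with the counit of
the latter. -/
def coinvTensorCounit :
    IndCarrier (coinvTensorRight M N) →ₗ[k] (M ⊗ N : HopfBimod k H A).X.carrier :=
  indCoinvCounit (M ⊗ N : HopfBimod k H A) ∘ₗ indMapLin (coinvMuRight M N)

/-- The counit lets `a` act on `[m ⊗ n]`; since `m` is coinvariant, the action passes to `n` without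
`ω`. -/
theorem coinvTensorCounit_mk (m : M.X.coinv) (n : N.X.coinv) (a : A) :
    coinvTensorCounit M N (indMk (coinvTensorRight M N) (coinvTmul M N (m ⊗ₜ n) ⊗ₜ a)) =
      (tensorProj M N).lin (m.1 ⊗ₜ[k] N.actRight.lin (n.1 ⊗ₜ[k] a)) := by
  rw [← tensorProj_act_right M N m.2, ← coinvMu_mk]
  rfl

/-- If `M` and `N` are spanned by elements `ma` and `nc` with `m`, `n` coinvariant, then so is `M
⊗_A N` by elements `[m ⊗ nc]`: in `[ma ⊗ y] = [m ⊗ ay]` the vector `ay` is again a sum of elements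
`nc`. -/
theorem coinvTensorCounit_surjective (hM : Function.Surjective (indCoinvCounit M))
    (hN : Function.Surjective (indCoinvCounit N)) :
    Function.Surjective (coinvTensorCounit M N) := by
  have h1 (m : M.X.coinv) (y : N.X.carrier) :
      (tensorProj M N).lin (m.1 ⊗ₜ[k] y) ∈ LinearMap.range (coinvTensorCounit M N) := by
    obtain ⟨y, rfl⟩ := hN y
    obtain ⟨y, rfl⟩ := indCoinvMk_surjective N y
    induction y with
    | zero => rw [map_zero, map_zero, tmul_zero, map_zero]; exact zero_mem _
    | add x y hx hy => rw [map_add, map_add, tmul_add, map_add]; exact add_mem hx hy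
    | tmul n a => exact ⟨_, coinvTensorCounit_mk M N m n a⟩
  have h2 (x : M.X.carrier) (y : N.X.carrier) :
      (tensorProj M N).lin (x ⊗ₜ[k] y) ∈ LinearMap.range (coinvTensorCounit M N) := by
    obtain ⟨x, rfl⟩ := hM x
    obtain ⟨x, rfl⟩ := indCoinvMk_surjective M x
    induction x with
    | zero => rw [map_zero, map_zero, zero_tmul, map_zero]; exact zero_mem _
    | add x y hx hy => rw [map_add, map_add, add_tmul, map_add]; exact add_mem hx hy
    | tmul m a =>
      rw [indCoinvCounit_mk, tensorProj_balanced_left M N m.2]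
      exact h1 _ _
  intro z
  obtain ⟨z, rfl⟩ := tensorProj_surjective M N z
  change _ ∈ LinearMap.range (coinvTensorCounit M N)
  refine TensorProduct.induction_on z ?_ h2 ?_
  · rw [map_zero]; exact zero_mem _
  · intro x y hx hy
    rw [map_add]; exact add_mem hx hy

variable {M N} (e : IndCoinv N ≃ₗ[k] N.X.carrier)

/-- The map `(m, na) ↦ (m ⊗ n) ⊗ a`. -/
def coinvTensorSplit : M.X.coinv →ₗ[k] N.X.carrier →ₗ[k] IndCarrier (coinvTensorRight M N) :=
  LinearMap.lcomp k _ e.symm.toLinearMap ∘ₗ coinvTensorMk M N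

theorem coinvTensorSplit_act (he : ∀ x, e x = indCoinvCounit N x) (m : M.X.coinv)
    (n : N.X.coinv) (a : A) :
    coinvTensorSplit e m (N.actRight.lin (n.1 ⊗ₜ[k] a)) =
      indMk (coinvTensorRight M N) (coinvTmul M N (m ⊗ₜ n) ⊗ₜ a) := by
  rw [← coinvTensorMk_mk, ← indCoinvCounit_mk, ← he]
  exact congrArg (coinvTensorMk M N m) (e.symm_apply_apply _)

/-- On `na` with `n` coinvariant, `b(na) = (bn)a` by the bimodule axiom, and `bn` is again
coinvariant, so the claim becomes `mb ⊗_B n = m ⊗_B bn`. -/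
theorem coinvTensorSplit_balanced (he : ∀ x, e x = indCoinvCounit N x) (m : M.X.coinv)
    (b : CoinvAlg k H A) (n : N.X.carrier) :
    coinvTensorSplit e (coinvActRight M (m ⊗ₜ b)) n =
      coinvTensorSplit e m (N.actLeft.lin (CoinvAlg.val b ⊗ₜ[k] n)) := by
  obtain ⟨n, rfl⟩ := e.surjective n
  obtain ⟨n, rfl⟩ := indCoinvMk_surjective N n
  induction n with
  | zero => simp only [map_zero, tmul_zero]
  | add x y hx hy => simp only [map_add, tmul_add, hx, hy]
  | tmul n a =>
    rw [he, indCoinvCounit_mk, coinvTensorSplit_act e he, ← middle_assoc_coinv N _ n]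
    refine Eq.trans ?_ (coinvTensorSplit_act e he m (coinvActLeft N (b ⊗ₜ n)) a).symm
    rw [coinvTmul_balanced]

/-- The map `(ma) ⊗ (nc) ↦ (m ⊗ a n) ⊗ c`. -/
def coinvTensorInv (he : ∀ x, e x = indCoinvCounit N x) :
    IndCoinv M →ₗ[k] N.X.carrier →ₗ[k] IndCarrier (coinvTensorRight M N) :=
  indLift (TensorProduct.lift (LinearMap.lcomp k _ (TensorProduct.curry N.actLeft.lin) ∘ₗ
      LinearMap.llcomp k N.X.carrier N.X.carrier _ ∘ₗ coinvTensorSplit e)) fun m b a =>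
    LinearMap.ext fun n => by
      refine (coinvTensorSplit_balanced e he m b _).trans ?_
      exact congrArg (coinvTensorSplit e m) (act_left_assoc_coinv N b a n).symm

theorem coinvTensorInv_mk (he : ∀ x, e x = indCoinvCounit N x) (m : M.X.coinv) (a : A)
    (n : N.X.carrier) : coinvTensorInv e he (indCoinvMk M (m ⊗ₜ a)) n =
      coinvTensorSplit e m (N.actLeft.lin (a ⊗ₜ[k] n)) := rfl

variable (e' : IndCoinv M ≃ₗ[k] M.X.carrier)

/-- The map `(ma) ⊗ (nc) ↦ (m ⊗ a n) ⊗ c` on `M ⊗ N`. -/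
def tensorSplit (he : ∀ x, e x = indCoinvCounit N x) :
    M.X.carrier ⊗[k] N.X.carrier →ₗ[k] IndCarrier (coinvTensorRight M N) :=
  TensorProduct.lift (coinvTensorInv e he ∘ₗ e'.symm.toLinearMap)

theorem tensorSplit_act (he : ∀ x, e x = indCoinvCounit N x)
    (he' : ∀ x, e' x = indCoinvCounit M x) (m : M.X.coinv) (a : A) (n : N.X.carrier) :
    tensorSplit e e' he (M.actRight.lin (m.1 ⊗ₜ[k] a) ⊗ₜ[k] n) =
      coinvTensorSplit e m (N.actLeft.lin (a ⊗ₜ[k] n)) := by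
  rw [← coinvTensorInv_mk e he, ← indCoinvCounit_mk, ← he']
  exact congrArg (fun x => coinvTensorInv e he x n) (e'.symm_apply_apply _)

/-- Restates `tensorSplit_act` along the colinear map `a ↦ ma`, in a form that accepts the output of
an associator, which is not a pure tensor in general. -/
theorem orbitMap_tensor_condition (he : ∀ x, e x = indCoinvCounit N x)
    (he' : ∀ x, e' x = indCoinvCounit M x) (m : M.X.coinv) :
    tensorSplit e e' he ∘ₗ (orbitMap (HopfBimod.toRight M) m.2 ▷ N.X).lin =
      coinvTensorSplit e m ∘ₗ N.actLeft.lin :=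
  TensorProduct.ext' fun a n => by
    refine Eq.trans ?_ (tensorSplit_act e e' he he' m a n)
    exact congrArg (fun x => tensorSplit e e' he (x ⊗ₜ[k] n))
      (orbitMap_apply (HopfBimod.toRight M) m.2 a)

/-- Balancedness over all of `A`, where `ω` does not vanish. Writing the first argument as `ma` with
`m` coinvariant reduces the claim to `(ac)n` against its reassociated form, which is associativity
of the left action on `N`. -/
theorem tensorSplit_condition (he : ∀ x, e x = indCoinvCounit N x)
    (he' : ∀ x, e' x = indCoinvCounit M x) :
    tensorSplit e e' he ∘ₗ (M.actRight ▷ N.X).lin =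
      tensorSplit e e' he ∘ₗ
        ((α_ M.X (algMon k H A).X N.X).hom ≫ M.X ◁ N.actLeft).lin := by
  have h (m : M.X.coinv) (a c : A) (n : N.X.carrier) :
      tensorSplit e e' he (M.actRight.lin (M.actRight.lin (m.1 ⊗ₜ[k] a) ⊗ₜ[k] c) ⊗ₜ[k] n) =
        tensorSplit e e' he (((α_ M.X (algMon k H A).X N.X).hom ≫ M.X ◁ N.actLeft).lin
          ((M.actRight.lin (m.1 ⊗ₜ[k] a) ⊗ₜ[k] c) ⊗ₜ[k] n)) := by
    let l : (algMon k H A).X ⟶ M.X := orbitMap (HopfBimod.toRight M) m.2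
    -- Naturality of the associator along the orbit map replaces the associator of `M, A, N` by that
    -- of `A, A, N`.
    have h1 : l ▷ (algMon k H A).X ▷ N.X ≫ (α_ M.X (algMon k H A).X N.X).hom ≫
        M.X ◁ N.actLeft = ((α_ _ _ _).hom ≫ (algMon k H A).X ◁ N.actLeft) ≫ l ▷ N.X := by
      rw [Category.assoc, whisker_exchange, associator_naturality_left_assoc]
    have h2 := LinearMap.congr_fun (congrArg Comod.Hom.lin h1) ((a ⊗ₜ[k] c) ⊗ₜ[k] n)
    have h3 := LinearMap.congr_fun (congrArg Comod.Hom.lin N.left_assoc) ((a ⊗ₜ[k] c) ⊗ₜ[k] n)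
    have h4 := LinearMap.congr_fun (orbitMap_tensor_condition e e' he he' m)
    have h5 : l.lin a = M.actRight.lin (m.1 ⊗ₜ[k] a) :=
      orbitMap_apply (HopfBimod.toRight M) m.2 a
    have h6 : M.actRight.lin (M.actRight.lin (m.1 ⊗ₜ[k] a) ⊗ₜ[k] c) =
        M.actRight.lin (m.1 ⊗ₜ[k] (a * c)) :=
      act_assoc_of_mem_coinv (HopfBimod.toRight M) m.2 a c
    rw [h6, tensorSplit_act e e' he he', ← h5]
    refine Eq.trans ?_ (congrArg (tensorSplit e e' he) h2).symm
    refine Eq.trans ?_ (h4 _).symm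
    exact congrArg (coinvTensorSplit e m) h3
  refine TensorProduct.ext_threefold fun x c n => ?_
  obtain ⟨x, rfl⟩ := e'.surjective x
  obtain ⟨x, rfl⟩ := indCoinvMk_surjective M x
  induction x with
  | zero => simp only [map_zero, zero_tmul]
  | add x y hx hy => simp only [map_add, add_tmul, hx, hy]
  | tmul m a =>
    rw [he']
    exact h m a c n

/-- The balanced map `tensorSplit` descends to `M ⊗_A N` and is a left inverse. It is merely linear,
so the descent uses the coequalizer of vector spaces. -/
theorem coinvTensorCounit_injective (he : ∀ x, e x = indCoinvCounit N x)
    (he' : ∀ x, e' x = indCoinvCounit M x) : Function.Injective (coinvTensorCounit M N) := by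
  obtain ⟨g, hg⟩ := exists_tensorProj_lift _ (tensorSplit_condition e e' he he')
  have h (m : M.X.coinv) (n : N.X.coinv) (a : A) : g (coinvTensorCounit M N
      (indMk (coinvTensorRight M N) (coinvTmul M N (m ⊗ₜ n) ⊗ₜ a))) =
      indMk (coinvTensorRight M N) (coinvTmul M N (m ⊗ₜ n) ⊗ₜ a) := by
    have h1 : M.actRight.lin (m.1 ⊗ₜ[k] (1 : A)) = m.1 := right_one (HopfBimod.toRight M) m.1
    rw [coinvTensorCounit_mk, hg, ← coinvTensorSplit_act e he]
    -- Writing `m = m · 1` puts the left factor in the form `ma` on which `tensorSplit` is known.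
    conv_lhs => rw [← h1]
    rw [tensorSplit_act e e' he he', left_one]
  have h2 : g ∘ₗ coinvTensorCounit M N = LinearMap.id := ind_hom_ext fun x a => by
    obtain ⟨x, rfl⟩ := coinvTmul_surjective M N x
    induction x with
    | zero => rw [map_zero, zero_tmul, map_zero, map_zero, map_zero]
    | add x y hx hy => rw [map_add, add_tmul, map_add, map_add, map_add, hx, hy]
    | tmul m n => exact h m n a
  exact Function.LeftInverse.injective (LinearMap.congr_fun h2)

end Inverse

/-! ### Bijectivity of the multiplication map -/

noncomputable section Isomorphism

variable {k : Type u} [Field k]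
variable {H : Type u} [NonAssocRing H] [Module k H] [IsScalarTower k H H] [SMulCommClass k H H]
  [Coalgebra k H] [CoquasiHopfAlgebra k H]
variable {A : Type u} [NonAssocRing A] [Module k A] [IsScalarTower k A A] [SMulCommClass k A A]
  [ComoduleAlgebra k H A]

theorem coinvMu_bijective (hflat : IsLeftFaithfullyFlat k (CoinvAlg k H A) A)
    (hgal : IsGaloisExtension k H A) (M N : HopfBimod k H A) :
    Function.Bijective (coinvMu M N).hom := by
  have hb (M : HopfBimod k H A) : Function.Bijective (indCoinvCounit M) :=
    indCounitLin_bijective hflat hgal _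
  have h1 : Function.Bijective (coinvTensorCounit M N) :=
    ⟨coinvTensorCounit_injective (LinearEquiv.ofBijective _ (hb N))
      (LinearEquiv.ofBijective _ (hb M)) (fun _ => rfl) fun _ => rfl,
      coinvTensorCounit_surjective M N (hb M).2 (hb N).2⟩
  -- The bijective `coinvTensorCounit` is the induced multiplication map followed by the counit of
  -- `M ⊗_A N`. That counit is bijective, so the induced map is, and faithful flatness descends
  -- this.
  exact map_bijective_of_indMapLin hflat (coinvMuRight M N)
    (((hb (M ⊗ N : HopfBimod k H A)).of_comp_iff' _).1 h1)

end Isomorphism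

/-! ### Naturality, associativity and unitality of the multiplication map -/

noncomputable section Coherence

variable {k : Type u} [Field k]
variable {H : Type u} [NonAssocRing H] [Module k H] [IsScalarTower k H H] [SMulCommClass k H H]
  [Coalgebra k H] [CoquasiBialgebra k H]
variable {A : Type u} [NonAssocRing A] [Module k A] [IsScalarTower k A A] [SMulCommClass k A A]
  [ComoduleAlgebra k H A]

theorem coinvProj_natural_left {M M' : HopfBimod k H A} (f : M ⟶ M') (N : HopfBimod k H A) :
    ((coinvBimod k H A).map f).hom ▷ ((coinvBimod k H A).obj N).X ≫ coinvProj M' N =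
      coinvProj M N ≫ ((coinvBimod k H A).map (f ▷ N)).hom :=
  ModuleCat.hom_ext (TensorProduct.ext' fun m n => Subtype.ext
    (LinearMap.congr_fun (congrArg Comod.Hom.lin (tensorProj_whiskerRight f N))
      (m.1 ⊗ₜ[k] n.1)).symm)

theorem coinvProj_natural_right (M : HopfBimod k H A) {N N' : HopfBimod k H A} (f : N ⟶ N') :
    ((coinvBimod k H A).obj M).X ◁ ((coinvBimod k H A).map f).hom ≫ coinvProj M N' =
      coinvProj M N ≫ ((coinvBimod k H A).map (M ◁ f)).hom :=
  ModuleCat.hom_ext (TensorProduct.ext' fun m n => Subtype.ext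
    (LinearMap.congr_fun (congrArg Comod.Hom.lin (tensorProj_whiskerLeft M f))
      (m.1 ⊗ₜ[k] n.1)).symm)

/-- With a coinvariant in the first slot, the associator of `A`-bimodules acts on classes by mere
rebracketing; this compares it with the strict associator over `B`. -/
theorem tensorProj_associator_coinv (M N P : HopfBimod k H A) (m : M.X.coinv)
    (n : N.X.carrier) (p : P.X.carrier) :
    (α_ M N P).hom.hom.lin ((tensorProj (M ⊗ N) P).lin
        ((tensorProj M N).lin (m.1 ⊗ₜ[k] n) ⊗ₜ[k] p)) =
      (tensorProj M (N ⊗ P)).lin (m.1 ⊗ₜ[k] (tensorProj N P).lin (n ⊗ₜ[k] p)) := by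
  have h := LinearMap.congr_fun (congrArg Comod.Hom.lin (tensorProj_associator M N P))
    ((m.1 ⊗ₜ[k] n) ⊗ₜ[k] p)
  refine h.trans ?_
  change (tensorProj M (N ⊗ P)).lin ((tensorProj N P).lin.lTensor M.X.carrier
    (reassoc M.X.coact N.X.coact P.X.coact ((m.1 ⊗ₜ[k] n) ⊗ₜ[k] p))) = _
  rw [reassoc_left M.X N.X P.X m.2]
  rfl

theorem coinvProj_associator (M N P : HopfBimod k H A) :
    coinvProj M N ▷ ((coinvBimod k H A).obj P).X ≫ coinvProj (M ⊗ N) P ≫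
        ((coinvBimod k H A).map (α_ M N P).hom).hom =
      (α_ _ _ _).hom ≫ ((coinvBimod k H A).obj M).X ◁ coinvProj N P ≫ coinvProj M (N ⊗ P) :=
  ModuleCat.hom_ext (TensorProduct.ext_threefold fun m n p => Subtype.ext
    (tensorProj_associator_coinv M N P m n.1 p.1))

/-- The identity of `B` as a morphism from the unit of `_B M_B` to the coinvariants of `A`. -/
def coinvUnit : 𝟙_ (CoinvBimod k H A) ≅ (coinvBimod k H A).obj (𝟙_ (HopfBimod k H A)) :=
  Bimod.isoOfIso (Iso.refl _) (ModuleCat.hom_ext (TensorProduct.ext' fun _ _ => rfl))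
    (ModuleCat.hom_ext (TensorProduct.ext' fun _ _ => rfl))

theorem coinvProj_leftUnitor (M : HopfBimod k H A) :
    coinvUnit.hom.hom ▷ ((coinvBimod k H A).obj M).X ≫ coinvProj (𝟙_ (HopfBimod k H A)) M ≫
      ((coinvBimod k H A).map (λ_ M).hom).hom = ((coinvBimod k H A).obj M).actLeft :=
  ModuleCat.hom_ext (TensorProduct.ext' fun b m => Subtype.ext
    (LinearMap.congr_fun (congrArg Comod.Hom.lin (tensorProj_leftUnitor M))
      (CoinvAlg.val (k := k) (H := H) (A := A) b ⊗ₜ[k] m.1)))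

theorem coinvProj_rightUnitor (M : HopfBimod k H A) :
    ((coinvBimod k H A).obj M).X ◁ coinvUnit.hom.hom ≫ coinvProj M (𝟙_ (HopfBimod k H A)) ≫
      ((coinvBimod k H A).map (ρ_ M).hom).hom = ((coinvBimod k H A).obj M).actRight :=
  ModuleCat.hom_ext (TensorProduct.ext' fun m b => Subtype.ext
    (LinearMap.congr_fun (congrArg Comod.Hom.lin (tensorProj_rightUnitor M))
      (m.1 ⊗ₜ[k] CoinvAlg.val (k := k) (H := H) (A := A) b)))

theorem tensorProj_whiskerRight_coinvMu {P : CoinvBimod k H A} {M N : HopfBimod k H A}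
    (f : P ⟶ (coinvBimod k H A).obj M) :
    tensorProj P ((coinvBimod k H A).obj N) ≫ (f ▷ (coinvBimod k H A).obj N).hom ≫ coinvMu M N =
      f.hom ▷ ((coinvBimod k H A).obj N).X ≫ coinvProj M N := by
  rw [reassoc_of% (tensorProj_whiskerRight f ((coinvBimod k H A).obj N)), tensorProj_coinvMu]

theorem tensorProj_whiskerLeft_coinvMu {P : CoinvBimod k H A} {M N : HopfBimod k H A}
    (f : P ⟶ (coinvBimod k H A).obj N) :
    tensorProj ((coinvBimod k H A).obj M) P ≫ ((coinvBimod k H A).obj M ◁ f).hom ≫ coinvMu M N =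
      ((coinvBimod k H A).obj M).X ◁ f.hom ≫ coinvProj M N := by
  rw [reassoc_of% (tensorProj_whiskerLeft ((coinvBimod k H A).obj M) f), tensorProj_coinvMu]

theorem coinvMu_natural_left {M M' : HopfBimod k H A} (f : M ⟶ M') (N : HopfBimod k H A) :
    ((coinvBimod k H A).map f ▷ (coinvBimod k H A).obj N).hom ≫ coinvMu M' N =
      coinvMu M N ≫ ((coinvBimod k H A).map (f ▷ N)).hom := by
  rw [← cancel_epi (tensorProj _ _), tensorProj_whiskerRight_coinvMu, coinvProj_natural_left,
    reassoc_of% (tensorProj_coinvMu M N)]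

theorem coinvMu_natural_right (M : HopfBimod k H A) {N N' : HopfBimod k H A} (f : N ⟶ N') :
    ((coinvBimod k H A).obj M ◁ (coinvBimod k H A).map f).hom ≫ coinvMu M N' =
      coinvMu M N ≫ ((coinvBimod k H A).map (M ◁ f)).hom := by
  rw [← cancel_epi (tensorProj _ _), tensorProj_whiskerLeft_coinvMu, coinvProj_natural_right,
    reassoc_of% (tensorProj_coinvMu M N)]

/-- The map `M^coH ⊗_B N^coH → (M ⊗_A N)^coH` of bimodules. -/
def coinvMuBimod (M N : HopfBimod k H A) :
    (coinvBimod k H A).obj M ⊗ (coinvBimod k H A).obj N ⟶ (coinvBimod k H A).obj (M ⊗ N) where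
  hom := coinvMu M N
  left_act_hom := coinvMu_actLeft M N
  right_act_hom := coinvMu_actRight M N

/-- Two projections precomposed on the left remove both tensor products over `B`, leaving an
identity between maps on `M^coH ⊗ N^coH ⊗ P^coH` that is `coinvProj_associator`. -/
theorem coinvMu_associativity (M N P : HopfBimod k H A) :
    (coinvMuBimod M N ▷ (coinvBimod k H A).obj P).hom ≫ coinvMu (M ⊗ N) P ≫
        ((coinvBimod k H A).map (α_ M N P).hom).hom =
      (α_ ((coinvBimod k H A).obj M) ((coinvBimod k H A).obj N)
          ((coinvBimod k H A).obj P)).hom.hom ≫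
        ((coinvBimod k H A).obj M ◁ coinvMuBimod N P).hom ≫ coinvMu M (N ⊗ P) := by
  rw [← cancel_epi (tensorProj _ _), ← cancel_epi (tensorProj _ _ ▷ _),
    reassoc_of% (tensorProj_whiskerRight_coinvMu (N := P) (coinvMuBimod M N)),
    reassoc_of% (tensorProj_associator ((coinvBimod k H A).obj M) ((coinvBimod k H A).obj N)
      ((coinvBimod k H A).obj P)),
    tensorProj_whiskerLeft_coinvMu (coinvMuBimod N P)]
  have h1 (M N : HopfBimod k H A) : tensorProj _ _ ≫ (coinvMuBimod M N).hom = coinvProj M N :=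
    tensorProj_coinvMu M N
  rw [← comp_whiskerRight_assoc, h1, ← whiskerLeft_comp_assoc, h1, coinvProj_associator]

theorem coinvMu_leftUnitality (M : HopfBimod k H A) :
    (λ_ ((coinvBimod k H A).obj M)).hom.hom =
      (coinvUnit.hom ▷ (coinvBimod k H A).obj M).hom ≫ coinvMu (𝟙_ (HopfBimod k H A)) M ≫
        ((coinvBimod k H A).map (λ_ M).hom).hom := by
  rw [← cancel_epi (tensorProj _ _), tensorProj_leftUnitor,
    reassoc_of% (tensorProj_whiskerRight_coinvMu (N := M) coinvUnit.hom), coinvProj_leftUnitor]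

theorem coinvMu_rightUnitality (M : HopfBimod k H A) :
    (ρ_ ((coinvBimod k H A).obj M)).hom.hom =
      ((coinvBimod k H A).obj M ◁ coinvUnit.hom).hom ≫ coinvMu M (𝟙_ (HopfBimod k H A)) ≫
        ((coinvBimod k H A).map (ρ_ M).hom).hom := by
  rw [← cancel_epi (tensorProj _ _), tensorProj_rightUnitor,
    reassoc_of% (tensorProj_whiskerLeft_coinvMu (M := M) coinvUnit.hom), coinvProj_rightUnitor]

end Coherence

/-! ### The monoidal structure and the main theorem -/

noncomputable section Monoidal

variable {k : Type u} [Field k]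
variable {H : Type u} [NonAssocRing H] [Module k H] [IsScalarTower k H H] [SMulCommClass k H H]
  [Coalgebra k H] [CoquasiHopfAlgebra k H]
variable {A : Type u} [NonAssocRing A] [Module k A] [IsScalarTower k A A] [SMulCommClass k A A]
  [ComoduleAlgebra k H A]

/-- The isomorphism `M^coH ⊗_B N^coH ≅ (M ⊗_A N)^coH`. -/
def coinvMuIso (hflat : IsLeftFaithfullyFlat k (CoinvAlg k H A) A)
    (hgal : IsGaloisExtension k H A) (M N : HopfBimod k H A) :
    (coinvBimod k H A).obj M ⊗ (coinvBimod k H A).obj N ≅ (coinvBimod k H A).obj (M ⊗ N) :=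
  have := (ConcreteCategory.isIso_iff_bijective (coinvMu M N)).2 (coinvMu_bijective hflat hgal M N)
  Bimod.isoOfIso (asIso (coinvMu M N)) (coinvMu_actLeft M N) (coinvMu_actRight M N)

/-- The functor of coinvariants of two-sided Hopf modules is monoidal. -/
def coinvCoreMonoidal (hflat : IsLeftFaithfullyFlat k (CoinvAlg k H A) A)
    (hgal : IsGaloisExtension k H A) : (coinvBimod k H A).CoreMonoidal where
  εIso := coinvUnit
  μIso := coinvMuIso hflat hgal
  μIso_hom_natural_left f N := Bimod.hom_ext _ _ (coinvMu_natural_left f N)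
  μIso_hom_natural_right M f := Bimod.hom_ext _ _ (coinvMu_natural_right M f)
  associativity M N P := Bimod.hom_ext _ _ (coinvMu_associativity M N P)
  left_unitality M := Bimod.hom_ext _ _ (coinvMu_leftUnitality M)
  right_unitality M := Bimod.hom_ext _ _ (coinvMu_rightUnitality M)

end Monoidal

end CoquasiGalois

theorem mainTheorem7 (k : Type u) [Field k] (H : Type u) [NonAssocRing H] [Module k H]
    [IsScalarTower k H H] [SMulCommClass k H H] [Coalgebra k H] [CoquasiHopfAlgebra k H]
    (hS : Function.Bijective (CoquasiHopfAlgebra.S (k := k) (H := H)))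
    (A : Type u) [NonAssocRing A] [Module k A] [IsScalarTower k A A] [SMulCommClass k A A]
    [ComoduleAlgebra k H A]
    (hflat : IsLeftFaithfullyFlat k (CoinvAlg k H A) A)
    (hgal : IsGaloisExtension k H A) :
    (coinvRight k H A).IsEquivalence ∧
    coinvBimod k H A ⋙ forgetLeft (coinvMon k H A) (coinvMon k H A) =
      forgetLeft (algMon k H A) (algMon k H A) ⋙ coinvRight k H A ∧
    ∃ F : (coinvBimod k H A).Monoidal,
      (∀ (M N : HopfBimod k H A) (m : M.X.coinv) (n : N.X.coinv),
        (M ⊗ N).X.coinv.subtype ((F.μ M N).hom.hom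
          ((tensorProj ((coinvBimod k H A).obj M) ((coinvBimod k H A).obj N)).hom (m ⊗ₜ[k] n))) =
        (tensorProj M N).lin (m.1 ⊗ₜ[k] n.1)) ∧
      ∀ b : CoinvAlg k H A, (algComod k H A).coinv.subtype (F.ε.hom.hom b) = CoinvAlg.val b :=
  by
  -- Compatibility with forgetting the left action is definitional, since both functors restrict the
  -- right action to coinvariants in the same way. The same holds for the unit constraint, the
  -- identity of `B`.
  refine ⟨isEquivalence_coinvRight hflat hgal, rfl,
    (coinvCoreMonoidal hflat hgal).toMonoidal, fun M N m n => ?_, fun b => rfl⟩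
  exact coinvMu_mk M N m n
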